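/- Let $n\ge 2$ be an integer, and let $M\subset\mathbb{C}^{n+n(n-1)/2}$, with coordinates $(z_i)_{1\le i\le n}$, $(w_{ij})_{1\le i<j\le n}$, be the real quadric $$w_{ij}-\overline{w}_{ij}=z_i\overline{z}_j-\overline{z}_iz_j\qquad(1\le i<j\le n).$$ Let $U\subset\mathbb{C}^{n+n(n-1)/2}$ be a connected open set meeting $M$ (for instance the whole space, or a small ball around a point of $M$), and let $\mathfrak{hol}(M)$ be the real Lie algebra, under the Lie bracket of vector fields, of all holomorphic vector fields $L=\sum_i Z_i(z,w)\,\partial_{z_i}+\sum_{i<j}W_{ij}(z,w)\,\partial_{w_{ij}}$ on $U$ such that $(L+\overline{L})|_{M\cap U}$ is tangent to $M$. Give $z_i$ weight $1$, $w_{ij}$ weight $2$, $\partial_{z_i}$ weight $-1$ and $\partial_{w_{ij}}$ weight $-2$. For $k\in\mathbb{Z}$ let $\mathfrak{g}_k\subset\mathfrak{hol}(M)$ be the real subspace of the fields with polynomial coefficients all of whose terms have weight $k$, i.e. each $Z_i$ is a weighted homogeneous polynomial of weight $k+1$ and each $W_{ij}$ one of weight $k+2$. Then $\mathfrak{hol}(M)=\bigoplus_{k\in\mathbb{Z}}\mathfrak{g}_k$,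 $[\mathfrak{g}_a,\mathfrak{g}_b]\subset\mathfrak{g}_{a+b}$, and $\mathfrak{g}_k=0$ for $|k|\ge3$. The real dimensions of $\mathfrak{g}_{-2},\mathfrak{g}_{-1},\mathfrak{g}_0,\mathfrak{g}_1,\mathfrak{g}_2$ are $$\tfrac{n(n-1)}2,\quad 2n,\quad n^2+1,\quad 2n,\quad \tfrac{n(n-1)}2 .$$ Put $w_{ji}:=-w_{ij}$ for $i<j$ and $w_{ii}:=0$, and let $\delta$ be the Kronecker symbol. The graded pieces are spanned over $\mathbb{R}$ by (the restrictions to $U$ of) the following fields. * $\mathfrak{g}_{-2}$: $\;\partial_{w_{ij}}$ for $1\le i<j\le n$. * $\mathfrak{g}_{-1}$: for $1\le i\le n$, $$L^{-1}_{z_i}=\partial_{z_i}+\sum_{k<i}z_k\,\partial_{w_{ki}}-\sum_{i<k}z_k\,\partial_{w_{ik}},\qquad IL^{-1}_{z_i}=\sqrt{-1}\,\partial_{z_i}-\sum_{k<i}\sqrt{-1}\,z_k\,\partial_{w_{ki}}+\sum_{i<k}\sqrt{-1}\,z_k\,\partial_{w_{ik}}.$$ * $\mathfrak{g}_0$: for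 $1\le i,j\le n$, $$L^0_{ij}=z_i\,\partial_{z_j}+\sum_{k<l}\big(\delta_{jl}\,w_{ki}+\delta_{jk}\,w_{il}\big)\,\partial_{w_{kl}},$$ together with the rotation $R=\sqrt{-1}\sum_{k}z_k\,\partial_{z_k}$. * $\mathfrak{g}_1$: for $1\le i\le n$, $$L^1_{z_iz_i}=\sum_k\big(z_iz_k-w_{ki}\big)\,\partial_{z_k}+\sum_{k<l}\big(z_lw_{ki}-z_kw_{li}\big)\,\partial_{w_{kl}},$$ $$IL^1_{z_iz_i}=\sqrt{-1}\sum_k\big(z_iz_k+w_{ki}\big)\,\partial_{z_k}+\sqrt{-1}\sum_{k<l}\big(z_lw_{ki}-z_kw_{li}\big)\,\partial_{w_{kl}}.$$ * $\mathfrak{g}_2$: for $1\le i<j\le n$, $$L^2_{w_{ij}w_{ij}}=\sum_k\big(z_iw_{kj}-z_jw_{ki}\big)\,\partial_{z_k}+\sum_{k<l}\big(w_{ki}w_{lj}-w_{kj}w_{li}\big)\,\partial_{w_{kl}}.$$ Finally, $\mathfrak{hol}(M)$ is isomorphic, as a real Lie algebra, to $\mathfrak{so}(n+2,n)$. -/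

import Mathlib

open scoped ComplexConjugate

noncomputable section

namespace SOQuadric

/-- Pairs `(i, j)` with `i < j`: the indices of the coordinates `w_{ij}`. -/
abbrev Pairs (n : ℕ) : Type := {p : Fin n × Fin n // p.1 < p.2}

/-- Indices of the coordinates `(z_i)`, `(w_{ij})_{i<j}` on `ℂ^{n + n(n-1)/2}`. -/
abbrev Idx (n : ℕ) : Type := Fin n ⊕ Pairs n

/-- The ambient space `ℂ^{n + n(n-1)/2}`. -/
abbrev Amb (n : ℕ) : Type := Idx n → ℂ

variable {n : ℕ}

/-- The coordinate `z_i`. -/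
def z (x : Amb n) (i : Fin n) : ℂ := x (Sum.inl i)

/-- The coordinates `w_{ij}`, extended to all pairs of indices by `w_{ji} = -w_{ij}`, `w_{ii} = 0`. -/
def w (x : Amb n) (i j : Fin n) : ℂ :=
  if h : i < j then x (Sum.inr ⟨(i, j), h⟩)
  else if h : j < i then -x (Sum.inr ⟨(j, i), h⟩)
  else 0

/-- The defining functions `w_{ij} - w̄_{ij} - (z_i z̄_j - z̄_i z_j)`, `i < j`. -/
def rho (p : Pairs n) (x : Amb n) : ℂ :=
  x (Sum.inr p) - conj (x (Sum.inr p)) -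
    (z x p.1.1 * conj (z x p.1.2) - conj (z x p.1.1) * z x p.1.2)

/-- The quadric `M`. -/
def quadric (n : ℕ) : Set (Amb n) := {x | ∀ p : Pairs n, rho p x = 0}

/-- A (coefficient vector of a) holomorphic vector field `L = ∑ X_s ∂_s` is tangent at `x` if
`L + L̄` annihilates all the defining functions at `x`. As a derivation, `L + L̄` is the real
directional derivative in the direction of the vector `X x`. -/
def TangentAt (X : Amb n → Amb n) (x : Amb n) : Prop :=
  ∀ p : Pairs n, fderiv ℝ (rho p) x (X x) = 0

/-- The real derivative of `rho p`. -/
lemma hasFDerivAt_rho (p : Pairs n) (x : Amb n) :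
    ∃ D : Amb n →L[ℝ] ℂ, HasFDerivAt (rho p) D x ∧ ∀ v : Amb n,
      D v = v (Sum.inr p) - conj (v (Sum.inr p)) -
        (z v p.1.1 * conj (z x p.1.2) + z x p.1.1 * conj (z v p.1.2)
          - conj (z v p.1.1) * z x p.1.2 - conj (z x p.1.1) * z v p.1.2) := by
  have hc : ∀ s : Idx n, HasFDerivAt (fun y : Amb n => y s)
      (ContinuousLinearMap.proj (R := ℝ) (φ := fun _ : Idx n => ℂ) s) x := fun s =>
    (ContinuousLinearMap.proj (R := ℝ) (φ := fun _ : Idx n => ℂ) s).hasFDerivAt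
  have hb : ∀ s : Idx n, HasFDerivAt (fun y : Amb n => conj (y s))
      ((Complex.conjCLE : ℂ →L[ℝ] ℂ).comp
        (ContinuousLinearMap.proj (R := ℝ) (φ := fun _ : Idx n => ℂ) s)) x := fun s =>
    ((Complex.conjCLE : ℂ →L[ℝ] ℂ).comp
      (ContinuousLinearMap.proj (R := ℝ) (φ := fun _ : Idx n => ℂ) s)).hasFDerivAt
  refine ⟨_, ((hc (Sum.inr p)).sub (hb (Sum.inr p))).sub
    (((hc (Sum.inl p.1.1)).mul (hb (Sum.inl p.1.2))).sub
      ((hb (Sum.inl p.1.1)).mul (hc (Sum.inl p.1.2)))), ?_⟩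
  intro v
  simp [z]
  ring

lemma fderiv_rho (p : Pairs n) (x v : Amb n) :
    fderiv ℝ (rho p) x v = v (Sum.inr p) - conj (v (Sum.inr p)) -
        (z v p.1.1 * conj (z x p.1.2) + z x p.1.1 * conj (z v p.1.2)
          - conj (z v p.1.1) * z x p.1.2 - conj (z x p.1.1) * z v p.1.2) := by
  obtain ⟨D, hD, h⟩ := hasFDerivAt_rho p x
  rw [hD.fderiv, h]

/-- `hol(M)` over an open set `U`: the real vector space of all holomorphic vector fields `X` on `U`
whose double real part is tangent to `M` at all points of `M ∩ U`. A field on `U` is represented by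
its extension by zero outside `U`. -/
def Hol (U : TopologicalSpace.Opens (Amb n)) : Submodule ℝ (Amb n → Amb n) where
  carrier := {X | AnalyticOnNhd ℂ X (U : Set (Amb n)) ∧ (∀ x ∉ U, X x = 0) ∧
    ∀ x ∈ quadric n, x ∈ U → TangentAt X x}
  add_mem' := by
    rintro X Y ⟨h1, h2, h3⟩ ⟨k1, k2, k3⟩
    refine ⟨h1.add k1, fun x hx => by simp [h2 x hx, k2 x hx], fun x hM hx p => ?_⟩
    rw [Pi.add_apply, map_add, h3 x hM hx p, k3 x hM hx p, add_zero]
  zero_mem' := ⟨analyticOnNhd_const, fun _ _ => rfl, fun x _ _ p => by simp⟩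
  smul_mem' := by
    rintro c X ⟨h1, h2, h3⟩
    refine ⟨?_, fun x hx => by simp [h2 x hx], fun x hM hx p => ?_⟩
    · have : c • X = (fun _ : Amb n => (c : ℂ)) • X := by
        ext x s
        simp
      rw [this]
      exact fun x hx => (analyticAt_const (v := (c : ℂ))).smul (h1 x hx)
    · rw [Pi.smul_apply, map_smul, h3 x hM hx p, smul_zero]

/-- Differentiating the tangency condition of `Y` along a direction tangent to `M`. -/
lemma deriv_tangent {U : TopologicalSpace.Opens (Amb n)} {X Y : Amb n → Amb n}
    (hX : X ∈ Hol U) (hY : Y ∈ Hol U) {x : Amb n} (hM : x ∈ quadric n) (hx : x ∈ U)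
    (p : Pairs n) :
    fderiv ℝ (rho p) x (fderiv ℂ Y x (X x)) =
      z (Y x) p.1.1 * conj (z (X x) p.1.2) + z (X x) p.1.1 * conj (z (Y x) p.1.2)
          - conj (z (Y x) p.1.1) * z (X x) p.1.2 - conj (z (X x) p.1.1) * z (Y x) p.1.2 := by
  set v := X x with hv
  -- a quadratic curve in `M` through `x` with velocity `v`
  let c : Amb n := Sum.elim (fun _ => 0) fun q =>
    (1 / 2 : ℂ) * (z v q.1.1 * conj (z v q.1.2) - conj (z v q.1.1) * z v q.1.2)
  let γ : ℝ → Amb n := fun t => x + t • v + t ^ 2 • c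
  have hγ0 : γ 0 = x := by simp [γ]
  have hγ : HasDerivAt γ v 0 := by
    have h1 : HasDerivAt (fun t : ℝ => t • v) ((1 : ℝ) • v) 0 := (hasDerivAt_id (0 : ℝ)).smul_const v
    have h2 : HasDerivAt (fun t : ℝ => t ^ 2 • c) ((2 * (0 : ℝ)) • c) 0 := by
      have := (hasDerivAt_pow 2 (0 : ℝ)).smul_const c
      simpa using this
    have h3 : HasDerivAt γ (0 + (1 : ℝ) • v + (2 * (0 : ℝ)) • c) 0 :=
      ((hasDerivAt_const (0 : ℝ) x).add h1).add h2
    simpa using h3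
  have hγM : ∀ t, γ t ∈ quadric n := by
    intro t q
    have e1 := hM q
    have e2 := hX.2.2 x hM hx q
    rw [← hv, fderiv_rho] at e2
    simp only [rho, z] at e1
    simp only [z] at e2
    simp only [rho, γ, c, z, Pi.add_apply, Pi.smul_apply, Sum.elim_inr, Sum.elim_inl,
      Complex.real_smul, map_add, map_mul, map_sub, Complex.conj_ofReal, Complex.conj_conj,
      map_div₀, map_one, map_ofNat, mul_zero, add_zero]
    push_cast
    linear_combination e1 + (t : ℂ) * e2
  have hYd : HasFDerivAt Y ((fderiv ℂ Y x).restrictScalars ℝ) x :=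
    (hY.1 x hx).differentiableAt.hasFDerivAt.restrictScalars ℝ
  have hYγ : HasDerivAt (fun t => Y (γ t)) (fderiv ℂ Y x v) 0 := by
    have h0 : HasFDerivAt Y ((fderiv ℂ Y x).restrictScalars ℝ) (γ 0) := by rw [hγ0]; exact hYd
    exact h0.comp_hasDerivAt (0 : ℝ) hγ
  have hev : ∀ᶠ t in nhds (0 : ℝ), γ t ∈ U := by
    apply hγ.continuousAt.eventually_mem
    rw [hγ0]
    exact U.isOpen.mem_nhds hx
  have hcoord : ∀ (f : ℝ → Amb n) (f' : Amb n), HasDerivAt f f' 0 → ∀ s,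
      HasDerivAt (fun t => f t s) (f' s) 0 := fun f f' hf s => (hasDerivAt_pi.1 hf) s
  have hconj : ∀ (f : ℝ → ℂ) (f' : ℂ), HasDerivAt f f' 0 →
      HasDerivAt (fun t => conj (f t)) (conj f') 0 := fun f f' hf =>
    (Complex.conjCLE : ℂ →L[ℝ] ℂ).hasFDerivAt.comp_hasDerivAt (0 : ℝ) hf
  have a := hcoord _ _ hYγ
  have b := hcoord _ _ hγ
  have ha := fun s => hconj _ _ (a s)
  have hb := fun s => hconj _ _ (b s)
  have key := (((a (Sum.inr p)).sub (ha (Sum.inr p))).sub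
    (((((a (Sum.inl p.1.1)).mul (hb (Sum.inl p.1.2))).add
      ((b (Sum.inl p.1.1)).mul (ha (Sum.inl p.1.2)))).sub
      ((ha (Sum.inl p.1.1)).mul (b (Sum.inl p.1.2)))).sub
      ((hb (Sum.inl p.1.1)).mul (a (Sum.inl p.1.2)))))
  have hz := key.congr_of_eventuallyEq (f₁ := fun _ => (0 : ℂ)) (by
    filter_upwards [hev] with t ht
    have := hY.2.2 _ (hγM t) ht p
    rw [fderiv_rho] at this
    exact this.symm)
  have := hz.unique (hasDerivAt_const (0 : ℝ) (0 : ℂ))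
  rw [hγ0] at this
  rw [fderiv_rho]
  simp only [z]
  linear_combination this

/-- `hol(M)` is closed under the Lie bracket of vector fields. -/
lemma lieBracket_mem {U : TopologicalSpace.Opens (Amb n)} {X Y : Amb n → Amb n}
    (hX : X ∈ Hol U) (hY : Y ∈ Hol U) : VectorField.lieBracket ℂ X Y ∈ Hol U := by
  refine ⟨?_, fun x hx => ?_, fun x hM hx p => ?_⟩
  · intro x hx
    have key : ∀ V W : Amb n → Amb n, AnalyticAt ℂ V x → AnalyticAt ℂ W x →
        AnalyticAt ℂ (fun y => fderiv ℂ V y (W y)) x := fun V W hV hW =>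
      (ContinuousLinearMap.analyticAt_bilinear
        (ContinuousLinearMap.id ℂ (Amb n →L[ℂ] Amb n)) (fderiv ℂ V x, W x)).comp₂ hV.fderiv hW
    exact (key Y X (hY.1 x hx) (hX.1 x hx)).sub (key X Y (hX.1 x hx) (hY.1 x hx))
  · exact VectorField.lieBracket_eq_zero_of_eq_zero (hX.2.1 x hx) (hY.2.1 x hx)
  · rw [VectorField.lieBracket, map_sub, deriv_tangent hX hY hM hx, deriv_tangent hY hX hM hx]
    ring

variable {U : TopologicalSpace.Opens (Amb n)}

/-- The bracket on `hol(M)` is the Lie bracket of vector fields,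
`[X, Y]^s = ∑_r (X^r ∂_r Y^s - Y^r ∂_r X^s)`. -/
instance : Bracket (Hol U) (Hol U) :=
  ⟨fun X Y => ⟨VectorField.lieBracket ℂ (X : Amb n → Amb n) Y, lieBracket_mem X.2 Y.2⟩⟩

lemma coe_bracket (X Y : Hol U) :
    ((⁅X, Y⁆ : Hol U) : Amb n → Amb n) = VectorField.lieBracket ℂ (X : Amb n → Amb n) Y := rfl

lemma hol_diff (X : Hol U) {x : Amb n} (hx : x ∈ U) :
    DifferentiableAt ℂ (X : Amb n → Amb n) x := (X.2.1 x hx).differentiableAt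

lemma hol_ext {X Y : Hol U}
    (h : ∀ x ∈ U, (X : Amb n → Amb n) x = (Y : Amb n → Amb n) x) : X = Y := by
  ext1
  funext x
  by_cases hx : x ∈ U
  · exact h x hx
  · rw [X.2.2.1 x hx, Y.2.2.1 x hx]

instance : LieRing (Hol U) where
  add_lie X Y Z := hol_ext fun x hx => by
    simpa [coe_bracket] using VectorField.lieBracket_add_left (W := (Z : Amb n → Amb n))
      (hol_diff X hx) (hol_diff Y hx)
  lie_add X Y Z := hol_ext fun x hx => by
    simpa [coe_bracket] using VectorField.lieBracket_add_right (V := (X : Amb n → Amb n))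
      (hol_diff Y hx) (hol_diff Z hx)
  lie_self X := hol_ext fun x _ => by simp [coe_bracket]
  leibniz_lie X Y Z := hol_ext fun x hx => by
    simpa [coe_bracket] using VectorField.leibniz_identity_lieBracket (𝕜 := ℂ) (n := ⊤)
      (by simp) (X.2.1 x hx).contDiffAt (Y.2.1 x hx).contDiffAt
      (Z.2.1 x hx).contDiffAt

instance : LieAlgebra ℝ (Hol U) where
  lie_smul c X Y := hol_ext fun x hx => by
    have h := VectorField.lieBracket_const_smul_right (V := (X : Amb n → Amb n)) (c := (c : ℂ))
      (hol_diff Y hx)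
    have e : ((c • Y : Hol U) : Amb n → Amb n) = (c : ℂ) • (Y : Amb n → Amb n) := by
      ext x s
      simp
    rw [coe_bracket, e, h]
    ext s
    rw [Submodule.coe_smul, coe_bracket]
    simp

/-- The weights of the coordinates: `[z_i] = 1`, `[w_{ij}] = 2`. -/
def wt : Idx n → ℤ := Sum.elim (fun _ => 1) fun _ => 2

/-- The graded piece `𝔤_k` of `hol(M)`: the fields whose `∂_s`-component is (the restriction to `U`
of) a polynomial that is weighted homogeneous of weight `k + [s]`, for every coordinate `s`. -/
def grade (U : TopologicalSpace.Opens (Amb n)) (k : ℤ) : Submodule ℝ (Hol U) where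
  carrier := {X | ∃ P : Idx n → MvPolynomial (Idx n) ℂ,
    (∀ s, (P s).IsWeightedHomogeneous wt (k + wt s)) ∧
    ∀ x ∈ U, ∀ s, (X : Amb n → Amb n) x s = MvPolynomial.eval x (P s)}
  add_mem' := by
    rintro X Y ⟨P, hP, h⟩ ⟨Q, hQ, h'⟩
    exact ⟨fun s => P s + Q s, fun s => (hP s).add (hQ s), fun x hx s => by
      simp [h x hx s, h' x hx s]⟩
  zero_mem' := ⟨fun _ => 0, fun s => MvPolynomial.isWeightedHomogeneous_zero _ _ _,
    fun x _ s => by simp⟩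
  smul_mem' := by
    rintro c X ⟨P, hP, h⟩
    refine ⟨fun s => MvPolynomial.C (c : ℂ) * P s, fun s => ?_, fun x hx s => by
      simp [h x hx s]⟩
    simpa using (MvPolynomial.isWeightedHomogeneous_C wt (c : ℂ)).mul (hP s)

/-- The vector field `∑_k A_k ∂_{z_k} + ∑_{k<l} C_{kl} ∂_{w_{kl}}`. -/
def field (A : Amb n → Fin n → ℂ) (C : Amb n → Fin n → Fin n → ℂ) : Amb n → Amb n :=
  fun x => Sum.elim (fun k => A x k) fun p => C x p.1.1 p.1.2

/-- Kronecker symbol. -/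
def δ (i j : Fin n) : ℂ := if i = j then 1 else 0

/-! ### The generators

All of them are written with the skew convention `w_{ji} = -w_{ij}`, `w_{ii} = 0`, which merges the
case distinctions on the relative order of the indices. -/

/-- `∂_{w_{ij}}`. -/
def Lm2 (p : Pairs n) : Amb n → Amb n :=
  field (fun _ _ => 0) fun _ k l => δ p.1.1 k * δ p.1.2 l

/-- `∂_{z_i} + ∑_{k<i} z_k ∂_{w_{ki}} - ∑_{i<k} z_k ∂_{w_{ik}}`. -/
def Lm1 (i : Fin n) : Amb n → Amb n :=
  field (fun _ k => δ i k) fun x k l => δ i l * z x k - δ i k * z x l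

/-- `√-1 ∂_{z_i} - ∑_{k<i} √-1 z_k ∂_{w_{ki}} + ∑_{i<k} √-1 z_k ∂_{w_{ik}}`. -/
def ILm1 (i : Fin n) : Amb n → Amb n :=
  field (fun _ k => Complex.I * δ i k) fun x k l =>
    -(Complex.I * (δ i l * z x k - δ i k * z x l))

/-- `L^0_{ij}`, for arbitrary `i, j`: `z_i ∂_{z_j}` plus the linear field in `w` that acts on the
skew-symmetric matrix `w` by `∑_k w_{ki} ∂_{w_{kj}}`, where `∂_{w_{kj}} = -∂_{w_{jk}}` and
`∂_{w_{jj}} = 0`. -/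
def L0 (i j : Fin n) : Amb n → Amb n :=
  field (fun x k => δ j k * z x i) fun x k l => δ j l * w x k i + δ j k * w x i l

/-- The rotation `∑_k √-1 z_k ∂_{z_k}`. -/
def Rot : Amb n → Amb n :=
  field (fun x k => Complex.I * z x k) fun _ _ _ => 0

/-- `L^1_{z_i z_i}`. -/
def L1 (i : Fin n) : Amb n → Amb n :=
  field (fun x k => z x i * z x k - w x k i) fun x k l => z x l * w x k i - z x k * w x l i

/-- `IL^1_{z_i z_i}`. -/
def IL1 (i : Fin n) : Amb n → Amb n :=
  field (fun x k => Complex.I * (z x i * z x k + w x k i)) fun x k l =>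
    Complex.I * (z x l * w x k i - z x k * w x l i)

/-- `L^2_{w_{ij} w_{ij}}`, `i < j`. -/
def L2 (p : Pairs n) : Amb n → Amb n :=
  field (fun x k => z x p.1.1 * w x k p.1.2 - z x p.1.2 * w x k p.1.1) fun x k l =>
    w x k p.1.1 * w x l p.1.2 - w x k p.1.2 * w x l p.1.1

/-- The real span of the restrictions to `U` (extended by zero) of a set of vector fields. -/
def spanOn (U : TopologicalSpace.Opens (Amb n)) (S : Set (Amb n → Amb n)) :
    Submodule ℝ (Amb n → Amb n) :=
  Submodule.span ℝ ((fun L => (U : Set (Amb n)).indicator L) '' S)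

/-- A subspace of `hol(M)`, seen as a space of vector fields. -/
def fields (V : Submodule ℝ (Hol U)) : Submodule ℝ (Amb n → Amb n) :=
  V.map (Hol U).subtype

end SOQuadric

end

noncomputable section

namespace SOQuadric

variable {n : ℕ}

/-! That the listed fields are tangent is a computation; the content is the converse. For a
holomorphic field the tangency equation survives when the conjugate point is replaced by an
independent one: it holds for all nearby pairs `(u, v)`, `(ζ, ω)` with `v = ω + u ∧ ζ`
(`polarization`, `polarization_pt`). This functional equation is strongly overdetermined.

Its derivative at `ζ = 0`, with `(u, v)` fixed, solves for the `z`-components and shows that they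
have degree at most two in `z` (`exists_quadratic`); at `ζ = 0` itself it expresses the
`w`-components through values on `{z = 0}` (`w_eq`). The constraint is invariant under `(u, ζ) ↦ (c
u, c⁻¹ ζ)`, so the equation splits by powers of `c` (`separated`): the parts of degree 0 and 2 in
`z` determine each other, and the part of degree 1, a matrix depending on `w`, is coupled to the
`w`-components. Each piece prescribes increments in the directions `u ∧ ζ`. Equality of mixed
derivatives then forces the degree 0 part and the matrix to be affine in `w` (`z_component_affine`,
`oddMat_affine`). For `n = 2` there is a single variable `w` and mixed derivatives say nothing;
there the second derivative is killed because the increments are known along whole lines, not only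
to first order. Comparison with the conjugated data cuts the parameters down to the right reality
conditions (`z_component_eq`).

After subtracting the combination of generators with these parameters, the `z`-components vanish and
the `w`-components are real constants (`exists_comb_of_ball`). The quadric is affinely homogeneous,
so any base point can be moved to `0`, and the identity theorem passes to a connected `U`
(`exists_comb`). Together with linear independence (`eq_zero_of_comb`) this gives `holBasis`.

The grading is an eigenvalue statement: the Euler field `∑ L0 i i` acts on `grade U k` as the scalar
`k` (`euler_lie`), and the basis consists of eigenvectors.

For the isomorphism, `(z, w)` is written as a skew matrix `Y` of size `n + 1`, whose graph is a
maximal isotropic subspace of `ℂ^{2n+2}`. Combinations of generators become the fields `B + AY - YD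
- YCY` of the linear action on graphs (`skewMat_comb`), whose bracket is minus the matrix commutator
(`skewMat_lieBracket`). The block matrices that occur are the elements of `so(n+2, n)` written in a
complex isotropic basis (`soMat_eq`). -/

/-! ### Tangency of the generators -/

lemma w_swap (x : Amb n) (i j : Fin n) : w x j i = -w x i j := by
  rcases lt_trichotomy i j with h | rfl | h
  · simp [w, h, h.not_gt]
  · simp [w]
  · simp [w, h, h.not_gt]

@[simp] lemma w_self (x : Amb n) (i : Fin n) : w x i i = 0 := by simp [w]

lemma w_pair (x : Amb n) (p : Pairs n) : w x p.1.1 p.1.2 = x (Sum.inr p) := by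
  simp [w, p.2]

/-- Both sides are skew in `i, j`, so the defining equations for `i < j` suffice. Rewriting with it
turns tangency of a polynomial field into an identity in `z`, its conjugate and `w`, which `ring`
decides. -/
lemma conj_w {x : Amb n} (hx : x ∈ quadric n) (i j : Fin n) :
    conj (w x i j) = w x i j - (z x i * conj (z x j) - conj (z x i) * z x j) := by
  rcases lt_trichotomy i j with h | rfl | h
  · have := hx ⟨(i, j), h⟩
    simp only [rho] at this
    simp only [w, h, dif_pos]
    linear_combination -this
  · simp; ring
  · have := hx ⟨(j, i), h⟩
    simp only [rho] at this
    simp only [w, h, dif_pos, h.not_gt, dif_neg, not_false_eq_true, map_neg]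
    linear_combination this

lemma tangentAt_field {A : Amb n → Fin n → ℂ} {C : Amb n → Fin n → Fin n → ℂ} {x : Amb n}
    (h : ∀ k l, C x k l - conj (C x k l) = A x k * conj (z x l) + z x k * conj (A x l)
      - conj (A x k) * z x l - conj (z x k) * A x l) : TangentAt (field A C) x := by
  intro p
  rw [fderiv_rho]
  simpa [field, z, sub_eq_zero] using h p.1.1 p.1.2

@[simp] lemma conj_δ (i j : Fin n) : conj (δ i j) = δ i j := by
  unfold δ; split_ifs <;> simp

lemma tangentAt_Lm2 (p : Pairs n) (x : Amb n) : TangentAt (Lm2 p) x :=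
  tangentAt_field fun k l => by simp

lemma tangentAt_Lm1 (i : Fin n) (x : Amb n) : TangentAt (Lm1 i) x :=
  tangentAt_field fun k l => by simp; ring

lemma tangentAt_ILm1 (i : Fin n) (x : Amb n) : TangentAt (ILm1 i) x :=
  tangentAt_field fun k l => by simp; ring

lemma tangentAt_L0 (i j : Fin n) {x : Amb n} (hx : x ∈ quadric n) : TangentAt (L0 i j) x :=
  tangentAt_field fun k l => by simp [conj_w hx]; ring

lemma tangentAt_Rot (x : Amb n) : TangentAt Rot x :=
  tangentAt_field fun k l => by simp; ring

lemma tangentAt_L1 (i : Fin n) {x : Amb n} (hx : x ∈ quadric n) : TangentAt (L1 i) x :=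
  tangentAt_field fun k l => by simp [conj_w hx]; ring

lemma tangentAt_IL1 (i : Fin n) {x : Amb n} (hx : x ∈ quadric n) : TangentAt (IL1 i) x :=
  tangentAt_field fun k l => by simp [conj_w hx]; ring

lemma tangentAt_L2 (p : Pairs n) {x : Amb n} (hx : x ∈ quadric n) : TangentAt (L2 p) x :=
  tangentAt_field fun k l => by simp [conj_w hx]; ring

/-- Indices of the generators of `hol(M)`. -/
abbrev GenIdx (n : ℕ) : Type :=
  Pairs n ⊕ (Fin n ⊕ Fin n) ⊕ ((Fin n × Fin n) ⊕ Unit) ⊕ (Fin n ⊕ Fin n) ⊕ Pairs n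

/-- The generators of `hol(M)`. -/
def gen : GenIdx n → Amb n → Amb n :=
  Sum.elim Lm2 (Sum.elim (Sum.elim Lm1 ILm1) (Sum.elim (Sum.elim (fun p => L0 p.1 p.2) fun _ => Rot)
    (Sum.elim (Sum.elim L1 IL1) L2)))

/-- The weights of the generators. -/
def deg : GenIdx n → ℤ :=
  Sum.elim (fun _ => -2) (Sum.elim (fun _ => -1) (Sum.elim (fun _ => 0)
    (Sum.elim (fun _ => 1) fun _ => 2)))

lemma tangentAt_gen (g : GenIdx n) {x : Amb n} (hx : x ∈ quadric n) : TangentAt (gen g) x := by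
  rcases g with p | (i | i) | (p | _) | (i | i) | p
  · exact tangentAt_Lm2 p x
  · exact tangentAt_Lm1 i x
  · exact tangentAt_ILm1 i x
  · exact tangentAt_L0 _ _ hx
  · exact tangentAt_Rot x
  · exact tangentAt_L1 i hx
  · exact tangentAt_IL1 i hx
  · exact tangentAt_L2 p hx

/-! ### Weights and analyticity of the generators -/

open MvPolynomial in
/-- The polynomial `w_{ij}`. -/
def wPoly (i j : Fin n) : MvPolynomial (Idx n) ℂ :=
  if h : i < j then X (Sum.inr ⟨(i, j), h⟩)
  else if h : j < i then -X (Sum.inr ⟨(j, i), h⟩)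
  else 0

lemma eval_wPoly (x : Amb n) (i j : Fin n) : MvPolynomial.eval x (wPoly i j) = w x i j := by
  unfold wPoly w
  split_ifs <;> simp

lemma isWeightedHomogeneous_zPoly (i : Fin n) :
    (MvPolynomial.X (Sum.inl i) : MvPolynomial (Idx n) ℂ).IsWeightedHomogeneous wt (1 : ℤ) :=
  MvPolynomial.isWeightedHomogeneous_X ℂ wt (Sum.inl i : Idx n)

lemma isWeightedHomogeneous_neg {P : MvPolynomial (Idx n) ℂ} {k : ℤ}
    (h : P.IsWeightedHomogeneous wt k) : (-P).IsWeightedHomogeneous wt k :=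
  (MvPolynomial.weightedHomogeneousSubmodule ℂ wt k).neg_mem h

lemma isWeightedHomogeneous_sub {P Q : MvPolynomial (Idx n) ℂ} {k : ℤ}
    (h : P.IsWeightedHomogeneous wt k) (h' : Q.IsWeightedHomogeneous wt k) :
    (P - Q).IsWeightedHomogeneous wt k :=
  (MvPolynomial.weightedHomogeneousSubmodule ℂ wt k).sub_mem h h'

lemma isWeightedHomogeneous_C_mul (c : ℂ) {P : MvPolynomial (Idx n) ℂ} {k : ℤ}
    (h : P.IsWeightedHomogeneous wt k) : (MvPolynomial.C c * P).IsWeightedHomogeneous wt k := by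
  simpa using (MvPolynomial.isWeightedHomogeneous_C wt c).mul h

lemma isWeightedHomogeneous_wPoly (i j : Fin n) :
    (wPoly i j).IsWeightedHomogeneous wt (2 : ℤ) := by
  unfold wPoly
  split_ifs with h h'
  · exact MvPolynomial.isWeightedHomogeneous_X ℂ wt (Sum.inr _ : Idx n)
  · exact isWeightedHomogeneous_neg
      (MvPolynomial.isWeightedHomogeneous_X ℂ wt (Sum.inr _ : Idx n))
  · exact MvPolynomial.isWeightedHomogeneous_zero _ _ _

/-- `X` is a polynomial vector field of weight `k`. -/
def IsPolyField (X : Amb n → Amb n) (k : ℤ) : Prop :=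
  ∃ P : Idx n → MvPolynomial (Idx n) ℂ,
    (∀ s, (P s).IsWeightedHomogeneous wt (k + wt s)) ∧
    ∀ x s, X x s = MvPolynomial.eval x (P s)

lemma isPolyField_field {A : Amb n → Fin n → ℂ} {C : Amb n → Fin n → Fin n → ℂ} {k : ℤ}
    (hA : ∀ i, ∃ P : MvPolynomial (Idx n) ℂ, P.IsWeightedHomogeneous wt (k + 1) ∧
      ∀ x, A x i = MvPolynomial.eval x P)
    (hC : ∀ i j, ∃ P : MvPolynomial (Idx n) ℂ, P.IsWeightedHomogeneous wt (k + 2) ∧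
      ∀ x, C x i j = MvPolynomial.eval x P) : IsPolyField (field A C) k := by
  choose P hP hP' using hA
  choose Q hQ hQ' using hC
  refine ⟨Sum.elim P fun p => Q p.1.1 p.1.2, ?_, ?_⟩
  · rintro (i | p)
    · exact hP i
    · exact hQ _ _
  · rintro x (i | p)
    · exact hP' i x
    · exact hQ' _ _ x

lemma isWeightedHomogeneous_C_of_eq_zero (c : ℂ) {k : ℤ} (hk : k = 0) :
    (MvPolynomial.C c : MvPolynomial (Idx n) ℂ).IsWeightedHomogeneous wt k :=
  hk ▸ MvPolynomial.isWeightedHomogeneous_C wt c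

open MvPolynomial in
lemma isPolyField_gen (g : GenIdx n) : IsPolyField (gen g) (deg g) := by
  have hz := fun i : Fin n => isWeightedHomogeneous_zPoly i
  have hw := fun i j : Fin n => isWeightedHomogeneous_wPoly i j
  have hzz := fun i j : Fin n => (hz i).mul (hz j)
  have hzw := fun i j k : Fin n => (hz i).mul (hw j k)
  have hww := fun i j k l : Fin n => (hw i j).mul (hw k l)
  have h0 : ∀ k : ℤ, (0 : MvPolynomial (Idx n) ℂ).IsWeightedHomogeneous wt k :=
    fun k => isWeightedHomogeneous_zero _ _ _
  rcases g with p | (i | i) | (p | _) | (i | i) | p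
  · change IsPolyField (Lm2 p) (-2)
    refine isPolyField_field ?_ ?_
    · exact fun k => ⟨0, h0 _, fun x => by simp⟩
    · exact fun k l => ⟨C (δ p.1.1 k * δ p.1.2 l), isWeightedHomogeneous_C_of_eq_zero _ rfl, fun x => by simp⟩
  · change IsPolyField (Lm1 i) (-1)
    refine isPolyField_field ?_ ?_
    · exact fun k => ⟨C (δ i k), isWeightedHomogeneous_C_of_eq_zero _ rfl, fun x => by simp⟩
    · exact fun k l => ⟨C (δ i l) * X (Sum.inl k) - C (δ i k) * X (Sum.inl l),
        isWeightedHomogeneous_sub (isWeightedHomogeneous_C_mul _ (hz k))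
          (isWeightedHomogeneous_C_mul _ (hz l)), fun x => by simp [z]⟩
  · change IsPolyField (ILm1 i) (-1)
    refine isPolyField_field ?_ ?_
    · exact fun k => ⟨C (Complex.I * δ i k), isWeightedHomogeneous_C_of_eq_zero _ rfl, fun x => by simp⟩
    · exact fun k l => ⟨-(C Complex.I * (C (δ i l) * X (Sum.inl k) - C (δ i k) * X (Sum.inl l))),
        isWeightedHomogeneous_neg (isWeightedHomogeneous_C_mul _ (isWeightedHomogeneous_sub
          (isWeightedHomogeneous_C_mul _ (hz k)) (isWeightedHomogeneous_C_mul _ (hz l)))),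
        fun x => by simp [z]⟩
  · change IsPolyField (L0 p.1 p.2) 0
    refine isPolyField_field ?_ ?_
    · exact fun k => ⟨C (δ p.2 k) * X (Sum.inl p.1),
        isWeightedHomogeneous_C_mul _ (hz _), fun x => by simp [z]⟩
    · exact fun k l => ⟨C (δ p.2 l) * wPoly k p.1 + C (δ p.2 k) * wPoly p.1 l,
        (isWeightedHomogeneous_C_mul _ (hw _ _)).add (isWeightedHomogeneous_C_mul _ (hw _ _)),
        fun x => by simp [eval_wPoly]⟩
  · change IsPolyField (Rot (n := n)) 0
    refine isPolyField_field ?_ ?_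
    · exact fun k => ⟨C Complex.I * X (Sum.inl k),
        isWeightedHomogeneous_C_mul _ (hz _), fun x => by simp [z]⟩
    · exact fun k l => ⟨0, h0 _, fun x => by simp⟩
  · change IsPolyField (L1 i) 1
    refine isPolyField_field ?_ ?_
    · exact fun k => ⟨X (Sum.inl i) * X (Sum.inl k) - wPoly k i,
        isWeightedHomogeneous_sub (hzz _ _) (hw _ _), fun x => by simp [z, eval_wPoly]⟩
    · exact fun k l => ⟨X (Sum.inl l) * wPoly k i - X (Sum.inl k) * wPoly l i,
        isWeightedHomogeneous_sub (hzw _ _ _) (hzw _ _ _), fun x => by simp [z, eval_wPoly]⟩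
  · change IsPolyField (IL1 i) 1
    refine isPolyField_field ?_ ?_
    · exact fun k => ⟨C Complex.I * (X (Sum.inl i) * X (Sum.inl k) + wPoly k i),
        isWeightedHomogeneous_C_mul _ ((hzz _ _).add (hw _ _)),
        fun x => by simp [z, eval_wPoly]⟩
    · exact fun k l => ⟨C Complex.I * (X (Sum.inl l) * wPoly k i - X (Sum.inl k) * wPoly l i),
        isWeightedHomogeneous_C_mul _ (isWeightedHomogeneous_sub (hzw _ _ _) (hzw _ _ _)),
        fun x => by simp [z, eval_wPoly]⟩
  · change IsPolyField (L2 p) 2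
    refine isPolyField_field ?_ ?_
    · exact fun k => ⟨X (Sum.inl p.1.1) * wPoly k p.1.2 -
          X (Sum.inl p.1.2) * wPoly k p.1.1,
        isWeightedHomogeneous_sub (hzw _ _ _) (hzw _ _ _), fun x => by simp [z, eval_wPoly]⟩
    · exact fun k l => ⟨wPoly k p.1.1 * wPoly l p.1.2 - wPoly k p.1.2 * wPoly l p.1.1,
        isWeightedHomogeneous_sub (hww _ _ _ _) (hww _ _ _ _), fun x => by simp [eval_wPoly]⟩

lemma IsPolyField.analyticOnNhd {X : Amb n → Amb n} {k : ℤ} (h : IsPolyField X k)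
    (s : Set (Amb n)) : AnalyticOnNhd ℂ X s := by
  obtain ⟨P, -, hP⟩ := h
  have : X = fun x s => MvPolynomial.eval x (P s) := by
    ext x s; exact hP x s
  rw [this]
  exact fun x _ => analyticAt_pi_iff.2 fun i =>
    AnalyticOnNhd.eval_mvPolynomial (P i) x (Set.mem_univ x)

/-- The real linear combination of the generators with coefficients `d`. -/
def comb (d : GenIdx n → ℝ) : Amb n → Amb n := ∑ g, d g • gen g

lemma analyticOnNhd_gen (g : GenIdx n) (s : Set (Amb n)) : AnalyticOnNhd ℂ (gen g) s :=
  (isPolyField_gen g).analyticOnNhd s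

lemma analyticOnNhd_comb (d : GenIdx n → ℝ) (s : Set (Amb n)) : AnalyticOnNhd ℂ (comb d) s := by
  have : comb d = ∑ g, fun x => ((d g : ℂ)) • gen g x := by
    ext x s
    simp [comb]
  rw [this]
  exact Finset.analyticOnNhd_sum _ fun g _ => fun x hx =>
    (analyticAt_const (v := (d g : ℂ))).smul (analyticOnNhd_gen g s x hx)

lemma tangentAt_comb (d : GenIdx n → ℝ) {x : Amb n} (hx : x ∈ quadric n) :
    TangentAt (comb d) x := by
  intro p
  simp only [comb, Finset.sum_apply, Pi.smul_apply, map_sum, map_smul]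
  exact Finset.sum_eq_zero fun g _ => by rw [tangentAt_gen g hx p, smul_zero]

/-! ### Polarization of the tangency condition -/

open Topology Metric

lemma tangentAt_iff {X : Amb n → Amb n} {x : Amb n} : TangentAt X x ↔ ∀ p : Pairs n,
    X x (Sum.inr p) - conj (X x (Sum.inr p)) =
      X x (Sum.inl p.1.1) * conj (x (Sum.inl p.1.2)) + x (Sum.inl p.1.1) * conj (X x (Sum.inl p.1.2))
        - conj (X x (Sum.inl p.1.1)) * x (Sum.inl p.1.2)
        - conj (x (Sum.inl p.1.1)) * X x (Sum.inl p.1.2) := by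
  simp only [TangentAt, fderiv_rho, z, sub_eq_zero]

/-- A holomorphic function on a disc around `0` of radius `> 1` that vanishes on the real axis
vanishes at `i`. -/
lemma eq_zero_at_I_of_real {g : ℂ → ℂ} (hg : DifferentiableOn ℂ g (ball 0 2))
    (h : ∀ t : ℝ, (t : ℂ) ∈ ball (0 : ℂ) 2 → g t = 0) : g Complex.I = 0 := by
  have ha : AnalyticOnNhd ℂ g (ball 0 2) := hg.analyticOnNhd isOpen_ball
  have hev : ∃ᶠ s in 𝓝[≠] (0 : ℂ), g s = 0 := by
    have ht : Filter.Tendsto (fun t : ℝ => (t : ℂ)) (𝓝[≠] 0) (𝓝[≠] 0) := by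
      refine tendsto_nhdsWithin_iff.2 ⟨?_, ?_⟩
      · have : Filter.Tendsto (fun t : ℝ => (t : ℂ)) (𝓝 0) (𝓝 0) := by
          simpa using Complex.continuous_ofReal.tendsto 0
        exact this.mono_left nhdsWithin_le_nhds
      · filter_upwards [self_mem_nhdsWithin] with t ht
        simpa using ht
    refine ht.frequently ?_
    refine Filter.Eventually.frequently ?_
    have : ∀ᶠ t : ℝ in 𝓝 0, (t : ℂ) ∈ ball (0 : ℂ) 2 :=
      Complex.continuous_ofReal.continuousAt.eventually_mem (by simpa using ball_mem_nhds (0:ℂ) two_pos)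
    filter_upwards [this.filter_mono nhdsWithin_le_nhds] with t ht using h t ht
  exact ha.eqOn_zero_of_preconnected_of_frequently_eq_zero (convex_ball _ _).isPreconnected
    (mem_ball_self two_pos) hev (by simp)

/-- The tangency condition of a holomorphic field holds in polarized form. -/
lemma polarization {X : Amb n → Amb n} {R : ℝ} (hR : 0 < R)
    (hX : AnalyticOnNhd ℂ X (ball 0 R)) (hT : ∀ x ∈ quadric n, x ∈ ball 0 R → TangentAt X x) :
    ∃ ε > 0, ε ≤ R ∧ ∀ x x' : Amb n, x ∈ ball 0 ε → x' ∈ ball 0 ε →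
      (∀ p : Pairs n, x (Sum.inr p) - conj (x' (Sum.inr p)) =
        x (Sum.inl p.1.1) * conj (x' (Sum.inl p.1.2)) -
          conj (x' (Sum.inl p.1.1)) * x (Sum.inl p.1.2)) →
      ∀ p : Pairs n, X x (Sum.inr p) - conj (X x' (Sum.inr p)) =
        X x (Sum.inl p.1.1) * conj (x' (Sum.inl p.1.2))
          - conj (x' (Sum.inl p.1.1)) * X x (Sum.inl p.1.2)
          + x (Sum.inl p.1.1) * conj (X x' (Sum.inl p.1.2))
          - conj (X x' (Sum.inl p.1.1)) * x (Sum.inl p.1.2) := by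
  -- For `‖s‖ ≤ 2` the curve `γ` below has `z`-coordinates of size at most `3ε` and `w`-coordinates
  -- at most `2ε + 4ε + 9ε² ≤ 15ε`; the bound `ε ≤ 1` absorbs the square, and `20ε ≤ R` keeps the
  -- curve in the ball.
  refine ⟨min 1 (R / 20), by positivity, (min_le_right _ _).trans (by linarith), ?_⟩
  intro x x' hx hx' hxx p
  set ε := min 1 (R / 20)
  have hε1 : ε ≤ 1 := min_le_left _ _
  have hεR : 20 * ε ≤ R := by have : ε ≤ R / 20 := min_le_right _ _; linarith
  have hε0 : 0 < ε := by positivity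
  have hxs : ∀ s, ‖x s‖ ≤ ε := fun s => (norm_le_pi_norm x s).trans (mem_ball_zero_iff.1 hx).le
  have hxs' : ∀ s, ‖x' s‖ ≤ ε := fun s => (norm_le_pi_norm x' s).trans (mem_ball_zero_iff.1 hx').le
  -- A holomorphic curve with `γ(i) = x` and `γ(-i) = x'` whose real points lie on the quadric. The
  -- `z`-coordinates `P + sQ` interpolate linearly; in `w`, the quadric prescribes the part
  -- quadratic in `z`, and the remaining real freedom is spent on `V`, whose value at `x'` is its
  -- conjugate by the polarized equation.
  let P : Fin n → ℂ := fun k => (x (Sum.inl k) + x' (Sum.inl k)) / 2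
  let Q : Fin n → ℂ := fun k => (x (Sum.inl k) - x' (Sum.inl k)) / (2 * Complex.I)
  let V : Pairs n → ℂ := fun p => x (Sum.inr p) -
    (x (Sum.inl p.1.1) * conj (x' (Sum.inl p.1.2)) -
          conj (x' (Sum.inl p.1.1)) * x (Sum.inl p.1.2)) / 2
  let zc : Fin n → ℂ → ℂ := fun k s => P k + s * Q k
  let zb : Fin n → ℂ → ℂ := fun k s => conj (P k) + s * conj (Q k)
  let wc : Pairs n → ℂ → ℂ := fun p s => (V p).re + s * (V p).im +
    (zc p.1.1 s * zb p.1.2 s - zb p.1.1 s * zc p.1.2 s) / 2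
  let γ : ℂ → Amb n := fun s => Sum.elim (fun k => zc k s) fun p => wc p s
  have hzb : ∀ k s, zb k s = conj (zc k (conj s)) := fun k s => by simp [zb, zc]
  have hP : ∀ k, ‖P k‖ ≤ ε := fun k => by
    have h1 : ‖x (Sum.inl k) + x' (Sum.inl k)‖ ≤ ε + ε :=
      (norm_add_le _ _).trans (add_le_add (hxs _) (hxs' _))
    simp only [P, norm_div, Complex.norm_ofNat]
    linarith
  have hQ : ∀ k, ‖Q k‖ ≤ ε := fun k => by
    have h1 : ‖x (Sum.inl k) - x' (Sum.inl k)‖ ≤ ε + ε :=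
      (norm_sub_le _ _).trans (add_le_add (hxs _) (hxs' _))
    simp only [Q, norm_div, norm_mul, Complex.norm_ofNat, Complex.norm_I]
    linarith
  have hmul : ∀ (a b : ℂ) (α β : ℝ), 0 ≤ α → ‖a‖ ≤ α → ‖b‖ ≤ β → ‖a * b‖ ≤ α * β :=
    fun a b α β h0 ha hb => by
      rw [norm_mul]; exact mul_le_mul ha hb (norm_nonneg _) h0
  have hV : ∀ p, ‖V p‖ ≤ 2 * ε := fun p => by
    have h1 := hmul (x (Sum.inl p.1.1)) (conj (x' (Sum.inl p.1.2))) ε ε hε0.le (hxs _)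
      (by simpa using hxs' (Sum.inl p.1.2))
    have h2 := hmul (conj (x' (Sum.inl p.1.1))) (x (Sum.inl p.1.2)) ε ε hε0.le
      (by simpa using hxs' (Sum.inl p.1.1)) (hxs _)
    have h3 := norm_sub_le (x (Sum.inr p)) ((x (Sum.inl p.1.1) * conj (x' (Sum.inl p.1.2)) -
          conj (x' (Sum.inl p.1.1)) * x (Sum.inl p.1.2)) / 2)
    have h4 := norm_sub_le (x (Sum.inl p.1.1) * conj (x' (Sum.inl p.1.2)))
          (conj (x' (Sum.inl p.1.1)) * x (Sum.inl p.1.2))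
    rw [norm_div, Complex.norm_ofNat] at h3
    have := hxs (Sum.inr p)
    simp only [V]
    nlinarith
  have hzc : ∀ k s, ‖s‖ ≤ 2 → ‖zc k s‖ ≤ 3 * ε := fun k s hs => by
    have h1 := hmul s (Q k) 2 ε (by norm_num) hs (hQ k)
    have h2 := norm_add_le (P k) (s * Q k)
    have := hP k
    simp only [zc]; linarith
  have hwc : ∀ p s, ‖s‖ ≤ 2 → ‖wc p s‖ ≤ 15 * ε := fun p s hs => by
    have b1 : ‖zb p.1.1 s‖ ≤ 3 * ε := by
      rw [hzb, Complex.norm_conj]; exact hzc _ _ (by simpa using hs)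
    have b2 : ‖zb p.1.2 s‖ ≤ 3 * ε := by
      rw [hzb, Complex.norm_conj]; exact hzc _ _ (by simpa using hs)
    have h1 := hmul _ _ _ _ (by positivity) (hzc p.1.1 s hs) b2
    have h2 := hmul _ _ _ _ (by positivity) b1 (hzc p.1.2 s hs)
    have h3 := norm_sub_le (zc p.1.1 s * zb p.1.2 s) (zb p.1.1 s * zc p.1.2 s)
    have r1 : ‖((V p).re : ℂ)‖ ≤ 2 * ε := by
      rw [Complex.norm_real]; exact (Complex.abs_re_le_norm _).trans (hV p)
    have r2 : ‖((V p).im : ℂ)‖ ≤ 2 * ε := by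
      rw [Complex.norm_real]; exact (Complex.abs_im_le_norm _).trans (hV p)
    have r3 := hmul s _ _ _ (by norm_num) hs r2
    have h4 := norm_add₃_le (a := ((V p).re : ℂ)) (b := s * (V p).im)
      (c := (zc p.1.1 s * zb p.1.2 s - zb p.1.1 s * zc p.1.2 s) / 2)
    rw [norm_div, Complex.norm_ofNat] at h4
    simp only [wc]
    nlinarith
  have hγ : ∀ s, ‖s‖ ≤ 2 → γ s ∈ ball 0 R := fun s hs => by
    rw [mem_ball_zero_iff]
    refine lt_of_le_of_lt ((pi_norm_le_iff_of_nonneg (r := 15 * ε) (by positivity)).2 ?_)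
      (by linarith)
    rintro (k | q)
    · exact (hzc k s hs).trans (by linarith)
    · exact hwc q s hs
  have hγd : Differentiable ℂ γ := by
    rw [differentiable_pi]
    rintro (k | q)
    · change Differentiable ℂ (fun s => P k + s * Q k)
      fun_prop
    · change Differentiable ℂ (fun s => ((V q).re : ℂ) + s * (V q).im +
        ((P q.1.1 + s * Q q.1.1) * (conj (P q.1.2) + s * conj (Q q.1.2)) -
          (conj (P q.1.1) + s * conj (Q q.1.1)) * (P q.1.2 + s * Q q.1.2)) / 2)
      fun_prop
  have hXγ : ∀ t, ∀ s ∈ ball (0 : ℂ) 2, DifferentiableAt ℂ (fun s => X (γ s) t) s := by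
    intro t s hs
    have h1 : DifferentiableAt ℂ (fun s => X (γ s)) s :=
      (hX _ (hγ s (mem_ball_zero_iff.1 hs).le)).differentiableAt.comp s (hγd s)
    exact (differentiableAt_pi.1 h1) t
  have hXγ' : ∀ t, ∀ s ∈ ball (0 : ℂ) 2,
      DifferentiableAt ℂ (fun s => conj (X (γ (conj s)) t)) s := by
    intro t s hs
    exact differentiableAt_conj_conj_iff.2 (hXγ t (conj s) (by simpa using hs))
  -- The tangency defect along `γ`, with each conjugate evaluated at `conj s`: this makes it
  -- holomorphic in `s` and leaves its values at real `s` unchanged.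
  let g : ℂ → ℂ := fun s => X (γ s) (Sum.inr p) - conj (X (γ (conj s)) (Sum.inr p)) -
    (X (γ s) (Sum.inl p.1.1) * zb p.1.2 s - zb p.1.1 s * X (γ s) (Sum.inl p.1.2)
      + zc p.1.1 s * conj (X (γ (conj s)) (Sum.inl p.1.2))
      - conj (X (γ (conj s)) (Sum.inl p.1.1)) * zc p.1.2 s)
  have hzcd : ∀ k, Differentiable ℂ (zc k) := fun k => by
    change Differentiable ℂ (fun s => P k + s * Q k)
    fun_prop
  have hzbd : ∀ k, Differentiable ℂ (zb k) := fun k => by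
    change Differentiable ℂ (fun s => conj (P k) + s * conj (Q k))
    fun_prop
  have hgd : DifferentiableOn ℂ g (ball 0 2) := fun s hs => by
    refine DifferentiableAt.differentiableWithinAt ?_
    exact ((hXγ _ s hs).sub (hXγ' _ s hs)).sub (((((hXγ _ s hs).mul (hzbd _ s)).sub
      ((hzbd _ s).mul (hXγ _ s hs))).add ((hzcd _ s).mul (hXγ' _ s hs))).sub
      ((hXγ' _ s hs).mul (hzcd _ s)))
  have hg0 : ∀ t : ℝ, (t : ℂ) ∈ ball (0 : ℂ) 2 → g t = 0 := by
    intro t ht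
    have hM : γ t ∈ quadric n := by
      intro q
      simp only [rho, z, γ, Sum.elim_inl, Sum.elim_inr, wc, hzb, Complex.conj_ofReal, map_add,
        map_sub, map_mul, Complex.conj_conj, map_div₀, map_ofNat]
      ring
    have := (tangentAt_iff.1 (hT _ hM (hγ t (mem_ball_zero_iff.1 ht).le))) p
    simp only [g, hzb, Complex.conj_ofReal]
    have e : ∀ k, γ t (Sum.inl k) = zc k t := fun k => rfl
    rw [e, e] at this
    linear_combination this
  have hI := eq_zero_at_I_of_real hgd hg0
  have hzI : ∀ k, zc k Complex.I = x (Sum.inl k) := fun k => by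
    simp only [zc, P, Q]
    field_simp
    ring
  have hzI' : ∀ k, zc k (-Complex.I) = x' (Sum.inl k) := fun k => by
    simp only [zc, P, Q]
    field_simp
    ring
  have hre : ∀ v : ℂ, (v.re : ℂ) + Complex.I * v.im = v := fun v => by
    rw [mul_comm]; exact Complex.re_add_im v
  have hre' : ∀ v : ℂ, (v.re : ℂ) + -Complex.I * v.im = conj v := fun v => by
    rw [← hre (conj v), Complex.conj_re, Complex.conj_im]; push_cast; ring
  have hγI : γ Complex.I = x := by
    funext s
    rcases s with k | q
    · exact hzI k
    · simp only [γ, Sum.elim_inr, wc, hzb, Complex.conj_I, hzI, hzI', hre, V]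
      ring
  have hγI' : γ (-Complex.I) = x' := by
    funext s
    rcases s with k | q
    · exact hzI' k
    · simp only [γ, Sum.elim_inr, wc, hzb, map_neg, Complex.conj_I, neg_neg, hzI, hzI', hre', V]
      have := congrArg conj (hxx q)
      simp only [map_sub, map_mul, Complex.conj_conj, map_div₀, map_ofNat] at this ⊢
      linear_combination this
  simp only [g, Complex.conj_I, hγI, hγI', hzb, hzI, hzI'] at hI
  linear_combination hI

/-! ### Coordinates, skew extensions and conjugation of vectors -/

/-- The point with coordinates `z` and `w`. -/
def pt (u : Fin n → ℂ) (v : Pairs n → ℂ) : Amb n := Sum.elim u v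

@[simp] lemma pt_inl (u : Fin n → ℂ) (v : Pairs n → ℂ) (i : Fin n) : pt u v (Sum.inl i) = u i := rfl

@[simp] lemma pt_inr (u : Fin n → ℂ) (v : Pairs n → ℂ) (p : Pairs n) : pt u v (Sum.inr p) = v p := rfl

lemma pt_eta (x : Amb n) : pt (fun i => x (Sum.inl i)) (fun p => x (Sum.inr p)) = x := by
  funext s; rcases s with i | p <;> rfl

/-- The skew extension of a family indexed by `i < j`. -/
def sk (v : Pairs n → ℂ) (i j : Fin n) : ℂ := w (pt 0 v) i j

lemma w_eq_sk (x : Amb n) (i j : Fin n) : w x i j = sk (fun p => x (Sum.inr p)) i j := rfl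

@[simp] lemma w_pt (u : Fin n → ℂ) (v : Pairs n → ℂ) (i j : Fin n) : w (pt u v) i j = sk v i j := rfl

lemma sk_swap (v : Pairs n → ℂ) (i j : Fin n) : sk v j i = -sk v i j := w_swap _ _ _

@[simp] lemma sk_self (v : Pairs n → ℂ) (i : Fin n) : sk v i i = 0 := w_self _ _

lemma sk_pair (v : Pairs n → ℂ) (p : Pairs n) : sk v p.1.1 p.1.2 = v p := w_pair _ p

lemma sk_lt (v : Pairs n → ℂ) {i j : Fin n} (h : i < j) : sk v i j = v ⟨(i, j), h⟩ :=
  sk_pair v ⟨(i, j), h⟩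

/-- The vector `u ∧ v`, with components `u_i v_j - v_i u_j`. -/
def wdg (u v : Fin n → ℂ) : Pairs n → ℂ := fun p => u p.1.1 * v p.1.2 - v p.1.1 * u p.1.2

/-- A skew array is determined by its entries above the diagonal. All later identities for arbitrary
`i, j` are obtained in this way from the pairs `i < j`. -/
lemma sk_ext {f : Fin n → Fin n → ℂ} (hf : ∀ i j, f j i = -f i j) {v : Pairs n → ℂ}
    (h : ∀ p : Pairs n, v p = f p.1.1 p.1.2) (i j : Fin n) : sk v i j = f i j := by
  rcases lt_trichotomy i j with h1 | rfl | h1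
  · rw [sk_lt v h1]; exact h _
  · have := hf i i
    rw [sk_self]
    linear_combination -(1/2 : ℂ) * this
  · rw [← neg_neg (sk v i j), ← sk_swap, sk_lt v h1, hf j i, neg_inj]; exact h _

lemma sk_wdg (u v : Fin n → ℂ) (i j : Fin n) : sk (wdg u v) i j = u i * v j - v i * u j :=
  sk_ext (f := fun i j => u i * v j - v i * u j) (fun i j => by ring) (fun p => rfl) i j

lemma sk_conj (v : Pairs n → ℂ) (i j : Fin n) : sk (fun p => conj (v p)) i j = conj (sk v i j) :=
  sk_ext (f := fun i j => conj (sk v i j)) (fun i j => by rw [sk_swap, map_neg])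
    (fun p => by rw [sk_pair]) i j

lemma sk_add (v v' : Pairs n → ℂ) (i j : Fin n) : sk (v + v') i j = sk v i j + sk v' i j :=
  sk_ext (f := fun i j => sk v i j + sk v' i j)
    (fun i j => by rw [sk_swap v, sk_swap v']; ring)
    (fun p => by rw [sk_pair, sk_pair]; rfl) i j

lemma sk_smul (c : ℂ) (v : Pairs n → ℂ) (i j : Fin n) : sk (c • v) i j = c * sk v i j :=
  sk_ext (f := fun i j => c * sk v i j) (fun i j => by rw [sk_swap v]; ring)
    (fun p => by rw [sk_pair]; rfl) i j

lemma sk_sub (v v' : Pairs n → ℂ) (i j : Fin n) : sk (v - v') i j = sk v i j - sk v' i j := by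
  have := sk_add v ((-1 : ℂ) • v') i j
  rw [sk_smul, neg_one_smul, ← sub_eq_add_neg] at this
  rw [this]; ring

lemma norm_pt_lt {u : Fin n → ℂ} {v : Pairs n → ℂ} {r : ℝ} (hu : ‖u‖ < r) (hv : ‖v‖ < r) :
    pt u v ∈ ball (0 : Amb n) r := by
  rw [mem_ball_zero_iff, pi_norm_lt_iff ((norm_nonneg u).trans_lt hu)]
  rintro (i | p)
  · exact (norm_le_pi_norm u i).trans_lt hu
  · exact (norm_le_pi_norm v p).trans_lt hv

/-- Complex conjugation of vectors. -/
def cv {ι : Type*} (v : ι → ℂ) : ι → ℂ := fun s => conj (v s)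

@[simp] lemma cv_apply {ι : Type*} (v : ι → ℂ) (s : ι) : cv v s = conj (v s) := rfl

@[simp] lemma cv_cv {ι : Type*} (v : ι → ℂ) : cv (cv v) = v := by
  funext s; simp

@[simp] lemma cv_zero {ι : Type*} : cv (0 : ι → ℂ) = 0 := by
  funext s; simp

@[simp] lemma norm_cv {ι : Type*} [Fintype ι] (v : ι → ℂ) : ‖cv v‖ = ‖v‖ := by
  apply le_antisymm
  · exact (pi_norm_le_iff_of_nonneg (norm_nonneg _)).2 fun s => by
      simpa using norm_le_pi_norm v s
  · exact (pi_norm_le_iff_of_nonneg (norm_nonneg _)).2 fun s => by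
      simpa using norm_le_pi_norm (cv v) s

@[simp] lemma sk_cv (v : Pairs n → ℂ) (i j : Fin n) : sk (cv v) i j = conj (sk v i j) := sk_conj v i j

/-- The polarized tangency condition in terms of the coordinates `z`, `w`. -/
lemma polarization_pt {X : Amb n → Amb n} {R : ℝ} (hR : 0 < R)
    (hX : AnalyticOnNhd ℂ X (ball 0 R)) (hT : ∀ x ∈ quadric n, x ∈ ball 0 R → TangentAt X x) :
    ∃ ε > 0, ε ≤ R ∧ ∀ (u ζ : Fin n → ℂ) (v ω : Pairs n → ℂ), ‖u‖ < ε → ‖ζ‖ < ε → ‖v‖ < ε →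
      ‖ω‖ < ε → v = ω + wdg u ζ → ∀ i j,
      w (X (pt u v)) i j - conj (w (X (pt (cv ζ) (cv ω))) i j) =
        z (X (pt u v)) i * ζ j - ζ i * z (X (pt u v)) j
          + u i * conj (z (X (pt (cv ζ) (cv ω))) j)
          - conj (z (X (pt (cv ζ) (cv ω))) i) * u j := by
  obtain ⟨ε, hε, hεR, h⟩ := polarization hR hX hT
  refine ⟨ε, hε, hεR, fun u ζ v ω hu hζ hv hω hvω i j => ?_⟩
  have key := h (pt u v) (pt (cv ζ) (cv ω)) (norm_pt_lt hu hv)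
    (norm_pt_lt (by simpa using hζ) (by simpa using hω)) (fun p => by
      simp [hvω, wdg])
  have e : ∀ x x' : Amb n, ∀ i j, w x i j - conj (w x' i j) =
      sk (fun p => x (Sum.inr p) - conj (x' (Sum.inr p))) i j := fun x x' i j => by
    have := sk_sub (fun p => x (Sum.inr p)) (fun p => conj (x' (Sum.inr p))) i j
    rw [sk_conj] at this
    exact this.symm
  rw [e]
  refine sk_ext (f := fun i j => z (X (pt u v)) i * ζ j - ζ i * z (X (pt u v)) j
          + u i * conj (z (X (pt (cv ζ) (cv ω))) j)
          - conj (z (X (pt (cv ζ) (cv ω))) i) * u j) (fun i j => by ring) (fun p => ?_) i j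
  rw [key p]
  simp [z]

lemma w_add (x y : Amb n) (i j : Fin n) : w (x + y) i j = w x i j + w y i j := by
  rw [w_eq_sk, w_eq_sk x, w_eq_sk y, ← sk_add]; rfl

lemma w_smul (c : ℂ) (x : Amb n) (i j : Fin n) : w (c • x) i j = c * w x i j := by
  rw [w_eq_sk, w_eq_sk x, ← sk_smul]; rfl

/-- The coordinate `w_{ij}` as a continuous linear functional. -/
def wL (i j : Fin n) : Amb n →L[ℂ] ℂ :=
  LinearMap.toContinuousLinearMap
    { toFun := fun x => w x i j
      map_add' := fun x y => w_add x y i j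
      map_smul' := fun c x => w_smul c x i j }

@[simp] lemma wL_apply (i j : Fin n) (x : Amb n) : wL i j x = w x i j := rfl

/-- The coordinate `z_i` as a continuous linear functional. -/
def zL (i : Fin n) : Amb n →L[ℂ] ℂ := ContinuousLinearMap.proj (Sum.inl i)

@[simp] lemma zL_apply (i : Fin n) (x : Amb n) : zL i x = z x i := rfl

/-- The polarized tangency condition on the polydisc of radius `ε`. -/
def Polarized (X : Amb n → Amb n) (ε : ℝ) : Prop :=
  ∀ (u ζ : Fin n → ℂ) (v ω : Pairs n → ℂ), ‖u‖ < ε → ‖ζ‖ < ε → ‖v‖ < ε →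
      ‖ω‖ < ε → v = ω + wdg u ζ → ∀ i j,
      w (X (pt u v)) i j - conj (w (X (pt (cv ζ) (cv ω))) i j) =
        z (X (pt u v)) i * ζ j - ζ i * z (X (pt u v)) j
          + u i * conj (z (X (pt (cv ζ) (cv ω))) j)
          - conj (z (X (pt (cv ζ) (cv ω))) i) * u j

lemma pt_add (u u' : Fin n → ℂ) (v v' : Pairs n → ℂ) : pt u v + pt u' v' = pt (u + u') (v + v') := by
  funext s; rcases s with i | p <;> rfl

lemma pt_smul (c : ℂ) (u : Fin n → ℂ) (v : Pairs n → ℂ) : c • pt u v = pt (c • u) (c • v) := by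
  funext s; rcases s with i | p <;> rfl

/-! ### Degree at most two in `z`, and separation by degree -/

/-- `∂_{w_{ij}}`-directions: the vector `e_i ∧ e_j`. -/
def E (i j : Fin n) : Pairs n → ℂ := wdg (Pi.single i 1) (Pi.single j 1)

@[simp] lemma conj_E (i j : Fin n) (p : Pairs n) : conj (E i j p) = E i j p := by
  simp [E, wdg, Pi.single_apply, apply_ite conj]

lemma wdg_single (u : Fin n → ℂ) (j : Fin n) :
    wdg u (Pi.single j 1) = ∑ k, u k • E k j := by
  funext p
  simp [wdg, E, Pi.single_apply, mul_sub, Finset.sum_sub_distrib]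

/-- The direction of differentiation is affine in `u` up to a conjugation, the derivative is complex
linear, and the outer conjugation undoes the inner one; hence the result is complex affine in `u`.
-/
lemma conj_fderiv_pt (X : Amb n → Amb n) (v : Pairs n → ℂ) (j : Fin n) (ℓ : Amb n →L[ℂ] ℂ) :
    ∃ (A : ℂ) (B : (Fin n → ℂ) →ₗ[ℂ] ℂ), ∀ u : Fin n → ℂ,
      conj (ℓ (fderiv ℂ X (pt 0 (cv v)) (pt (Pi.single j 1) (-cv (wdg u (Pi.single j 1)))))) =
        A + B u := by
  refine ⟨conj (ℓ (fderiv ℂ X (pt 0 (cv v)) (pt (Pi.single j 1) 0))),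
    ∑ k, (-conj (ℓ (fderiv ℂ X (pt 0 (cv v)) (pt 0 (E k j))))) • LinearMap.proj k, fun u => ?_⟩
  have e : pt (Pi.single j 1) (-cv (wdg u (Pi.single j 1))) =
      pt (Pi.single j 1) 0 + ∑ k, (-conj (u k)) • pt 0 (E k j) := by
    funext s
    rcases s with i | p
    · simp
    · rw [wdg_single]
      simp
  rw [e, map_add, map_add, map_add, map_sum, map_sum, map_sum]
  simp [mul_comm]

/-- Along `w` fixed, the `z`-components of a tangent field are polynomials of degree at most two
in `z`. -/
lemma exists_quadratic (hn : 2 ≤ n) {X : Amb n → Amb n} {ε : ℝ} (hε : 0 < ε)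
    (hX : AnalyticOnNhd ℂ X (ball 0 ε)) (hP : Polarized X ε) (v : Pairs n → ℂ) (hv : ‖v‖ < ε)
    (i : Fin n) :
    ∃ (α : ℂ) (β : (Fin n → ℂ) →ₗ[ℂ] ℂ) (Q : (Fin n → ℂ) → ℂ),
      (∀ (c : ℂ) u, Q (c • u) = c ^ 2 * Q u) ∧
      ∀ u, ‖u‖ < ε → z (X (pt u v)) i = α + β u + Q u := by
  -- With `ζ = t e_j` and `ω = v - t u ∧ e_j`, the `(i, j)` equation has `ζ_i = 0` and `ζ_j = t`.
  -- Its derivative at `t = 0` is solved for the `i`-th component; all other terms are affine in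
  -- `u`, two of them multiplied by `u_i` or `u_j`.
  obtain ⟨j, hj⟩ : ∃ j : Fin n, j ≠ i := by
    have : Nontrivial (Fin n) := Fin.nontrivial_iff_two_le.2 hn
    exact exists_ne i
  obtain ⟨A, B, hAB⟩ := conj_fderiv_pt X v j (wL i j)
  obtain ⟨Ai, Bi, hi⟩ := conj_fderiv_pt X v j (zL i)
  obtain ⟨Aj, Bj, hj'⟩ := conj_fderiv_pt X v j (zL j)
  refine ⟨-A, -B - Aj • LinearMap.proj i + Ai • LinearMap.proj j,
    fun u => -(u i * Bj u) + u j * Bi u, fun c u => by simp; ring, fun u hu => ?_⟩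
  set e : Fin n → ℂ := Pi.single j 1 with he
  have hder : ∀ ℓ : Amb n →L[ℂ] ℂ, HasDerivAt
      (fun t : ℂ => conj (ℓ (X (pt (cv (t • e)) (cv (v - t • wdg u e))))))
      (conj (ℓ (fderiv ℂ X (pt 0 (cv v)) (pt e (-cv (wdg u e)))))) 0 := by
    intro ℓ
    have h1 : HasDerivAt (fun s : ℂ => pt 0 (cv v) + s • pt e (-cv (wdg u e)))
        (pt e (-cv (wdg u e))) 0 := by
      simpa using ((hasDerivAt_id (0 : ℂ)).smul_const (pt e (-cv (wdg u e)))).const_add (pt 0 (cv v))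
    have h2 : HasFDerivAt X (fderiv ℂ X (pt 0 (cv v)))
        (pt 0 (cv v) + (0 : ℂ) • pt e (-cv (wdg u e))) := by
      rw [zero_smul, add_zero]
      exact (hX _ (norm_pt_lt (by simpa using hε) (by simpa using hv))).differentiableAt.hasFDerivAt
    have h3 := ℓ.hasFDerivAt.comp_hasDerivAt (0 : ℂ) (h2.comp_hasDerivAt (0 : ℂ) h1)
    have h4 : HasDerivAt (fun s : ℂ => ℓ (X (pt 0 (cv v) + s • pt e (-cv (wdg u e)))))
      (ℓ (fderiv ℂ X (pt 0 (cv v)) (pt e (-cv (wdg u e))))) (conj (0 : ℂ)) := by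
      rw [map_zero]; exact h3
    have h5 := h4.conj_conj
    rw [Complex.conj_conj] at h5
    refine h5.congr_of_eventuallyEq (Filter.Eventually.of_forall fun t => ?_)
    simp only [Function.comp]
    congr 3
    rw [pt_smul, pt_add]
    congr 1
    · funext k
      by_cases h : k = j
      · subst h; simp [he]
      · simp [he, h]
    · funext k; simp [sub_eq_add_neg]
  have hev : ∀ᶠ t : ℂ in 𝓝 0, ‖t • e‖ < ε ∧ ‖v - t • wdg u e‖ < ε := by
    have c1 : Continuous fun t : ℂ => ‖t • e‖ := by fun_prop
    have c2 : Continuous fun t : ℂ => ‖v - t • wdg u e‖ := by fun_prop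
    exact (c1.continuousAt.eventually_lt continuousAt_const (by simpa using hε)).and
      (c2.continuousAt.eventually_lt continuousAt_const (by simpa using hv))
  have hi0 : e i = 0 := by simp [he, hj.symm]
  have hj0 : e j = 1 := by simp [he]
  have hid : HasDerivAt (fun t : ℂ => t) 1 0 := hasDerivAt_id 0
  have hL := (hder (wL i j)).const_sub (w (X (pt u v)) i j)
  have hR := ((hid.const_mul (z (X (pt u v)) i)).add ((hder (zL j)).const_mul (u i))).sub
    ((hder (zL i)).mul_const (u j))
  have hEq := hL.unique (hR.congr_of_eventuallyEq (by
    filter_upwards [hev] with t ht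
    have := hP u (t • e) v (v - t • wdg u e) hu ht.1 hv ht.2 (by
      funext p; simp [wdg]; ring) i j
    simp only [Pi.smul_apply, hi0, hj0, smul_eq_mul] at this
    simp only [wL_apply, zL_apply, Pi.add_apply, Pi.sub_apply]
    linear_combination this))
  rw [hAB, hi, hj'] at hEq
  simp
  linear_combination -hEq

/-- The odd part in `z` of the `z`-component of `X`. -/
def oddPart (X : Amb n → Amb n) (u : Fin n → ℂ) (v : Pairs n → ℂ) (i : Fin n) : ℂ :=
  (z (X (pt u v)) i - z (X (pt (-u) v)) i) / 2

/-- The even part in `z`, without constant term, of the `z`-component of `X`. -/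
def evenPart (X : Amb n → Amb n) (u : Fin n → ℂ) (v : Pairs n → ℂ) (i : Fin n) : ℂ :=
  (z (X (pt u v)) i + z (X (pt (-u) v)) i) / 2 - z (X (pt 0 v)) i

lemma norm_half_smul_single {ε : ℝ} (hε : 0 < ε) (k : Fin n) :
    ‖((ε / 2 : ℝ) : ℂ) • (Pi.single k 1 : Fin n → ℂ)‖ < ε := by
  rw [norm_smul, Pi.norm_single]
  simpa [abs_of_pos hε] using hε

section

variable {X : Amb n → Amb n} {ε : ℝ}

/-- In degree at most two the values at `0`, `u` and `-u` already determine the homogeneous parts.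
The bound on `c` only serves to keep `c • u` in the polydisc. -/
lemma z_smul_eq (hn : 2 ≤ n) (hε : 0 < ε) (hX : AnalyticOnNhd ℂ X (ball 0 ε))
    (hP : Polarized X ε) {u : Fin n → ℂ} {v : Pairs n → ℂ} (hu : ‖u‖ < ε) (hv : ‖v‖ < ε)
    {c : ℂ} (hc : ‖c‖ ≤ 1) (i : Fin n) :
    z (X (pt (c • u) v)) i =
      z (X (pt 0 v)) i + c * oddPart X u v i + c ^ 2 * evenPart X u v i := by
  obtain ⟨α, β, Q, hQ, h⟩ := exists_quadratic hn hε hX hP v hv i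
  have hQ0 : Q 0 = 0 := by simpa using hQ 0 0
  have hQn : Q (-u) = Q u := by simpa using hQ (-1) u
  have hcu : ‖c • u‖ < ε := by
    rw [norm_smul]
    exact lt_of_le_of_lt (mul_le_of_le_one_left (norm_nonneg u) hc) hu
  rw [oddPart, evenPart, h _ hcu, h _ hu, h (-u) (by simpa using hu), h 0 (by simpa using hε),
    map_smul, map_neg, hQ, hQ0, hQn, map_zero, smul_eq_mul]
  ring

/-- The matrix of the odd part. -/
def oddMat (X : Amb n → Amb n) (r : ℝ) (v : Pairs n → ℂ) (i k : Fin n) : ℂ :=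
  (r : ℂ)⁻¹ * oddPart X ((r : ℂ) • Pi.single k 1) v i

/-- The odd part is the linear form of `exists_quadratic`. Its matrix is read off at `(ε/2) e_k`,
which lies in the polydisc, so that the entries are explicit analytic functions of `v`. -/
lemma oddPart_eq (hn : 2 ≤ n) (hε : 0 < ε) (hX : AnalyticOnNhd ℂ X (ball 0 ε))
    (hP : Polarized X ε) {u : Fin n → ℂ} {v : Pairs n → ℂ} (hu : ‖u‖ < ε) (hv : ‖v‖ < ε)
    (i : Fin n) : oddPart X u v i = ∑ k, oddMat X (ε / 2) v i k * u k := by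
  obtain ⟨α, β, Q, hQ, h⟩ := exists_quadratic hn hε hX hP v hv i
  have key : ∀ u, ‖u‖ < ε → oddPart X u v i = β u := fun u hu => by
    have hQn : Q (-u) = Q u := by simpa using hQ (-1) u
    rw [oddPart, h _ hu, h (-u) (by simpa using hu), hQn, map_neg]
    ring
  have hM : ∀ k, oddMat X (ε / 2) v i k = β (Pi.single k 1) := fun k => by
    rw [oddMat, key, map_smul, smul_eq_mul]
    · have : ((ε / 2 : ℝ) : ℂ) ≠ 0 := by exact_mod_cast (by positivity : ε / 2 ≠ 0)
      rw [← mul_assoc, inv_mul_cancel₀ this, one_mul]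
    · exact norm_half_smul_single hε k
  rw [key u hu]
  conv_lhs => rw [pi_eq_sum_univ' u, map_sum]
  refine Finset.sum_congr rfl fun k _ => ?_
  rw [hM, map_smul, smul_eq_mul, mul_comm]

lemma analyticOnNhd_X_pt (hX : AnalyticOnNhd ℂ X (ball 0 ε)) {u : Fin n → ℂ} (hu : ‖u‖ < ε)
    (s : Idx n) : AnalyticOnNhd ℂ (fun v => X (pt u v) s) (ball 0 ε) := by
  intro v hv
  have h1 : AnalyticAt ℂ (fun v : Pairs n → ℂ => pt u v) v := by
    refine analyticAt_pi_iff.2 ?_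
    rintro (i | p)
    · exact analyticAt_const
    · exact (ContinuousLinearMap.proj (R := ℂ) (φ := fun _ : Pairs n => ℂ) p).analyticAt v
  have h2 := (hX (pt u v) (norm_pt_lt hu (by simpa using hv))).comp h1
  exact analyticAt_pi_iff.1 h2 s

lemma analyticOnNhd_oddMat (hε : 0 < ε) (hX : AnalyticOnNhd ℂ X (ball 0 ε)) (i k : Fin n) :
    AnalyticOnNhd ℂ (fun v => oddMat X (ε / 2) v i k) (ball 0 ε) := by
  have h1 : ‖((ε / 2 : ℝ) : ℂ) • (Pi.single k 1 : Fin n → ℂ)‖ < ε :=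
    norm_half_smul_single hε k
  have := ((analyticOnNhd_X_pt hX h1 (Sum.inl i)).sub
    (analyticOnNhd_X_pt hX (u := -(((ε / 2 : ℝ) : ℂ) • (Pi.single k 1 : Fin n → ℂ)))
      (by rw [norm_neg]; exact h1) (Sum.inl i))).div_const (c := (2 : ℂ))
  have := (analyticOnNhd_const (v := (((ε / 2 : ℝ) : ℂ))⁻¹)).mul this
  exact this

lemma w_conj_eq (hε : 0 < ε) (hP : Polarized X ε) {v : Pairs n → ℂ} (hv : ‖v‖ < ε) (i j : Fin n) :
    conj (w (X (pt 0 (cv v))) i j) = w (X (pt 0 v)) i j := by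
  have := hP 0 0 v v (by simpa using hε) (by simpa using hε) hv hv (by funext p; simp [wdg]) i j
  simp only [cv_zero, Pi.zero_apply] at this
  linear_combination -this

/-- The polarized equation at `ζ = 0`, where `ω = v`. It reduces the `w`-components to data on `{z =
0}`. -/
lemma w_eq (hε : 0 < ε) (hP : Polarized X ε) {u : Fin n → ℂ} {v : Pairs n → ℂ} (hu : ‖u‖ < ε)
    (hv : ‖v‖ < ε) (i j : Fin n) :
    w (X (pt u v)) i j = w (X (pt 0 v)) i j + u i * conj (z (X (pt 0 (cv v))) j)
      - conj (z (X (pt 0 (cv v))) i) * u j := by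
  have := hP u 0 v v hu (by simpa using hε) hv hv (by funext p; simp [wdg]) i j
  rw [cv_zero, w_conj_eq hε hP hv] at this
  simp only [Pi.zero_apply] at this
  linear_combination this

/-- The separated form of the polarized tangency condition. -/
lemma separated (hn : 2 ≤ n) (hε : 0 < ε) (hX : AnalyticOnNhd ℂ X (ball 0 ε))
    (hP : Polarized X ε) {u ζ : Fin n → ℂ} {v ω : Pairs n → ℂ} (hu : ‖u‖ < ε) (hζ : ‖ζ‖ < ε)
    (hv : ‖v‖ < ε) (hω : ‖ω‖ < ε) (h : v = ω + wdg u ζ) (i j : Fin n) :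
    w (X (pt 0 v)) i j - w (X (pt 0 ω)) i j =
        oddPart X u v i * ζ j - ζ i * oddPart X u v j
          + u i * conj (oddPart X (cv ζ) (cv ω) j) - conj (oddPart X (cv ζ) (cv ω) i) * u j ∧
    u i * (conj (z (X (pt 0 (cv v))) j) - conj (z (X (pt 0 (cv ω))) j))
        - (conj (z (X (pt 0 (cv v))) i) - conj (z (X (pt 0 (cv ω))) i)) * u j =
      evenPart X u v i * ζ j - ζ i * evenPart X u v j ∧
    ζ i * (z (X (pt 0 v)) j - z (X (pt 0 ω)) j) - (z (X (pt 0 v)) i - z (X (pt 0 ω)) i) * ζ j =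
      u i * conj (evenPart X (cv ζ) (cv ω) j) - conj (evenPart X (cv ζ) (cv ω) i) * u j := by
  have hnu : ∀ c : ℂ, ‖c‖ ≤ 1 → ∀ u : Fin n → ℂ, ‖u‖ < ε → ‖c • u‖ < ε := fun c hc u hu => by
    rw [norm_smul]
    exact lt_of_le_of_lt (mul_le_of_le_one_left (norm_nonneg u) hc) hu
  -- The rescaling `(u, ζ) ↦ (c u, d ζ)` with `c d = 1` fixes `u ∧ ζ`, so `v` and `ω` stay
  -- admissible. The equation becomes a Laurent polynomial in `c` with exponents `-1, 0, 1`.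
  have main : ∀ c d : ℂ, ‖c‖ ≤ 1 → ‖d‖ ≤ 1 → c * d = 1 → 
      (w (X (pt 0 v)) i j + c * (u i * conj (z (X (pt 0 (cv v))) j)
        - conj (z (X (pt 0 (cv v))) i) * u j)) - (w (X (pt 0 ω)) i j +
        d * (ζ i * z (X (pt 0 ω)) j - z (X (pt 0 ω)) i * ζ j)) =
      d * ((z (X (pt 0 v)) i + c * oddPart X u v i + c ^ 2 * evenPart X u v i) * ζ j
        - ζ i * (z (X (pt 0 v)) j + c * oddPart X u v j + c ^ 2 * evenPart X u v j))
      + c * (u i * (conj (z (X (pt 0 (cv ω))) j) + d * conj (oddPart X (cv ζ) (cv ω) j)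
          + d ^ 2 * conj (evenPart X (cv ζ) (cv ω) j))
        - (conj (z (X (pt 0 (cv ω))) i) + d * conj (oddPart X (cv ζ) (cv ω) i)
          + d ^ 2 * conj (evenPart X (cv ζ) (cv ω) i)) * u j) := by
    intro c d hc hd hcd
    have e := hP (c • u) (d • ζ) v ω (hnu c hc u hu) (hnu d hd ζ hζ) hv hω (by
      rw [h]; funext p; simp only [wdg, Pi.add_apply, Pi.smul_apply, smul_eq_mul]
      linear_combination (-(u p.1.1 * ζ p.1.2) + ζ p.1.1 * u p.1.2) * hcd) i j
    have hcv : cv (d • ζ) = conj d • cv ζ := by funext k; simp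
    have hζ' : ‖cv ζ‖ < ε := by simpa using hζ
    have hω' : ‖cv ω‖ < ε := by simpa using hω
    have hd' : ‖conj d‖ ≤ 1 := by simpa using hd
    rw [w_eq hε hP (hnu c hc u hu) hv, hcv, w_eq hε hP (hnu _ hd' _ hζ') hω',
      z_smul_eq hn hε hX hP hu hv hc, z_smul_eq hn hε hX hP hu hv hc,
      z_smul_eq hn hε hX hP hζ' hω' hd', z_smul_eq hn hε hX hP hζ' hω' hd'] at e
    simp only [map_add, map_sub, map_mul, map_pow, Complex.conj_conj, Pi.smul_apply, smul_eq_mul,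
      cv_apply, cv_cv, w_conj_eq hε hP hω] at e
    linear_combination e
  -- The values `c = ±1, ±i` isolate the three Laurent coefficients: `m1 + m2` gives exponent 0, `m1
  -- - m2` the sum and `m3 - m4` the difference of the other two.
  have m1 := main 1 1 (by simp) (by simp) (by simp)
  have m2 := main (-1) (-1) (by simp) (by simp) (by simp)
  have m3 := main Complex.I (-Complex.I) (by simp) (by simp) (by simp)
  have m4 := main (-Complex.I) Complex.I (by simp) (by simp) (by simp)
  simp only [neg_sq, Complex.I_sq] at m3 m4
  have m5 : (u i * conj (z (X (pt 0 (cv v))) j) - conj (z (X (pt 0 (cv v))) i) * u j) +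
        (ζ i * z (X (pt 0 ω)) j - z (X (pt 0 ω)) i * ζ j) =
      -((z (X (pt 0 v)) i - evenPart X u v i) * ζ j - ζ i * (z (X (pt 0 v)) j - evenPart X u v j))
      + (u i * (conj (z (X (pt 0 (cv ω))) j) - conj (evenPart X (cv ζ) (cv ω) j))
        - (conj (z (X (pt 0 (cv ω))) i) - conj (evenPart X (cv ζ) (cv ω) i)) * u j) :=
    mul_left_cancel₀ Complex.I_ne_zero (by linear_combination (m3 - m4) / 2)
  refine ⟨?_, ?_, ?_⟩
  · linear_combination (m1 + m2) / 2
  · linear_combination (m1 - m2) / 4 + m5 / 2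
  · linear_combination (m1 - m2) / 4 - m5 / 2

end

/-! ### Derivatives in `w` and the overdetermined systems behind affinity -/

lemma δ_self (i : Fin n) : δ i i = 1 := by simp [δ]

lemma δ_of_ne {i j : Fin n} (h : i ≠ j) : δ i j = 0 := by simp [δ, h]

/-- The algebra behind the determination of the first derivative of the linear part. -/
lemma linear_part_relations {d : Fin n → Fin n → Fin n → Fin n → ℂ}
    (h0 : ∀ i j l k, d j i l k = -d i j l k)
    (h1 : ∀ i j l, l ≠ i → d i j l i = 0)
    (h2 : ∀ i j, i ≠ j → d i j i i = d i j j j)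
    (h3 : ∀ i j k m, i ≠ j → i ≠ k → j ≠ k → m ≠ i → m ≠ k → d i j m k + d k j m i = 0)
    (h3' : ∀ i j k, i ≠ j → i ≠ k → j ≠ k → d i j i k + d k j i i = d k j k k)
    (h4 : ∀ i j k l, i ≠ j → i ≠ k → j ≠ k → l ≠ i →
      d i k i i * δ j l + d i k l j = d i j i i * δ k l + d i j l k) (i j l k : Fin n) :
    d i j l k = d i k i i * δ j l - d j k j j * δ i l := by
  have hd : ∀ i l k, d i i l k = 0 := fun i l k => by
    have := h0 i i l k
    linear_combination (1 / 2 : ℂ) * this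
  by_cases hij : i = j
  · subst hij; rw [hd]; ring
  have hji : j ≠ i := fun h => hij h.symm
  by_cases hki : k = i
  · subst hki
    rw [hd, h0 k j j j, ← h2 k j hij]
    by_cases hl : l = k
    · subst hl; rw [δ_self]; ring
    · rw [h1 _ _ _ hl, δ_of_ne (Ne.symm hl)]; ring
  by_cases hkj : k = j
  · subst hkj
    rw [hd, h2 i k hij]
    by_cases hl : l = k
    · subst hl; rw [δ_self]; ring
    · rw [h0 k i, h1 _ _ _ hl, δ_of_ne (Ne.symm hl)]; ring
  have hik : i ≠ k := fun h => hki h.symm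
  have hjk : j ≠ k := fun h => hkj h.symm
  -- the entry `k k`
  have hkk : ∀ i j k, i ≠ j → i ≠ k → j ≠ k → d i j k k = 0 := by
    intro i j k hij hik hjk
    have e1 := h4 i k j k hik hij hjk.symm hik.symm
    rw [δ_self, δ_of_ne hjk] at e1
    have e2 := h3 i k j k hik hij hjk.symm hik.symm hjk.symm
    have e3 := h3' k j i hjk.symm hik.symm hij.symm
    linear_combination (1 / 2 : ℂ) * e1 + (1 / 2 : ℂ) * e2 + (1 / 2 : ℂ) * e3
      - (1 / 2 : ℂ) * h0 j k k i
  have hj : ∀ i j k, i ≠ j → i ≠ k → j ≠ k → d i j j k = d i k i i := by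
    intro i j k hij hik hjk
    have e := h4 i j k j hij hik hjk hij.symm
    rw [δ_self, δ_of_ne hjk.symm, hkk i k j hik hij hjk.symm] at e
    linear_combination -e
  by_cases hlk : l = k
  · subst hlk
    rw [hkk i j l hij hik hjk, δ_of_ne hjk, δ_of_ne hik]; ring
  by_cases hlj : l = j
  · subst hlj
    rw [hj i l k hij hik hjk, δ_self, δ_of_ne hij]; ring
  by_cases hli : l = i
  · subst hli
    rw [h0 j l, hj j l k hji hjk hik, δ_self, δ_of_ne hji]; ring
  -- Four distinct indices: `h4` makes `d i j l k` and `d k j l i` equal, `h3` makes them opposite,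
  -- so both vanish.
  rw [δ_of_ne (Ne.symm hlj), δ_of_ne (Ne.symm hli)]
  have e1 := h4 j k i l hjk hji hik.symm hlj
  rw [δ_of_ne (Ne.symm hlk), δ_of_ne (Ne.symm hli)] at e1
  have e2 := h3 i j k l hij hik hjk hli hlk
  linear_combination (1 / 2 : ℂ) * e2 - (1 / 2 : ℂ) * h0 k j l i + (1 / 2 : ℂ) * h0 i j l k
    - (1 / 2 : ℂ) * e1

/-- The derivative with respect to `w_{ij}`. -/
def dE (i j : Fin n) (f : (Pairs n → ℂ) → ℂ) (v : Pairs n → ℂ) : ℂ := fderiv ℂ f v (E i j)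

lemma wdg_swap (u v : Fin n → ℂ) : wdg v u = -wdg u v := by
  funext p; simp [wdg]

lemma E_swap (i j : Fin n) : E j i = -E i j := wdg_swap _ _

lemma dE_swap (i j : Fin n) (f : (Pairs n → ℂ) → ℂ) (v : Pairs n → ℂ) :
    dE j i f v = -dE i j f v := by
  rw [dE, E_swap, map_neg, dE]

lemma dE_self (i : Fin n) (f : (Pairs n → ℂ) → ℂ) (v : Pairs n → ℂ) : dE i i f v = 0 := by
  have := dE_swap i i f v
  linear_combination (1 / 2 : ℂ) * this

lemma analyticAt_fderiv_apply {f : (Pairs n → ℂ) → ℂ} {v : Pairs n → ℂ} (hf : AnalyticAt ℂ f v)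
    (S : Pairs n → ℂ) : AnalyticAt ℂ (fun v => fderiv ℂ f v S) v :=
  ((ContinuousLinearMap.apply ℂ ℂ S).analyticAt _).comp hf.fderiv

lemma analyticAt_dE {f : (Pairs n → ℂ) → ℂ} {v : Pairs n → ℂ} (hf : AnalyticAt ℂ f v) (i j : Fin n) :
    AnalyticAt ℂ (dE i j f) v := analyticAt_fderiv_apply hf _

lemma dE_comm {f : (Pairs n → ℂ) → ℂ} {v : Pairs n → ℂ} (hf : AnalyticAt ℂ f v) (i j k l : Fin n) :
    dE i j (dE k l f) v = dE k l (dE i j f) v := by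
  have key : ∀ S T : Pairs n → ℂ, fderiv ℂ (fun v => fderiv ℂ f v S) v T =
      fderiv ℂ (fderiv ℂ f) v T S := fun S T => by
    rw [fderiv_clm_apply hf.fderiv.differentiableAt (differentiableAt_const S)]
    simp
  have hs : IsSymmSndFDerivAt ℂ f v := hf.contDiffAt.isSymmSndFDerivAt (n := ⊤) (by simp)
  have e := hs (E i j) (E k l)
  rw [← key, ← key] at e
  exact e

lemma dE_congr {f g : (Pairs n → ℂ) → ℂ} {ε : ℝ} (h : ∀ v ∈ ball (0 : Pairs n → ℂ) ε, f v = g v)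
    {v : Pairs n → ℂ} (hv : v ∈ ball (0 : Pairs n → ℂ) ε) (i j : Fin n) : dE i j f v = dE i j g v := by
  have : f =ᶠ[𝓝 v] g := Filter.eventuallyEq_of_mem (isOpen_ball.mem_nhds hv) h
  rw [dE, this.fderiv_eq, dE]

lemma dE_add {f g : (Pairs n → ℂ) → ℂ} {v : Pairs n → ℂ} (hf : DifferentiableAt ℂ f v)
    (hg : DifferentiableAt ℂ g v) (i j : Fin n) :
    dE i j (fun v => f v + g v) v = dE i j f v + dE i j g v := by
  simp only [dE, fderiv_fun_add hf hg, _root_.add_apply]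

lemma dE_sub {f g : (Pairs n → ℂ) → ℂ} {v : Pairs n → ℂ} (hf : DifferentiableAt ℂ f v)
    (hg : DifferentiableAt ℂ g v) (i j : Fin n) :
    dE i j (fun v => f v - g v) v = dE i j f v - dE i j g v := by
  simp only [dE, fderiv_fun_sub hf hg, _root_.sub_apply]

lemma dE_mul_const {f : (Pairs n → ℂ) → ℂ} {v : Pairs n → ℂ} (hf : DifferentiableAt ℂ f v) (c : ℂ)
    (i j : Fin n) : dE i j (fun v => f v * c) v = dE i j f v * c := by
  simp only [dE, fderiv_mul_const hf, _root_.smul_apply, smul_eq_mul]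
  ring

lemma dE_const (c : ℂ) (v : Pairs n → ℂ) (i j : Fin n) : dE i j (fun _ => c) v = 0 := by
  simp [dE]

lemma eq_sum_E (v : Pairs n → ℂ) : v = ∑ p : Pairs n, v p • E p.1.1 p.1.2 := by
  have hE : ∀ p q : Pairs n, E p.1.1 p.1.2 q = if p = q then 1 else 0 := by
    intro p q
    rcases p with ⟨⟨a, b⟩, hab⟩
    rcases q with ⟨⟨c, d⟩, hcd⟩
    simp only [E, wdg, Pi.single_apply, Subtype.mk.injEq, Prod.mk.injEq] at hab hcd ⊢
    have : ¬(c = b ∧ d = a) := fun h => by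
      rw [h.1, h.2] at hcd; exact absurd hab (not_lt.2 hcd.le)
    split_ifs <;> grind
  funext q
  simp [hE]

lemma eq_zero_of_dE {f : (Pairs n → ℂ) → ℂ} {ε : ℝ}
    (hf : ∀ v ∈ ball (0 : Pairs n → ℂ) ε, DifferentiableAt ℂ f v)
    (h : ∀ v ∈ ball (0 : Pairs n → ℂ) ε, ∀ i j, i < j → dE i j f v = 0)
    {v : Pairs n → ℂ} (hv : v ∈ ball (0 : Pairs n → ℂ) ε) : f v = f 0 := by
  have h0 : (0 : Pairs n → ℂ) ∈ ball (0 : Pairs n → ℂ) ε :=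
    mem_ball_self (pos_of_mem_ball hv)
  refine isOpen_ball.is_const_of_fderiv_eq_zero (𝕜 := ℂ) (convex_ball _ _).isPreconnected
    (fun x hx => (hf x hx).differentiableWithinAt) (fun x hx => ?_) hv h0
  ext S
  rw [eq_sum_E S, map_sum]
  simp only [map_smul]
  exact Finset.sum_eq_zero fun p _ => by
    have := h x hx _ _ p.2
    rw [dE] at this
    rw [this, smul_zero]

/-- The coordinate `w_{ij}` as a continuous linear functional of `w`. -/
def skL (i j : Fin n) : (Pairs n → ℂ) →L[ℂ] ℂ :=
  LinearMap.toContinuousLinearMap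
    { toFun := fun v => sk v i j
      map_add' := fun x y => sk_add x y i j
      map_smul' := fun c x => sk_smul c x i j }

@[simp] lemma skL_apply (i j : Fin n) (v : Pairs n → ℂ) : skL i j v = sk v i j := rfl

lemma analyticAt_sk (i j : Fin n) (v : Pairs n → ℂ) : AnalyticAt ℂ (fun v => sk v i j) v :=
  (skL i j).analyticAt v

lemma dE_sk (i j k l : Fin n) (v : Pairs n → ℂ) :
    dE i j (fun v => sk v k l) v = δ i k * δ j l - δ j k * δ i l := by
  change fderiv ℂ (skL k l) v (E i j) = _
  rw [ContinuousLinearMap.fderiv, skL_apply, E, sk_wdg]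
  simp [Pi.single_apply, δ, eq_comm]

/-- The gradient of `c` has the shape of that of `∑ w_{ml} q_m`; symmetry of its second derivatives
forces `q` to be constant. To kill `∂_{ij} q_i` this symmetry needs a third index. When only `i` and
`j` exist, `h2` takes its place. -/
lemma affine_of_dE {c q : (Pairs n → ℂ) → Fin n → ℂ} {ε : ℝ} (hn : 2 ≤ n)
    (hc : ∀ l, AnalyticOnNhd ℂ (fun v => c v l) (ball 0 ε))
    (h1 : ∀ v ∈ ball (0 : Pairs n → ℂ) ε, ∀ i j l,
      dE i j (fun v => c v l) v = q v i * δ j l - q v j * δ i l)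
    (h2 : ∀ v ∈ ball (0 : Pairs n → ℂ) ε, ∀ i j, i ≠ j → (∀ k, k = i ∨ k = j) →
      dE i j (dE i j fun v => c v j) v = 0) :
    (∀ v ∈ ball (0 : Pairs n → ℂ) ε, q v = q 0) ∧
    ∀ v ∈ ball (0 : Pairs n → ℂ) ε, ∀ l, c v l = c 0 l + ∑ m, sk v m l * q 0 m := by
  have hnt : Nontrivial (Fin n) := Fin.nontrivial_iff_two_le.2 hn
  have hqd : ∀ i j, i ≠ j → ∀ v ∈ ball (0 : Pairs n → ℂ) ε, dE i j (fun v => c v j) v = q v i :=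
    fun i j hij v hv => by rw [h1 v hv, δ_self, δ_of_ne hij]; ring
  have hq : ∀ i, AnalyticOnNhd ℂ (fun v => q v i) (ball 0 ε) := by
    intro i v hv
    obtain ⟨j, hj⟩ := exists_ne i
    refine (analyticAt_dE (hc j v hv) i j).congr ?_
    exact Filter.eventuallyEq_of_mem (isOpen_ball.mem_nhds hv) (hqd i j hj.symm)
  let f : (Pairs n → ℂ) → Fin n → Fin n → Fin n → ℂ := fun v i j k => dE i j (fun v => q v k) v
  have hrel : ∀ v ∈ ball (0 : Pairs n → ℂ) ε, ∀ i j k l m,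
      f v i j k * δ l m - f v i j l * δ k m = f v k l i * δ j m - f v k l j * δ i m := by
    intro v hv
    have key : ∀ i j k l m, dE i j (dE k l fun v => c v m) v =
        f v i j k * δ l m - f v i j l * δ k m := fun i j k l m => by
      rw [dE_congr (fun v hv => h1 v hv k l m) hv, dE_sub, dE_mul_const, dE_mul_const]
      · exact (hq _ v hv).differentiableAt
      · exact (hq _ v hv).differentiableAt
      · exact (hq _ v hv).differentiableAt.mul_const _
      · exact (hq _ v hv).differentiableAt.mul_const _
    intro i j k l m
    rw [← key, ← key, dE_comm (hc m v hv)]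
  have hsw : ∀ v i j k, f v j i k = -f v i j k := fun v i j k => dE_swap _ _ _ _
  have hf0 : ∀ v ∈ ball (0 : Pairs n → ℂ) ε, ∀ i j, f v i j i = 0 := by
    intro v hv i j
    by_cases hij : i = j
    · subst hij; exact dE_self _ _ _
    by_cases hk : ∀ k, k = i ∨ k = j
    · rw [← h2 v hv i j hij hk]
      exact (dE_congr (hqd i j hij) hv i j).symm
    · push Not at hk
      obtain ⟨k, hki, hkj⟩ := hk
      have := hrel v hv i j k i k
      rw [δ_self, δ_of_ne (Ne.symm hki), δ_of_ne (Ne.symm hkj)] at this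
      linear_combination -this
  have hf1 : ∀ v ∈ ball (0 : Pairs n → ℂ) ε, ∀ i j k, f v i j k = -f v k i j := by
    intro v hv i j k
    have := hrel v hv i j k i i
    rw [δ_self, hf0 v hv, hsw v i k, hf0 v hv] at this
    linear_combination this
  -- Each cyclic shift of the three indices changes the sign, and three shifts give the identity, so
  -- the value equals its own negative.
  have hf : ∀ v ∈ ball (0 : Pairs n → ℂ) ε, ∀ i j k, f v i j k = 0 := by
    intro v hv i j k
    have e1 := hf1 v hv i j k
    have e2 := hf1 v hv k i j
    have e3 := hf1 v hv j k i
    linear_combination (1 / 2 : ℂ) * (e1 - e2 + e3)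
  have hqc : ∀ v ∈ ball (0 : Pairs n → ℂ) ε, q v = q 0 := fun v hv => by
    funext k
    exact eq_zero_of_dE (fun v hv => (hq k v hv).differentiableAt) (fun v hv i j _ => hf v hv i j k) hv
  refine ⟨hqc, fun v hv l => ?_⟩
  have han : ∀ v : Pairs n → ℂ, AnalyticAt ℂ (fun v => ∑ m, sk v m l * q 0 m) v := fun v =>
    Finset.analyticAt_fun_sum _ fun m _ => (analyticAt_sk m l v).mul analyticAt_const
  have hder : ∀ (v : Pairs n → ℂ) i j, dE i j (fun v => ∑ m, sk v m l * q 0 m) v =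
      q 0 i * δ j l - q 0 j * δ i l := by
    intro v i j
    have : dE i j (fun v => ∑ m, sk v m l * q 0 m) v =
        ∑ m, dE i j (fun v => sk v m l * q 0 m) v := by
      simp only [dE]
      rw [fderiv_fun_sum (A := fun m v => sk v m l * q 0 m) fun m _ =>
        ((analyticAt_sk m l v).mul analyticAt_const).differentiableAt]
      simp
    rw [this]
    simp only [dE_mul_const (analyticAt_sk _ l v).differentiableAt, dE_sk, sub_mul,
      Finset.sum_sub_distrib]
    simp [δ, mul_comm]
  have := eq_zero_of_dE (f := fun v => c v l - ∑ m, sk v m l * q 0 m) (ε := ε)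
    (fun v hv => ((hc l v hv).sub (han v)).differentiableAt) (fun v hv i j _ => by
      rw [dE_sub (hc l v hv).differentiableAt (han v).differentiableAt, h1 v hv, hder, hqc v hv]
      ring) hv
  have h0 : ∀ m, sk (0 : Pairs n → ℂ) m l = 0 := fun m => (skL m l).map_zero
  simp only [h0, zero_mul, Finset.sum_const_zero] at this
  linear_combination this

/-! ### Restriction to lines, and the `z`-components on `{z = 0}` -/

lemma eventually_sub_smul_mem {ε : ℝ} {v : Pairs n → ℂ} (hv : v ∈ ball (0 : Pairs n → ℂ) ε)
    (S : Pairs n → ℂ) : ∀ᶠ t : ℂ in 𝓝 0, v - t • S ∈ ball (0 : Pairs n → ℂ) ε := by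
  have c : Continuous fun t : ℂ => v - t • S := by fun_prop
  exact c.continuousAt.eventually_mem (by simpa using isOpen_ball.mem_nhds hv)

lemma hasDerivAt_line {f : (Pairs n → ℂ) → ℂ} {v S : Pairs n → ℂ} {t : ℂ}
    (hf : DifferentiableAt ℂ f (v - t • S)) :
    HasDerivAt (fun t : ℂ => f (v - t • S)) (-(fderiv ℂ f (v - t • S) S)) t := by
  have h1 : HasDerivAt (fun t : ℂ => v - t • S) (-S) t := by
    simpa using ((hasDerivAt_id t).smul_const S).const_sub v
  have := hf.hasFDerivAt.comp_hasDerivAt t h1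
  rwa [map_neg] at this

/-- The increment is exactly linear in `t`, so the directional derivative is constant near `v` along
the line. This yields the second derivative as well, which `affine_of_dE` needs for `n = 2`. -/
lemma fderiv_of_line {f : (Pairs n → ℂ) → ℂ} {ε : ℝ} (hf : AnalyticOnNhd ℂ f (ball 0 ε))
    {v : Pairs n → ℂ} (hv : v ∈ ball (0 : Pairs n → ℂ) ε) {S : Pairs n → ℂ} {C : ℂ}
    (h : ∀ᶠ t : ℂ in 𝓝 0, f (v - t • S) - f v = t * C) :
    fderiv ℂ f v S = -C ∧ fderiv ℂ (fun v => fderiv ℂ f v S) v S = 0 := by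
  have h1 : ∀ᶠ t : ℂ in 𝓝 0, fderiv ℂ f (v - t • S) S = -C := by
    filter_upwards [h.eventually_nhds, eventually_sub_smul_mem hv S] with t ht hm
    have e1 := hasDerivAt_line (hf _ hm).differentiableAt
    have e2 : HasDerivAt (fun t : ℂ => f v + t * C) C t := by
      simpa using ((hasDerivAt_id t).mul_const C).const_add (f v)
    have := e1.unique (e2.congr_of_eventuallyEq (by
      filter_upwards [ht] with s hs
      linear_combination hs))
    linear_combination -this
  have h0 := h1.self_of_nhds
  rw [zero_smul, sub_zero] at h0
  refine ⟨h0, ?_⟩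
  have hv' : v - (0 : ℂ) • S = v := by simp
  have e1 := hasDerivAt_line (f := fun v => fderiv ℂ f v S) (v := v) (S := S) (t := 0)
    (by rw [hv']; exact (analyticAt_fderiv_apply (hf v hv) S).differentiableAt)
  have := e1.unique ((hasDerivAt_const (0 : ℂ) (-C)).congr_of_eventuallyEq h1)
  rw [hv'] at this
  simpa using this

section

variable {X : Amb n → Amb n} {ε : ℝ}

/-- The `z`-component on `{z = 0}` is affine in `w`. -/
lemma z_component_affine (hn : 2 ≤ n) (hε : 0 < ε) (hX : AnalyticOnNhd ℂ X (ball 0 ε))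
    (hP : Polarized X ε) : ∃ q : Fin n → ℂ, ∀ v ∈ ball (0 : Pairs n → ℂ) ε, ∀ l,
      z (X (pt 0 v)) l = z (X (pt 0 0)) l + ∑ m, sk v m l * q m := by
  have hc : ∀ l, AnalyticOnNhd ℂ (fun v => z (X (pt 0 v)) l) (ball 0 ε) := fun l =>
    analyticOnNhd_X_pt hX (by simpa using hε) (Sum.inl l)
  set r : ℂ := ((ε / 2 : ℝ) : ℂ) with hr
  have hr0 : r ≠ 0 := by
    rw [hr]; exact_mod_cast (by positivity : ε / 2 ≠ 0)
  let Y : (Pairs n → ℂ) → Fin n → Fin n → ℂ := fun v i k =>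
    conj (evenPart X (cv (r • Pi.single i 1)) (cv v) k)
  -- With `ζ = r e_i` and `u = (t/r) e_j` one has `u ∧ ζ = -t e_i ∧ e_j`. In the third identity of
  -- `separated` the conjugated term depends only on `ζ` and the base point, hence not on `t`.
  have hline : ∀ v ∈ ball (0 : Pairs n → ℂ) ε, ∀ i j, i ≠ j → ∀ l, l ≠ i →
      ∀ᶠ t : ℂ in 𝓝 0, z (X (pt 0 (v - t • E i j))) l - z (X (pt 0 v)) l =
        t * -(r⁻¹ * r⁻¹ * (Y v i i * δ j l)) := by
    intro v hv i j hij l hl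
    have hsm : ∀ᶠ t : ℂ in 𝓝 0, ‖(t * r⁻¹) • (Pi.single j 1 : Fin n → ℂ)‖ < ε := by
      have c : Continuous fun t : ℂ => ‖(t * r⁻¹) • (Pi.single j 1 : Fin n → ℂ)‖ := by fun_prop
      exact c.continuousAt.eventually_lt continuousAt_const (by simpa using hε)
    filter_upwards [hsm, eventually_sub_smul_mem hv (E i j)] with t ht hm
    have := (separated hn hε hX hP (v := v - t • E i j) (ω := v) ht
      (norm_half_smul_single hε i) (by simpa using hm) (by simpa using hv) (by
        funext p
        simp only [E, wdg, Pi.sub_apply, Pi.add_apply, Pi.smul_apply, smul_eq_mul, ← hr]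
        field_simp
        ring) i l).2.2
    simp only [← hr, Pi.smul_apply, smul_eq_mul, Pi.single_eq_same, mul_one,
      Pi.single_eq_of_ne hij, Pi.single_eq_of_ne hl, mul_zero, zero_mul, sub_zero, zero_sub] at this
    have e : (Pi.single j 1 : Fin n → ℂ) l = δ j l := by simp [Pi.single_apply, δ, eq_comm]
    rw [e] at this
    have := congrArg (fun x => r⁻¹ * x) this
    simp only [← mul_assoc, inv_mul_cancel₀ hr0, one_mul] at this
    rw [this]
    ring
  let q : (Pairs n → ℂ) → Fin n → ℂ := fun v i => r⁻¹ * r⁻¹ * Y v i i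
  have h1 : ∀ v ∈ ball (0 : Pairs n → ℂ) ε, ∀ i j, i ≠ j → ∀ l, l ≠ i →
      dE i j (fun v => z (X (pt 0 v)) l) v = q v i * δ j l := fun v hv i j hij l hl => by
    have := (fderiv_of_line (hc l) hv (hline v hv i j hij l hl)).1
    rw [dE, this]
    simp only [q]
    ring
  obtain ⟨-, h⟩ := affine_of_dE (c := fun v l => z (X (pt 0 v)) l) (q := q) hn hc
    (fun v hv i j l => by
      by_cases hij : i = j
      · subst hij; rw [dE_self]; ring
      by_cases hl : l = i
      · subst hl
        rw [dE_swap, h1 v hv j l (Ne.symm hij) l hij, δ_self, δ_of_ne (Ne.symm hij)]; ring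
      · rw [h1 v hv i j hij l hl, δ_of_ne (Ne.symm hl)]; ring)
    (fun v hv i j hij _ =>
      (fderiv_of_line (hc j) hv (hline v hv i j hij j (Ne.symm hij))).2)
  exact ⟨q 0, fun v hv l => h v hv l⟩

end

/-! ### The part of the `z`-components linear in `z` -/

/-- Matrix-vector product, for matrices given as functions. -/
def mv (M : Fin n → Fin n → ℂ) (u : Fin n → ℂ) (i : Fin n) : ℂ := ∑ k, M i k * u k

lemma mv_smul (M : Fin n → Fin n → ℂ) (c : ℂ) (u : Fin n → ℂ) (i : Fin n) :
    mv M (c • u) i = c * mv M u i := by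
  simp only [mv, Pi.smul_apply, smul_eq_mul, Finset.mul_sum]
  exact Finset.sum_congr rfl fun k _ => by ring

lemma mv_neg (M : Fin n → Fin n → ℂ) (u : Fin n → ℂ) (i : Fin n) : mv M (-u) i = -mv M u i := by
  simp [mv]

lemma mv_add (M : Fin n → Fin n → ℂ) (u u' : Fin n → ℂ) (i : Fin n) :
    mv M (u + u') i = mv M u i + mv M u' i := by
  simp [mv, mul_add, Finset.sum_add_distrib]

lemma mv_single (M : Fin n → Fin n → ℂ) (k i : Fin n) : mv M (Pi.single k 1) i = M i k := by
  simp [mv, Pi.single_apply]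

/-- The components of `x ∧ y`. -/
def wg (x y : Fin n → ℂ) (p q : Fin n) : ℂ := x p * y q - y p * x q

lemma dE_eq_fderiv_wdg (i j : Fin n) (f : (Pairs n → ℂ) → ℂ) (v : Pairs n → ℂ) :
    dE i j f v = fderiv ℂ f v (wdg (Pi.single i 1) (Pi.single j 1)) := rfl

section

variable {X : Amb n → Amb n} {ε : ℝ}

/-- The matrix of the odd part, conjugated. -/
def oddMatConj (X : Amb n → Amb n) (r : ℝ) (v : Pairs n → ℂ) (i k : Fin n) : ℂ :=
  conj (oddMat X r (cv v) i k)

/-- Conjugating both the argument and the value of a holomorphic function gives a holomorphic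
function. -/
lemma differentiableAt_oddMatConj (hε : 0 < ε) (hX : AnalyticOnNhd ℂ X (ball 0 ε)) (i k : Fin n)
    {v : Pairs n → ℂ} (hv : v ∈ ball (0 : Pairs n → ℂ) ε) :
    DifferentiableAt ℂ (fun v => oddMatConj X (ε / 2) v i k) v := by
  have h := (analyticOnNhd_oddMat hε hX i k (star v)
    (by simpa using hv)).differentiableAt.star_star
  rw [star_star] at h
  exact h

lemma odd_separated (hn : 2 ≤ n) (hε : 0 < ε) (hX : AnalyticOnNhd ℂ X (ball 0 ε))
    (hP : Polarized X ε) {u ζ : Fin n → ℂ} {v ω : Pairs n → ℂ} (hu : ‖u‖ < ε) (hζ : ‖ζ‖ < ε)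
    (hv : ‖v‖ < ε) (hω : ‖ω‖ < ε) (h : v = ω + wdg u ζ) (p q : Fin n) :
    w (X (pt 0 v)) p q - w (X (pt 0 ω)) p q =
      wg (mv (oddMat X (ε / 2) v) u) ζ p q + wg u (mv (oddMatConj X (ε / 2) ω) ζ) p q := by
  have e := (separated hn hε hX hP hu hζ hv hω h p q).1
  have hc : ∀ i, conj (oddPart X (cv ζ) (cv ω) i) = mv (oddMatConj X (ε / 2) ω) ζ i := fun i => by
    rw [oddPart_eq hn hε hX hP (by simpa using hζ) (by simpa using hω)]
    simp [mv, oddMatConj]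
  rw [hc, hc, oddPart_eq hn hε hX hP hu hv, oddPart_eq hn hε hX hP hu hv] at e
  rw [e]
  simp only [wg, mv]
  ring

/-- Only `u ∧ ζ` enters the constraint, so arbitrary `u` and `ζ` are brought into the polydisc by
scaling with `η` and `t/η`. Exchanging the two base points and the sign of `ζ` gives a second
formula for the same increment; adding the two eliminates the `w`-components and leaves a relation
between the two matrices. -/
lemma odd_line (hn : 2 ≤ n) (hε : 0 < ε) (hX : AnalyticOnNhd ℂ X (ball 0 ε))
    (hP : Polarized X ε) {v : Pairs n → ℂ} (hv : v ∈ ball (0 : Pairs n → ℂ) ε) (u ζ : Fin n → ℂ)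
    (p q : Fin n) : ∀ᶠ t : ℂ in 𝓝 0,
      w (X (pt 0 v)) p q - w (X (pt 0 (v - t • wdg u ζ))) p q =
        t * (wg (mv (oddMat X (ε / 2) v) u) ζ p q +
          wg u (mv (oddMatConj X (ε / 2) (v - t • wdg u ζ)) ζ) p q) ∧
      wg (fun i => mv (oddMat X (ε / 2) v) u i - mv (oddMat X (ε / 2) (v - t • wdg u ζ)) u i) ζ p q
        = wg u (fun i => mv (oddMatConj X (ε / 2) v) ζ i -
          mv (oddMatConj X (ε / 2) (v - t • wdg u ζ)) ζ i) p q := by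
  obtain ⟨η, hη, hηu⟩ : ∃ η : ℂ, η ≠ 0 ∧ ‖η • u‖ < ε := by
    have c : Continuous fun t : ℂ => ‖t • u‖ := by fun_prop
    have h1 : ∀ᶠ t : ℂ in 𝓝 0, ‖t • u‖ < ε :=
      c.continuousAt.eventually_lt continuousAt_const (by simpa using hε)
    obtain ⟨t, ht, ht'⟩ := ((h1.filter_mono nhdsWithin_le_nhds).and
      (self_mem_nhdsWithin (a := (0 : ℂ)) (s := {0}ᶜ))).exists
    exact ⟨t, ht', ht⟩
  have hsm : ∀ᶠ t : ℂ in 𝓝 0, ‖(t * η⁻¹) • ζ‖ < ε := by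
    have c : Continuous fun t : ℂ => ‖(t * η⁻¹) • ζ‖ := by fun_prop
    exact c.continuousAt.eventually_lt continuousAt_const (by simpa using hε)
  filter_upwards [hsm, eventually_sub_smul_mem hv (wdg u ζ)] with t ht hm
  have hv' : ‖v‖ < ε := by simpa using hv
  have hm' : ‖v - t • wdg u ζ‖ < ε := by simpa using hm
  have e1 := odd_separated hn hε hX hP hηu ht hv' hm' (by
    funext p
    simp only [wdg, Pi.sub_apply, Pi.add_apply, Pi.smul_apply, smul_eq_mul]
    field_simp
    ring) p q
  have e2 := odd_separated hn hε hX hP (u := η • u) (ζ := -((t * η⁻¹) • ζ)) hηu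
    (by rwa [norm_neg]) hm' hv' (by
    funext p
    simp only [wdg, Pi.sub_apply, Pi.add_apply, Pi.smul_apply, Pi.neg_apply, smul_eq_mul]
    field_simp
    ring) p q
  simp only [wg, mv_smul, mv_neg, Pi.smul_apply, Pi.neg_apply, smul_eq_mul] at e1 e2 ⊢
  have hη1 : η * η⁻¹ = 1 := mul_inv_cancel₀ hη
  constructor
  · rw [e1]
    linear_combination t * (mv (oddMat X (ε / 2) v) u p * ζ q - ζ p * mv (oddMat X (ε / 2) v) u q +
      (u p * mv (oddMatConj X (ε / 2) (v - t • wdg u ζ)) ζ q -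
        mv (oddMatConj X (ε / 2) (v - t • wdg u ζ)) ζ p * u q)) * hη1
  · by_cases ht0 : t = 0
    · subst ht0; simp
    · refine mul_left_cancel₀ ht0 ?_
      linear_combination -e1 - e2 - t * ((mv (oddMat X (ε / 2) v) u p
        - mv (oddMat X (ε / 2) (v - t • wdg u ζ)) u p) * ζ q
        - ζ p * (mv (oddMat X (ε / 2) v) u q - mv (oddMat X (ε / 2) (v - t • wdg u ζ)) u q)
        - (u p * (mv (oddMatConj X (ε / 2) v) ζ q - mv (oddMatConj X (ε / 2) (v - t • wdg u ζ)) ζ q)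
        - (mv (oddMatConj X (ε / 2) v) ζ p - mv (oddMatConj X (ε / 2) (v - t • wdg u ζ)) ζ p) * u q)) * hη1

/-- The derivative of the matrix `M` in the direction `S`. -/
def dMat (M : (Pairs n → ℂ) → Fin n → Fin n → ℂ) (v S : Pairs n → ℂ) (i k : Fin n) : ℂ :=
  fderiv ℂ (fun v => M v i k) v S

lemma hasDerivAt_mv_line {M : (Pairs n → ℂ) → Fin n → Fin n → ℂ} {v S : Pairs n → ℂ} {t : ℂ}
    (hM : ∀ i k, DifferentiableAt ℂ (fun v => M v i k) (v - t • S)) (u : Fin n → ℂ) (i : Fin n) :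
    HasDerivAt (fun t : ℂ => mv (M (v - t • S)) u i) (-(mv (dMat M (v - t • S) S) u i)) t := by
  have := HasDerivAt.fun_sum (u := Finset.univ) (A := fun k (t : ℂ) => M (v - t • S) i k * u k)
    (A' := fun k => -(dMat M (v - t • S) S i k) * u k) (x := t) fun k _ =>
      (hasDerivAt_line (hM i k)).mul_const (u k)
  simpa [mv, neg_mul] using this

/-- These are the derivatives at `t = 0` of the two identities of `odd_line`. -/
lemma odd_first_order (hn : 2 ≤ n) (hε : 0 < ε) (hX : AnalyticOnNhd ℂ X (ball 0 ε))
    (hP : Polarized X ε) {v : Pairs n → ℂ} (hv : v ∈ ball (0 : Pairs n → ℂ) ε) (u ζ : Fin n → ℂ)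
    (p q : Fin n) :
    fderiv ℂ (fun v => w (X (pt 0 v)) p q) v (wdg u ζ) =
      wg (mv (oddMat X (ε / 2) v) u) ζ p q + wg u (mv (oddMatConj X (ε / 2) v) ζ) p q ∧
    wg (mv (dMat (oddMat X (ε / 2)) v (wdg u ζ)) u) ζ p q =
      wg u (mv (dMat (oddMatConj X (ε / 2)) v (wdg u ζ)) ζ) p q := by
  have hv0 : v - (0 : ℂ) • wdg u ζ = v := by simp
  have hM : ∀ i k, DifferentiableAt ℂ (fun v => oddMat X (ε / 2) v i k) (v - (0 : ℂ) • wdg u ζ) :=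
    fun i k => by rw [hv0]; exact (analyticOnNhd_oddMat hε hX i k v hv).differentiableAt
  have hM' : ∀ i k, DifferentiableAt ℂ (fun v => oddMatConj X (ε / 2) v i k)
      (v - (0 : ℂ) • wdg u ζ) :=
    fun i k => by rw [hv0]; exact differentiableAt_oddMatConj hε hX i k hv
  have ha : DifferentiableAt ℂ (fun v => w (X (pt 0 v)) p q) (v - (0 : ℂ) • wdg u ζ) := by
    rw [hv0]
    have h1 : DifferentiableAt ℂ (fun v => X (pt 0 v)) v :=
      differentiableAt_pi.2 fun s =>
        (analyticOnNhd_X_pt hX (u := 0) (by simpa using hε) s v hv).differentiableAt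
    exact (wL p q).differentiableAt.comp v h1
  have hd := fun ζ i => hasDerivAt_mv_line hM ζ i
  have hd' := fun ζ i => hasDerivAt_mv_line hM' ζ i
  have hid : HasDerivAt (fun t : ℂ => t) 1 0 := hasDerivAt_id 0
  constructor
  · have e1 := (hasDerivAt_line ha).const_sub (w (X (pt 0 v)) p q)
    have e2 := hid.mul ((((hd' ζ q).const_mul (u p)).sub ((hd' ζ p).mul_const (u q))).const_add
      (wg (mv (oddMat X (ε / 2) v) u) ζ p q))
    have := e1.unique (e2.congr_of_eventuallyEq (by
      filter_upwards [odd_line hn hε hX hP hv u ζ p q] with t ht using ht.1))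
    simp only [hv0, wg] at this ⊢
    simp only [neg_neg, Pi.sub_apply, hv0] at this
    linear_combination this
  · have e1 := (((hd u p).const_sub (mv (oddMat X (ε / 2) v) u p)).mul_const (ζ q)).sub
      (((hd u q).const_sub (mv (oddMat X (ε / 2) v) u q)).const_mul (ζ p))
    have e2 := (((hd' ζ q).const_sub (mv (oddMatConj X (ε / 2) v) ζ q)).const_mul (u p)).sub
      (((hd' ζ p).const_sub (mv (oddMatConj X (ε / 2) v) ζ p)).mul_const (u q))
    have := e1.unique (e2.congr_of_eventuallyEq (by
      filter_upwards [odd_line hn hε hX hP hv u ζ p q] with t ht using ht.2))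
    simp only [neg_neg, hv0] at this
    exact this

end

lemma single_eq_δ (i p : Fin n) : (Pi.single i 1 : Fin n → ℂ) p = δ i p := by
  simp [Pi.single_apply, δ, eq_comm]

lemma wdg_add_self (u ζ : Fin n → ℂ) : wdg u (ζ + u) = wdg u ζ := by
  funext p; simp only [wdg, Pi.add_apply]; ring

section

variable {X : Amb n → Amb n} {ε : ℝ}

/-- The bivectors `e_i ∧ e_j` and `e_j ∧ (-e_i)` agree, so the first-order formula computes the same
derivative twice. Comparison shows that the difference of the two matrices is scalar. The second
first-order relation, used for both orders of `i` and `j`, shows that this scalar does not depend on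
`w`. -/
lemma oddMatConj_eq (hn : 2 ≤ n) (hε : 0 < ε) (hX : AnalyticOnNhd ℂ X (ball 0 ε))
    (hP : Polarized X ε) : ∃ μ : ℂ, ∀ v ∈ ball (0 : Pairs n → ℂ) ε, ∀ i k,
      oddMatConj X (ε / 2) v i k = oddMat X (ε / 2) v i k - μ * δ i k := by
  have hnt : Nontrivial (Fin n) := Fin.nontrivial_iff_two_le.2 hn
  have key : ∀ v ∈ ball (0 : Pairs n → ℂ) ε, ∀ i j p q,
      oddMat X (ε / 2) v p i * δ j q - δ j p * oddMat X (ε / 2) v q i +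
        (δ i p * oddMatConj X (ε / 2) v q j - oddMatConj X (ε / 2) v p j * δ i q) =
      -(oddMat X (ε / 2) v p j * δ i q) + δ i p * oddMat X (ε / 2) v q j +
        (-(δ j p * oddMatConj X (ε / 2) v q i) + oddMatConj X (ε / 2) v p i * δ j q) := by
    intro v hv i j p q
    have e1 := (odd_first_order hn hε hX hP hv (Pi.single i 1) (Pi.single j 1) p q).1
    have e2 := (odd_first_order hn hε hX hP hv (Pi.single j 1) (-Pi.single i 1) p q).1
    have hS : wdg (Pi.single j 1 : Fin n → ℂ) (-Pi.single i 1) =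
        wdg (Pi.single i 1) (Pi.single j 1) := by
      funext p; simp only [wdg, Pi.neg_apply]; ring
    rw [hS, e1] at e2
    simp only [wg, mv_neg, mv_single, Pi.neg_apply, single_eq_δ] at e2
    linear_combination e2
  have hoff : ∀ v ∈ ball (0 : Pairs n → ℂ) ε, ∀ i k, i ≠ k →
      oddMatConj X (ε / 2) v i k = oddMat X (ε / 2) v i k := by
    intro v hv i k hik
    have := key v hv k k k i
    rw [δ_self, δ_of_ne (Ne.symm hik)] at this
    linear_combination (1 / 2 : ℂ) * this
  have hdiag : ∀ v ∈ ball (0 : Pairs n → ℂ) ε, ∀ i j,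
      oddMat X (ε / 2) v i i - oddMatConj X (ε / 2) v i i =
        oddMat X (ε / 2) v j j - oddMatConj X (ε / 2) v j j := by
    intro v hv i j
    by_cases hij : i = j
    · rw [hij]
    have := key v hv i j i j
    rw [δ_self, δ_self, δ_of_ne hij, δ_of_ne (Ne.symm hij)] at this
    linear_combination this
  obtain ⟨i₀, -⟩ := exists_pair_ne (Fin n)
  have hdM : ∀ i k, ∀ v ∈ ball (0 : Pairs n → ℂ) ε,
      DifferentiableAt ℂ (fun v => oddMat X (ε / 2) v i k) v := fun i k v hv =>
    (analyticOnNhd_oddMat hε hX i k v hv).differentiableAt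
  have hdL : ∀ i k, ∀ v ∈ ball (0 : Pairs n → ℂ) ε,
      DifferentiableAt ℂ (fun v => oddMatConj X (ε / 2) v i k) v := fun i k v hv =>
    differentiableAt_oddMatConj hε hX i k hv
  have hc : ∀ v ∈ ball (0 : Pairs n → ℂ) ε,
      oddMat X (ε / 2) v i₀ i₀ - oddMatConj X (ε / 2) v i₀ i₀ =
        oddMat X (ε / 2) 0 i₀ i₀ - oddMatConj X (ε / 2) 0 i₀ i₀ := fun v hv => by
    refine eq_zero_of_dE (f := fun v => oddMat X (ε / 2) v i₀ i₀ - oddMatConj X (ε / 2) v i₀ i₀)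
      (fun v hv => (hdM _ _ v hv).sub (hdL _ _ v hv)) (fun v hv i j hij => ?_) hv
    have hij' := hij.ne
    have e1 := (odd_first_order hn hε hX hP hv (Pi.single i 1) (Pi.single j 1) i j).2
    have e2 := (odd_first_order hn hε hX hP hv (Pi.single j 1) (Pi.single i 1) j i).2
    simp only [wg, mv_single, single_eq_δ, δ_self, δ_of_ne hij', δ_of_ne hij'.symm, dMat,
      ← dE_eq_fderiv_wdg] at e1 e2
    simp only [dE_swap i j] at e2
    have f1 := dE_congr (fun v hv => hdiag v hv i₀ i) hv i j
    have f2 := dE_congr (fun v hv => hdiag v hv i₀ j) hv i j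
    rw [dE_sub (hdM i i v hv) (hdL i i v hv)] at f1
    rw [dE_sub (hdM j j v hv) (hdL j j v hv)] at f2
    linear_combination (1 / 2 : ℂ) * (f1 + f2 + e1 - e2)
  refine ⟨oddMat X (ε / 2) 0 i₀ i₀ - oddMatConj X (ε / 2) 0 i₀ i₀, fun v hv i k => ?_⟩
  by_cases hik : i = k
  · subst hik
    rw [δ_self, ← hc v hv, hdiag v hv i₀ i]; ring
  · rw [hoff v hv i k hik, δ_of_ne hik]; ring

lemma odd_first_order' (hn : 2 ≤ n) (hε : 0 < ε) (hX : AnalyticOnNhd ℂ X (ball 0 ε))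
    (hP : Polarized X ε) {μ : ℂ} (hμ : ∀ v ∈ ball (0 : Pairs n → ℂ) ε, ∀ i k,
      oddMatConj X (ε / 2) v i k = oddMat X (ε / 2) v i k - μ * δ i k)
    {v : Pairs n → ℂ} (hv : v ∈ ball (0 : Pairs n → ℂ) ε) (u ζ : Fin n → ℂ) (p q : Fin n) :
    fderiv ℂ (fun v => w (X (pt 0 v)) p q) v (wdg u ζ) =
      wg (mv (oddMat X (ε / 2) v) u) ζ p q + wg u (mv (oddMat X (ε / 2) v) ζ) p q
        - μ * wg u ζ p q ∧
    wg (mv (dMat (oddMat X (ε / 2)) v (wdg u ζ)) u) ζ p q =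
      wg u (mv (dMat (oddMat X (ε / 2)) v (wdg u ζ)) ζ) p q := by
  obtain ⟨e1, e2⟩ := odd_first_order hn hε hX hP hv u ζ p q
  have h1 : ∀ i, mv (oddMatConj X (ε / 2) v) ζ i = mv (oddMat X (ε / 2) v) ζ i - μ * ζ i := by
    intro i
    simp only [mv, hμ v hv, sub_mul, Finset.sum_sub_distrib]
    simp [δ]
  have h2 : ∀ S, dMat (oddMatConj X (ε / 2)) v S = dMat (oddMat X (ε / 2)) v S := by
    intro S
    funext i k
    have : (fun v => oddMatConj X (ε / 2) v i k) =ᶠ[𝓝 v]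
        fun v => oddMat X (ε / 2) v i k - μ * δ i k :=
      Filter.eventuallyEq_of_mem (isOpen_ball.mem_nhds hv) fun v hv => hμ v hv i k
    rw [dMat, this.fderiv_eq, fderiv_sub_const, dMat]
  rw [h2] at e2
  refine ⟨?_, e2⟩
  rw [e1]
  simp only [wg, h1]
  ring

/-- Differentiating the hypothesis in `t` cancels the first derivatives and leaves `t` times the
second derivative at `v - t • S`. This vanishes for `t ≠ 0`, and continuity gives the value at `t =
0`. -/
lemma eq_zero_of_line {f : (Pairs n → ℂ) → ℂ} (hf : AnalyticOnNhd ℂ f (ball 0 ε))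
    {v : Pairs n → ℂ} (hv : v ∈ ball (0 : Pairs n → ℂ) ε) {S : Pairs n → ℂ}
    (h : ∀ᶠ t : ℂ in 𝓝 0, f (v - t • S) - f v = t * -(fderiv ℂ f (v - t • S) S)) :
    fderiv ℂ (fun v => fderiv ℂ f v S) v S = 0 := by
  set f₂ := fun v => fderiv ℂ (fun v => fderiv ℂ f v S) v S with hf₂
  have hf₂a : AnalyticOnNhd ℂ f₂ (ball 0 ε) := fun x hx =>
    analyticAt_fderiv_apply (analyticAt_fderiv_apply (hf x hx) S) S
  have h1 : ∀ᶠ t : ℂ in 𝓝 0, t * f₂ (v - t • S) = 0 := by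
    filter_upwards [h.eventually_nhds, eventually_sub_smul_mem hv S] with t ht hm
    have e1 := (hasDerivAt_line (hf _ hm).differentiableAt).sub_const (f v)
    have e2 := (hasDerivAt_id t).mul (hasDerivAt_line (f := fun v => fderiv ℂ f v S) (S := S)
      (analyticAt_fderiv_apply (hf _ hm) S).differentiableAt).neg
    have := e1.unique (e2.congr_of_eventuallyEq (by
      filter_upwards [ht] with s hs
      simpa using hs))
    simp only [Pi.neg_apply, id] at this
    linear_combination -this
  have hv' : v - (0 : ℂ) • S = v := by simp
  have h2 : Filter.Tendsto (fun t : ℂ => f₂ (v - t • S)) (𝓝[≠] 0) (𝓝 (f₂ v)) := by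
    have hd : DifferentiableAt ℂ f₂ (v - (0 : ℂ) • S) := by
      rw [hv']; exact (hf₂a v hv).differentiableAt
    have := (hasDerivAt_line hd).continuousAt.tendsto
    rw [hv'] at this
    exact this.mono_left nhdsWithin_le_nhds
  refine tendsto_nhds_unique h2 (tendsto_const_nhds.congr' ?_)
  filter_upwards [h1.filter_mono nhdsWithin_le_nhds, self_mem_nhdsWithin] with t ht ht0
  exact ((mul_eq_zero.1 ht).resolve_left ht0).symm

/-- The first identity of `odd_line` is differentiated at every small `t`, not only at `0`. As the
derivatives of the entries `i i` and `j j` along `e_i ∧ e_j` coincide, the result is the hypothesis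
of `eq_zero_of_line` for the entry `i i`. -/
lemma odd_second_order (hn : 2 ≤ n) (hε : 0 < ε) (hX : AnalyticOnNhd ℂ X (ball 0 ε))
    (hP : Polarized X ε) {v : Pairs n → ℂ} (hv : v ∈ ball (0 : Pairs n → ℂ) ε)
    {i j : Fin n} (hij : i ≠ j) :
    dE i j (dE i j fun v => oddMat X (ε / 2) v j j) v = 0 := by
  obtain ⟨μ, hμ⟩ := oddMatConj_eq hn hε hX hP
  have hji := hij.symm
  have hM := fun i k => analyticOnNhd_oddMat hε hX i k
  have r1 : ∀ v ∈ ball (0 : Pairs n → ℂ) ε, dE i j (fun v => w (X (pt 0 v)) i j) v =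
      oddMat X (ε / 2) v i i + oddMat X (ε / 2) v j j - μ := fun v hv => by
    have := (odd_first_order' hn hε hX hP hμ hv (Pi.single i 1) (Pi.single j 1) i j).1
    simp only [wg, mv_single, single_eq_δ, δ_self, δ_of_ne hij, δ_of_ne hji,
      ← dE_eq_fderiv_wdg] at this
    rw [this]; ring
  have r2 : ∀ v ∈ ball (0 : Pairs n → ℂ) ε, dE i j (fun v => oddMat X (ε / 2) v i i) v =
      dE i j (fun v => oddMat X (ε / 2) v j j) v := fun v hv => by
    have := (odd_first_order' hn hε hX hP hμ hv (Pi.single i 1) (Pi.single j 1) i j).2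
    simp only [wg, mv_single, single_eq_δ, δ_self, δ_of_ne hij, δ_of_ne hji, dMat,
      ← dE_eq_fderiv_wdg] at this
    linear_combination this
  rw [← dE_congr r2 hv]
  refine eq_zero_of_line (hM i i) hv ?_
  have ha : ∀ v ∈ ball (0 : Pairs n → ℂ) ε,
      DifferentiableAt ℂ (fun v => w (X (pt 0 v)) i j) v := fun v hv => by
    have h1 : DifferentiableAt ℂ (fun v => X (pt 0 v)) v :=
      differentiableAt_pi.2 fun s =>
        (analyticOnNhd_X_pt hX (u := 0) (by simpa using hε) s v hv).differentiableAt
    exact (wL i j).differentiableAt.comp v h1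
  filter_upwards [(odd_line hn hε hX hP hv (Pi.single i 1) (Pi.single j 1) i j).eventually_nhds,
    eventually_sub_smul_mem hv (E i j),
    (eventually_sub_smul_mem hv (E i j)).eventually_nhds] with t ht hm hm'
  have e1 := (hasDerivAt_line (S := E i j) (ha _ hm)).const_sub (w (X (pt 0 v)) i j)
  have e2 := (hasDerivAt_id t).mul (((hasDerivAt_line (S := E i j)
    (hM j j _ hm).differentiableAt).const_add (oddMat X (ε / 2) v i i)).sub_const μ)
  have := e1.unique (e2.congr_of_eventuallyEq (by
    filter_upwards [ht, hm'] with s hs hms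
    have := hs.1
    simp only [wg, mv_single, single_eq_δ, δ_self, δ_of_ne hij, δ_of_ne hji] at this
    change w (X (pt 0 v)) i j - w (X (pt 0 (v - s • E i j))) i j = _ 
    change w (X (pt 0 v)) i j - w (X (pt 0 (v - s • E i j))) i j = _ at this
    rw [this]
    change _ * (_ + (1 * oddMatConj X (ε / 2) (v - s • E i j) j j - _)) = _
    rw [hμ _ hms, δ_self]
    simp
    left
    ring))
  have f1 := r1 _ hm
  have f2 := r2 _ hm
  simp only [dE] at f1 f2
  simp only [id] at this
  rw [f1] at this
  rw [f2]
  linear_combination this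

end

lemma wdg_add_left (u u' ζ : Fin n → ℂ) : wdg (u + u') ζ = wdg u ζ + wdg u' ζ := by
  funext p; simp only [wdg, Pi.add_apply]; ring

lemma wdg_neg_left (u ζ : Fin n → ℂ) : wdg (-u) ζ = -wdg u ζ := by
  funext p; simp only [wdg, Pi.neg_apply]; ring

section

variable {X : Amb n → Amb n} {ε : ℝ}

/-- Two sources of relations feed `linear_part_relations`: the derivative of the matrix along `u ∧
ζ` maps `u` to a multiple of `u`, and the mixed second derivatives of the `w`-components agree. -/
lemma dE_oddMat (hn : 2 ≤ n) (hε : 0 < ε) (hX : AnalyticOnNhd ℂ X (ball 0 ε))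
    (hP : Polarized X ε) {v : Pairs n → ℂ} (hv : v ∈ ball (0 : Pairs n → ℂ) ε) :
    (∀ i j l k, dE i j (fun v => oddMat X (ε / 2) v l k) v =
      dE i k (fun v => oddMat X (ε / 2) v i i) v * δ j l -
        dE j k (fun v => oddMat X (ε / 2) v j j) v * δ i l) ∧
    ∀ i k, dE i k (fun v => oddMat X (ε / 2) v i i) v =
      -dE k i (fun v => oddMat X (ε / 2) v k k) v := by
  obtain ⟨μ, hμ⟩ := oddMatConj_eq hn hε hX hP
  set M := oddMat X (ε / 2) with hMdef
  have hM : ∀ i k, AnalyticOnNhd ℂ (fun v => M v i k) (ball 0 ε) := fun i k =>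
    analyticOnNhd_oddMat hε hX i k
  have r1 := fun v hv u ζ p q => (odd_first_order' (v := v) hn hε hX hP hμ hv u ζ p q).1
  have r2 := fun v hv u ζ p q => (odd_first_order' (v := v) hn hε hX hP hμ hv u ζ p q).2
  rw [← hMdef] at r1 r2
  -- Replacing `ζ` by `ζ + u` does not change `u ∧ ζ`; the extra terms say that the derivative sends
  -- `u` to a vector parallel to `u`.
  have r4 : ∀ u ζ p q, mv (dMat M v (wdg u ζ)) u p * u q = u p * mv (dMat M v (wdg u ζ)) u q := by
    intro u ζ p q
    have e1 := r2 v hv u ζ p q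
    have e2 := r2 v hv u (ζ + u) p q
    rw [wdg_add_self] at e2
    simp only [wg, mv_add, Pi.add_apply] at e1 e2
    linear_combination (1 / 2 : ℂ) * (e2 - e1)
  let d : Fin n → Fin n → Fin n → Fin n → ℂ := fun i j l k => dE i j (fun v => M v l k) v
  have hdd : ∀ i j l k, dMat M v (wdg (Pi.single i 1) (Pi.single j 1)) l k = d i j l k :=
    fun _ _ _ _ => rfl
  have hda : ∀ S T l k, dMat M v (S + T) l k = dMat M v S l k + dMat M v T l k :=
    fun S T l k => by simp [dMat]
  have hdn : ∀ S l k, dMat M v (-S) l k = -dMat M v S l k := fun S l k => by simp [dMat]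
  have h0 : ∀ i j l k, d j i l k = -d i j l k := fun i j l k => dE_swap _ _ _ _
  have h1 : ∀ i j l, l ≠ i → d i j l i = 0 := by
    intro i j l hl
    have := r4 (Pi.single i 1) (Pi.single j 1) l i
    simpa [mv_single, single_eq_δ, δ_self, δ_of_ne (Ne.symm hl), hdd] using this
  have h2 : ∀ i j, i ≠ j → d i j i i = d i j j j := by
    intro i j hij
    have := r2 v hv (Pi.single i 1) (Pi.single j 1) i j
    simpa [wg, mv_single, single_eq_δ, δ_self, δ_of_ne hij, δ_of_ne (Ne.symm hij), hdd] using this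
  have h3 : ∀ i j k m, i ≠ j → i ≠ k → j ≠ k → m ≠ i → m ≠ k → d i j m k + d k j m i = 0 := by
    intro i j k m hij hik hjk hmi hmk
    have := r4 (Pi.single i 1 + Pi.single k 1) (Pi.single j 1) m i
    simp only [wdg_add_left, mv_add, mv_single, Pi.add_apply, single_eq_δ, hda, hdd, δ_self,
      δ_of_ne (Ne.symm hmi), δ_of_ne (Ne.symm hmk), δ_of_ne (Ne.symm hik), h1 i j m hmi,
      h1 k j m hmk] at this
    linear_combination this
  have h3' : ∀ i j k, i ≠ j → i ≠ k → j ≠ k → d i j i k + d k j i i = d k j k k := by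
    intro i j k hij hik hjk
    have e1 := r4 (Pi.single i 1 + Pi.single k 1) (Pi.single j 1) i k
    have e2 := r4 (Pi.single i 1 + -Pi.single k 1) (Pi.single j 1) i k
    simp only [wdg_add_left, wdg_neg_left, mv_add, mv_neg, mv_single, Pi.add_apply, Pi.neg_apply,
      single_eq_δ, hda, hdn, hdd, δ_self,
      δ_of_ne hik, δ_of_ne (Ne.symm hik), h1 i j k (Ne.symm hik), h1 k j i hik] at e1 e2
    linear_combination (1 / 2 : ℂ) * e1 + (1 / 2 : ℂ) * e2
  have hMd : ∀ i k, DifferentiableAt ℂ (fun v => M v i k) v := fun i k =>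
    (hM i k v hv).differentiableAt
  -- The two sides are the mixed derivatives of the `w_{il}`-component along `e_i ∧ e_j` and `e_i ∧
  -- e_k`.
  have h4 : ∀ i j k l, i ≠ j → i ≠ k → j ≠ k → l ≠ i →
      d i k i i * δ j l + d i k l j = d i j i i * δ k l + d i j l k := by
    intro i j k l hij hik hjk hl
    have ha : AnalyticAt ℂ (fun v => w (X (pt 0 v)) i l) v :=
      ((wL i l).analyticAt _).comp (analyticAt_pi_iff.2 fun s =>
        analyticOnNhd_X_pt hX (u := 0) (by simpa using hε) s v hv)
    have key : ∀ j k, i ≠ j → dE i k (dE i j fun v => w (X (pt 0 v)) i l) v =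
        d i k i i * δ j l + d i k l j := by
      intro j k hij
      rw [dE_congr (g := fun v => M v i i * δ j l + M v l j - μ * δ j l) (fun v hv => ?_) hv]
      · have e1 := dE_sub (((hMd i i).mul_const (δ j l)).add (hMd l j))
          (differentiableAt_const (μ * δ j l)) i k
        refine e1.trans ?_
        have e2 := dE_add ((hMd i i).mul_const (δ j l)) (hMd l j) i k
        rw [dE_const, sub_zero]
        refine e2.trans ?_
        rw [dE_mul_const (hMd i i)]
      · have := r1 v hv (Pi.single i 1) (Pi.single j 1) i l
        simp only [wg, mv_single, single_eq_δ, δ_self, δ_of_ne (Ne.symm hl),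
          δ_of_ne (Ne.symm hij)] at this
        refine this.trans ?_
        ring
    rw [← key j k hij, ← key k j hik, dE_comm ha]
  refine ⟨fun i j l k => linear_part_relations h0 h1 h2 h3 h3' h4 i j l k, fun i k => ?_⟩
  by_cases hik : i = k
  · subst hik; rw [dE_self]; simp
  · have := h2 i k hik
    rw [dE_swap i k, neg_neg]
    exact this

/-- The odd part is affine in `w`. -/
lemma oddMat_affine (hn : 2 ≤ n) (hε : 0 < ε) (hX : AnalyticOnNhd ℂ X (ball 0 ε))
    (hP : Polarized X ε) : ∃ κ : Fin n → Fin n → ℂ, (∀ i k, κ i k = -κ k i) ∧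
      ∀ v ∈ ball (0 : Pairs n → ℂ) ε, ∀ l k,
        oddMat X (ε / 2) v l k = oddMat X (ε / 2) 0 l k + ∑ m, sk v m l * κ m k := by
  have h0 : (0 : Pairs n → ℂ) ∈ ball (0 : Pairs n → ℂ) ε := mem_ball_self hε
  refine ⟨fun i k => dE i k (fun v => oddMat X (ε / 2) v i i) 0,
    (dE_oddMat hn hε hX hP h0).2, fun v hv l k => ?_⟩
  refine (affine_of_dE (c := fun v l => oddMat X (ε / 2) v l k)
    (q := fun v i => dE i k (fun v => oddMat X (ε / 2) v i i) v) hn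
    (fun l => analyticOnNhd_oddMat hε hX l k)
    (fun v hv i j l => (dE_oddMat hn hε hX hP hv).1 i j l k) (fun v hv i j hij hk => ?_)).2 v hv l
  -- Here `n = 2`, so the column `k` is `i` or `j`: for `i` the first derivative already vanishes,
  -- and for `j` the entry is diagonal.
  rcases hk k with rfl | rfl
  · rw [dE_congr (g := fun _ => 0) (fun v hv => ?_) hv, dE_const]
    rw [(dE_oddMat hn hε hX hP hv).1, dE_self, δ_of_ne hij]
    ring
  · exact odd_second_order hn hε hX hP hv hij

/-! ### Normal form of the `z`-components -/

/-- The explicit form of the `z`-components of a tangent holomorphic field. -/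
theorem z_component_eq (hn : 2 ≤ n) (hε : 0 < ε) (hX : AnalyticOnNhd ℂ X (ball 0 ε))
    (hP : Polarized X ε) : ∃ (q : Fin n → ℂ) (s : Pairs n → ℝ) (A : Fin n → Fin n → ℝ) (θ : ℝ),
      ∀ (u : Fin n → ℂ) (v : Pairs n → ℂ), ‖u‖ < ε → ‖v‖ < ε → ∀ l,
        z (X (pt u v)) l = z (X (pt 0 0)) l + ∑ m, sk v m l * q m + ∑ k, A l k * u k
          + Complex.I * θ * u l + ∑ k, (∑ m, sk v m l * sk (fun p => (s p : ℂ)) m k) * u k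
          + (∑ m, conj (q m) * u m) * u l := by
  have hnt : Nontrivial (Fin n) := Fin.nontrivial_iff_two_le.2 hn
  obtain ⟨q, hq⟩ := z_component_affine hn hε hX hP
  obtain ⟨κ, hκ, hκM⟩ := oddMat_affine hn hε hX hP
  obtain ⟨μ, hμ⟩ := oddMatConj_eq hn hε hX hP
  obtain ⟨i₀, -⟩ := exists_pair_ne (Fin n)
  have h0 : (0 : Pairs n → ℂ) ∈ ball (0 : Pairs n → ℂ) ε := mem_ball_self hε
  have hcM : ∀ v ∈ ball (0 : Pairs n → ℂ) ε, ∀ i k, conj (oddMat X (ε / 2) (cv v) i k) =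
      oddMat X (ε / 2) v i k - μ * δ i k := hμ
  have hM0 : ∀ i k, conj (oddMat X (ε / 2) 0 i k) = oddMat X (ε / 2) 0 i k - μ * δ i k :=
    fun i k => by have := hcM 0 h0 i k; rwa [cv_zero] at this
  -- At `v = t e_m ∧ e_l` the sum in row `l` reduces to `t κ m k`, which is compared with its
  -- conjugated counterpart.
  have hκr : ∀ m k, conj (κ m k) = κ m k := by
    intro m k
    obtain ⟨l, hl⟩ := exists_ne m
    obtain ⟨t, ht, ht0⟩ : ∃ t : ℂ, t • E m l ∈ ball (0 : Pairs n → ℂ) ε ∧ t ≠ 0 := by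
      have c : Continuous fun t : ℂ => t • E m l := by fun_prop
      have h1 : ∀ᶠ t : ℂ in 𝓝 0, t • E m l ∈ ball (0 : Pairs n → ℂ) ε :=
        c.continuousAt.eventually_mem (by simpa using ball_mem_nhds _ hε)
      exact ((h1.filter_mono nhdsWithin_le_nhds).and
        (self_mem_nhdsWithin (a := (0 : ℂ)) (s := {0}ᶜ))).exists
    have e1 := hcM _ ht l k
    have hcv : cv (t • E m l) ∈ ball (0 : Pairs n → ℂ) ε := by
      rw [mem_ball_zero_iff, norm_cv]; simpa using ht
    rw [hκM _ ht, hκM _ hcv, map_add, hM0, map_sum] at e1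
    have hs : ∀ m', sk (t • E m l) m' l = if m' = m then t else 0 := by
      intro m'
      rw [sk_smul, E, sk_wdg]
      by_cases h : m' = m
      · subst h; simp [hl.symm, hl]
      · simp [h, hl]
    simp only [map_mul, sk_cv, Complex.conj_conj, hs] at e1
    simp only [ite_mul, zero_mul, Finset.sum_ite_eq', Finset.mem_univ, if_true] at e1
    refine mul_left_cancel₀ ht0 ?_
    linear_combination e1
  have hκs : ∀ m k, κ m k = sk (fun p => (((κ p.1.1 p.1.2).re : ℝ) : ℂ)) m k := by
    intro m k
    refine (sk_ext (f := κ) (fun i j => hκ j i) (fun p => ?_) m k).symm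
    exact Complex.conj_eq_iff_re.1 (hκr _ _)
  -- The matrix at `0` differs from its conjugate by a scalar matrix, so its imaginary part is
  -- scalar: this is the parameter `θ` of the rotation.
  have hM0' : ∀ i k, oddMat X (ε / 2) 0 i k = ((oddMat X (ε / 2) 0 i k).re : ℂ) +
      Complex.I * ((oddMat X (ε / 2) 0 i₀ i₀).im : ℝ) * δ i k := by
    have him : ∀ i k, μ * δ i k = 2 * Complex.I * ((oddMat X (ε / 2) 0 i k).im : ℂ) := by
      intro i k
      have e1 := hM0 i k
      have e2 := Complex.sub_conj (oddMat X (ε / 2) 0 i k)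
      rw [e1] at e2
      push_cast at e2
      linear_combination e2
    intro i k
    have e1 := him i k
    have e2 := him i₀ i₀
    rw [δ_self] at e2
    have e3 := Complex.re_add_im (oddMat X (ε / 2) 0 i k)
    linear_combination -e3 - (1 / 2 : ℂ) * e1 + (1 / 2 : ℂ) * δ i k * e2
  -- With `ζ = t e_j`, `j ≠ l`, the second identity of `separated` isolates `t` times the quadratic
  -- part; its other side is an increment of the affine part found above, with `q` conjugated.
  have hev : ∀ (u : Fin n → ℂ) (v : Pairs n → ℂ), ‖u‖ < ε → ‖v‖ < ε → ∀ l,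
      evenPart X u v l = (∑ m, conj (q m) * u m) * u l := by
    intro u v hu hv l
    have hv' : v ∈ ball (0 : Pairs n → ℂ) ε := by simpa using hv
    obtain ⟨j, hj⟩ := exists_ne l
    have hsm : ∀ᶠ t : ℂ in 𝓝 0, ‖t • (Pi.single j 1 : Fin n → ℂ)‖ < ε := by
      have c : Continuous fun t : ℂ => ‖t • (Pi.single j 1 : Fin n → ℂ)‖ := by fun_prop
      exact c.continuousAt.eventually_lt continuousAt_const (by simpa using hε)
    obtain ⟨t, ⟨ht, hm⟩, ht0⟩ := (((hsm.and (eventually_sub_smul_mem hv'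
      (wdg u (Pi.single j 1)))).filter_mono nhdsWithin_le_nhds).and
        (self_mem_nhdsWithin (a := (0 : ℂ)) (s := {0}ᶜ))).exists
    set ω := v - t • wdg u (Pi.single j 1) with hω
    have hωn : ‖ω‖ < ε := by simpa using hm
    have e := (separated hn hε hX hP hu ht hv hωn (by
      funext p
      simp only [hω, wdg, Pi.sub_apply, Pi.add_apply, Pi.smul_apply, smul_eq_mul]
      ring) l j).2.1
    have hc : ∀ k, conj (z (X (pt 0 (cv v))) k) - conj (z (X (pt 0 (cv ω))) k) =
        t * ((∑ m, conj (q m) * u m) * δ j k - conj (q j) * u k) := by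
      intro k
      have m1 : cv v ∈ ball (0 : Pairs n → ℂ) ε := by rw [mem_ball_zero_iff, norm_cv]; exact hv
      have m2 : cv ω ∈ ball (0 : Pairs n → ℂ) ε := by rw [mem_ball_zero_iff, norm_cv]; exact hωn
      rw [hq _ m1, hq _ m2]
      simp only [map_add, map_sum, map_mul, sk_cv, Complex.conj_conj]
      rw [add_sub_add_left_eq_sub, ← Finset.sum_sub_distrib]
      simp only [hω, sk_sub, sk_smul, sk_wdg, single_eq_δ]
      have : ∀ m, sk v m k * conj (q m) - (sk v m k - t * (u m * δ j k - δ j m * u k)) * conj (q m)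
          = t * ((conj (q m) * u m) * δ j k - δ j m * (conj (q m) * u k)) := fun m => by ring
      simp only [this]
      rw [← Finset.mul_sum, Finset.sum_sub_distrib, Finset.sum_mul]
      congr 2
      simp [δ]
    rw [hc, hc, Pi.smul_apply, Pi.smul_apply, single_eq_δ, single_eq_δ, δ_self, δ_of_ne hj] at e
    simp only [smul_eq_mul] at e
    refine mul_left_cancel₀ ht0 ?_
    linear_combination -e
  refine ⟨q, fun p => (κ p.1.1 p.1.2).re, fun i k => (oddMat X (ε / 2) 0 i k).re,
    (oddMat X (ε / 2) 0 i₀ i₀).im, fun u v hu hv l => ?_⟩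
  have hv' : v ∈ ball (0 : Pairs n → ℂ) ε := by simpa using hv
  have e := z_smul_eq hn hε hX hP hu hv (c := 1) (by simp) l
  rw [one_smul, hq v hv', hev u v hu hv, oddPart_eq hn hε hX hP hu hv] at e
  rw [e]
  have hsum : ∑ k, oddMat X (ε / 2) v l k * u k = ∑ k, ((oddMat X (ε / 2) 0 l k).re : ℂ) * u k
      + Complex.I * ((oddMat X (ε / 2) 0 i₀ i₀).im : ℝ) * u l
      + ∑ k, (∑ m, sk v m l * κ m k) * u k := by
    have : ∀ k, oddMat X (ε / 2) v l k * u k = ((oddMat X (ε / 2) 0 l k).re : ℂ) * u k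
      + δ l k * (Complex.I * ((oddMat X (ε / 2) 0 i₀ i₀).im : ℝ) * u k)
      + (∑ m, sk v m l * κ m k) * u k := fun k => by
      linear_combination (hκM v hv' l k + hM0' l k) * u k
    simp only [this, Finset.sum_add_distrib]
    simp [δ]
  rw [hsum]
  simp only [← hκs]
  ring

end

/-! ### Combinations of generators in coordinates, and the local theorem -/

lemma sk_sum {ι : Type*} (T : Finset ι) (f : ι → Pairs n → ℂ) (i j : Fin n) :
    sk (∑ a ∈ T, f a) i j = ∑ a ∈ T, sk (f a) i j := map_sum (skL i j) f T

lemma sk_eq_sum (v : Pairs n → ℂ) (i j : Fin n) :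
    sk v i j = ∑ p : Pairs n, v p * (δ p.1.1 i * δ p.1.2 j - δ p.1.2 i * δ p.1.1 j) := by
  conv_lhs => rw [eq_sum_E v]
  rw [sk_sum]
  refine Finset.sum_congr rfl fun p _ => ?_
  rw [sk_smul, E, sk_wdg]
  simp only [single_eq_δ]

lemma sum_sk_mul (v : Pairs n → ℂ) (f : Fin n → Fin n → ℂ) :
    ∑ i, ∑ j, sk v i j * f i j = ∑ p : Pairs n, v p * (f p.1.1 p.1.2 - f p.1.2 p.1.1) := by
  simp only [sk_eq_sum, Finset.sum_mul]
  have h1 : ∀ i : Fin n, ∑ j, ∑ p : Pairs n,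
      v p * (δ p.1.1 i * δ p.1.2 j - δ p.1.2 i * δ p.1.1 j) * f i j =
      ∑ p : Pairs n, v p * (δ p.1.1 i * f i p.1.2 - δ p.1.2 i * f i p.1.1) := fun i => by
    rw [Finset.sum_comm]
    refine Finset.sum_congr rfl fun p _ => ?_
    have : ∀ j, v p * (δ p.1.1 i * δ p.1.2 j - δ p.1.2 i * δ p.1.1 j) * f i j =
      δ p.1.2 j * (v p * δ p.1.1 i * f i j) - δ p.1.1 j * (v p * δ p.1.2 i * f i j) :=
      fun j => by ring
    simp only [this, Finset.sum_sub_distrib]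
    have h2 : ∀ (a : Fin n) (g : Fin n → ℂ), ∑ j, δ a j * g j = g a := fun a g => by
      simp [δ]
    rw [h2, h2]
    ring
  simp only [h1]
  rw [Finset.sum_comm]
  refine Finset.sum_congr rfl fun p _ => ?_
  rw [← Finset.mul_sum, Finset.sum_sub_distrib]
  simp [δ]

/-- The coefficient vector with the given data. -/
def coeffs (t : Pairs n → ℝ) (c : Fin n → ℂ) (A : Fin n → Fin n → ℝ) (θ : ℝ) (q : Fin n → ℂ)
    (s : Pairs n → ℝ) : GenIdx n → ℝ :=
  Sum.elim t (Sum.elim (Sum.elim (fun i => (c i).re) fun i => (c i).im)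
    (Sum.elim (Sum.elim (fun p => A p.2 p.1) fun _ => θ)
      (Sum.elim (Sum.elim (fun i => (q i).re) fun i => -(q i).im) s)))

/-- The right-hand side is the normal form of `z_component_eq`, so its parameters are directly
coefficients of generators. The sign of `(q i).im` and the transposition of `A` in `coeffs` are
chosen for this. -/
lemma comb_coeffs_inl (t : Pairs n → ℝ) (c : Fin n → ℂ) (A : Fin n → Fin n → ℝ) (θ : ℝ)
    (q : Fin n → ℂ) (s : Pairs n → ℝ) (x : Amb n) (l : Fin n) :
    comb (coeffs t c A θ q s) x (Sum.inl l) =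
      c l + ∑ m, w x m l * q m + ∑ k, A l k * z x k + Complex.I * θ * z x l
        + ∑ k, (∑ m, w x m l * sk (fun p => (s p : ℂ)) m k) * z x k
        + (∑ m, conj (q m) * z x m) * z x l := by
  have hs : ∑ k, (∑ m, w x m l * sk (fun p => (s p : ℂ)) m k) * z x k =
      ∑ p : Pairs n, (s p : ℂ) * (z x p.1.1 * w x l p.1.2 - z x p.1.2 * w x l p.1.1) := by
    have := sum_sk_mul (fun p => (s p : ℂ)) fun m k => w x m l * z x k
    simp only [Finset.sum_mul]
    rw [Finset.sum_comm]
    refine Eq.trans ?_ (this.trans ?_)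
    · exact Finset.sum_congr rfl fun m _ => Finset.sum_congr rfl fun k _ => by ring
    · exact Finset.sum_congr rfl fun p _ => by rw [w_swap x l, w_swap x l]; ring
  have h1 : ∀ k, ((c k).re : ℂ) * δ k l + ((c k).im : ℂ) * (Complex.I * δ k l) = δ k l * c k :=
    fun k => by
      conv_rhs => rw [← Complex.re_add_im (c k)]
      ring
  have h2 : ∀ k, ((q k).re : ℂ) * (z x k * z x l - w x l k) +
      -((q k).im : ℂ) * (Complex.I * (z x k * z x l + w x l k)) =
        w x k l * q k + conj (q k) * z x k * z x l := fun k => by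
    have e1 := Complex.re_add_im (q k)
    have e2 := Complex.re_add_im (conj (q k))
    rw [Complex.conj_re, Complex.conj_im] at e2
    push_cast at e2
    rw [w_swap x k l]
    linear_combination w x k l * e1 + z x k * z x l * e2
  rw [hs]
  simp only [comb, coeffs, gen, Finset.sum_apply, Pi.smul_apply, Fintype.sum_sum_type,
    Sum.elim_inl, Sum.elim_inr, Lm2, Lm1, ILm1, L0, Rot, L1, IL1, L2, field, Complex.real_smul,
    mul_zero, Finset.sum_const_zero, zero_add, Fintype.sum_prod_type, Finset.univ_unique,
    Finset.sum_singleton, Complex.ofReal_neg]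
  rw [← Finset.sum_add_distrib, ← Finset.sum_add_distrib]
  simp only [h1, h2, Finset.sum_add_distrib, Finset.sum_mul]
  have h3 : ∑ k, ∑ j, (A j k : ℂ) * (δ j l * z x k) = ∑ k, (A l k : ℂ) * z x k := by
    refine Finset.sum_congr rfl fun k _ => ?_
    simp [δ]
  rw [h3]
  simp only [δ, ite_mul, one_mul, zero_mul, Finset.sum_ite_eq', Finset.mem_univ, if_true]
  ring

lemma comb_coeffs_inr (t : Pairs n → ℝ) (c : Fin n → ℂ) (A : Fin n → Fin n → ℝ) (θ : ℝ)
    (q : Fin n → ℂ) (s : Pairs n → ℝ) (x : Amb n) (p : Pairs n) :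
    comb (coeffs t c A θ q s) x (Sum.inr p) =
      t p + (z x p.1.1 * conj (c p.1.2) - z x p.1.2 * conj (c p.1.1))
        + ∑ m, (A p.1.1 m * w x m p.1.2 + A p.1.2 m * w x p.1.1 m)
        + (z x p.1.1 * ∑ m, w x m p.1.2 * conj (q m) - z x p.1.2 * ∑ m, w x m p.1.1 * conj (q m))
        + ∑ m, ∑ r, sk (fun p => (s p : ℂ)) m r * (w x m p.1.1 * w x r p.1.2) := by
  obtain ⟨⟨k, l⟩, hkl⟩ := p
  have hs : ∑ m, ∑ r, sk (fun p => (s p : ℂ)) m r * (w x m k * w x r l) =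
      ∑ p : Pairs n, (s p : ℂ) * (w x k p.1.1 * w x l p.1.2 - w x k p.1.2 * w x l p.1.1) := by
    rw [sum_sk_mul]
    exact Finset.sum_congr rfl fun p _ => by
      rw [w_swap x k, w_swap x k, w_swap x l, w_swap x l]; ring
  have h1 : ∀ i, ((c i).re : ℂ) * (δ i l * z x k - δ i k * z x l) +
      ((c i).im : ℂ) * -(Complex.I * (δ i l * z x k - δ i k * z x l)) =
      δ i l * (z x k * conj (c i)) - δ i k * (z x l * conj (c i)) := fun i => by
    have e2 := Complex.re_add_im (conj (c i))
    rw [Complex.conj_re, Complex.conj_im] at e2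
    push_cast at e2
    linear_combination (δ i l * z x k - δ i k * z x l) * e2
  have h2 : ∀ i, ((q i).re : ℂ) * (z x l * w x k i - z x k * w x l i) +
      -((q i).im : ℂ) * (Complex.I * (z x l * w x k i - z x k * w x l i)) =
        z x k * (w x i l * conj (q i)) - z x l * (w x i k * conj (q i)) := fun i => by
    have e2 := Complex.re_add_im (conj (q i))
    rw [Complex.conj_re, Complex.conj_im] at e2
    push_cast at e2
    rw [w_swap x i l, w_swap x i k]
    linear_combination (z x k * w x i l - z x l * w x i k) * e2
  have h3 : ∑ i, ∑ j, (A j i : ℂ) * (δ j l * w x k i + δ j k * w x i l) =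
      ∑ m, (A k m * w x m l + A l m * w x k m) := by
    refine Finset.sum_congr rfl fun i _ => ?_
    have : ∀ j, (A j i : ℂ) * (δ j l * w x k i + δ j k * w x i l) =
      δ j l * (A j i * w x k i) + δ j k * (A j i * w x i l) := fun j => by ring
    simp only [this, Finset.sum_add_distrib]
    simp [δ, add_comm]
  have h0 : ∑ p' : Pairs n, (t p' : ℂ) * (δ p'.1.1 k * δ p'.1.2 l) = t ⟨(k, l), hkl⟩ := by
    have := sk_eq_sum (fun p => (t p : ℂ)) k l
    rw [sk_lt _ hkl] at this
    rw [this]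
    refine Finset.sum_congr rfl fun p' _ => ?_
    have : δ p'.1.2 k * δ p'.1.1 l = 0 := by
      by_contra h
      simp only [δ, mul_ite, mul_one, mul_zero, ite_eq_right_iff, Classical.not_imp] at h
      obtain ⟨h1, h2, -⟩ := h
      have := p'.2
      rw [h1, h2] at this
      exact absurd this (not_lt.2 hkl.le)
    rw [this, sub_zero]
  simp only [hs]
  simp only [comb, coeffs, gen, Finset.sum_apply, Pi.smul_apply, Fintype.sum_sum_type,
    Sum.elim_inl, Sum.elim_inr, Lm2, Lm1, ILm1, L0, Rot, L1, IL1, L2, field, Complex.real_smul,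
    mul_zero, Finset.sum_const_zero, add_zero, Fintype.sum_prod_type, Finset.univ_unique,
    Complex.ofReal_neg]
  rw [← Finset.sum_add_distrib, ← Finset.sum_add_distrib]
  simp only [h0, h1, h2, h3, Finset.sum_sub_distrib, Finset.mul_sum]
  simp only [δ, ite_mul, one_mul, zero_mul, Finset.sum_ite_eq', Finset.mem_univ, if_true]
  ring

lemma comb_add (d d' : GenIdx n → ℝ) : comb (d + d') = comb d + comb d' := by
  simp only [comb, Pi.add_apply, add_smul, Finset.sum_add_distrib]

lemma Polarized.mono {X : Amb n → Amb n} {ε ε' : ℝ} (h : Polarized X ε) (h' : ε' ≤ ε) :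
    Polarized X ε' := fun u ζ v ω hu hζ hv hω =>
  h u ζ v ω (hu.trans_le h') (hζ.trans_le h') (hv.trans_le h') (hω.trans_le h')

/-- Holomorphic fields near `0` that are tangent to the quadric are combinations of the
generators. -/
theorem exists_comb_of_ball (hn : 2 ≤ n) {X : Amb n → Amb n} {R : ℝ} (hR : 0 < R)
    (hX : AnalyticOnNhd ℂ X (ball 0 R)) (hT : ∀ x ∈ quadric n, x ∈ ball 0 R → TangentAt X x) :
    ∃ d : GenIdx n → ℝ, ∀ᶠ x in 𝓝 0, X x = comb d x := by
  obtain ⟨ε₁, hε₁, hε₁R, hP₁⟩ := polarization_pt hR hX hT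
  obtain ⟨q, s, A, θ, hz⟩ := z_component_eq hn hε₁ (hX.mono (ball_subset_ball hε₁R)) hP₁
  -- This combination has the `z`-components of `X`. The coefficients of `Lm2` do not affect them
  -- and are fixed afterwards by `d₂`.
  set d₁ := coeffs (0 : Pairs n → ℝ) (fun l => z (X (pt 0 0)) l) A θ q s with hd₁
  let Y : Amb n → Amb n := fun x => X x - comb d₁ x
  have hY : AnalyticOnNhd ℂ Y (ball 0 R) := hX.sub (analyticOnNhd_comb _ _)
  have hYT : ∀ x ∈ quadric n, x ∈ ball 0 R → TangentAt Y x := fun x hM hx p => by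
    rw [map_sub, hT x hM hx p, tangentAt_comb d₁ hM p, sub_zero]
  obtain ⟨ε₂, hε₂, hε₂R, hP₂⟩ := polarization_pt hR hY hYT
  set ε := min ε₁ ε₂
  have hε : 0 < ε := lt_min hε₁ hε₂
  have hP : Polarized Y ε := Polarized.mono hP₂ (min_le_right _ _)
  have hYε : AnalyticOnNhd ℂ Y (ball 0 ε) :=
    hY.mono (ball_subset_ball ((min_le_left _ _).trans hε₁R))
  have hz0 : ∀ (u : Fin n → ℂ) (v : Pairs n → ℂ), ‖u‖ < ε → ‖v‖ < ε → ∀ l,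
      z (Y (pt u v)) l = 0 := fun u v hu hv l => by
    have := hz u v (hu.trans_le (min_le_left _ _)) (hv.trans_le (min_le_left _ _)) l
    change X (pt u v) (Sum.inl l) - comb d₁ (pt u v) (Sum.inl l) = 0
    rw [hd₁, comb_coeffs_inl]
    exact sub_eq_zero.2 this
  have h0 : (0 : Pairs n → ℂ) ∈ ball (0 : Pairs n → ℂ) ε := mem_ball_self hε
  have hodd : ∀ (u : Fin n → ℂ) (v : Pairs n → ℂ), ‖u‖ < ε → ‖v‖ < ε → ∀ l,
      oddPart Y u v l = 0 := fun u v hu hv l => by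
    rw [oddPart, hz0 u v hu hv, hz0 (-u) v (by simpa using hu) hv]; simp
  have hmat : ∀ v ∈ ball (0 : Pairs n → ℂ) ε, ∀ i k, oddMat Y (ε / 2) v i k = 0 :=
    fun v hv i k => by
      rw [oddMat, hodd _ _ (norm_half_smul_single hε k) (by simpa using hv), mul_zero]
  have hmat' : ∀ v ∈ ball (0 : Pairs n → ℂ) ε, ∀ i k, oddMatConj Y (ε / 2) v i k = 0 :=
    fun v hv i k => by
      rw [oddMatConj, hmat _ (by rw [mem_ball_zero_iff, norm_cv]; simpa using hv), map_zero]
  have ha : ∀ i j, ∀ v ∈ ball (0 : Pairs n → ℂ) ε,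
      DifferentiableAt ℂ (fun v => w (Y (pt 0 v)) i j) v := fun i j v hv => by
    have h1 : DifferentiableAt ℂ (fun v => Y (pt 0 v)) v :=
      differentiableAt_pi.2 fun s =>
        (analyticOnNhd_X_pt hYε (u := 0) (by simpa using hε) s v hv).differentiableAt
    exact (wL i j).differentiableAt.comp v h1
  -- Both matrices of `Y` vanish, so `odd_first_order` makes the gradient of the `w`-components on
  -- `{z = 0}` zero; `w_eq` extends this off `{z = 0}`.
  have hconst : ∀ i j, ∀ v ∈ ball (0 : Pairs n → ℂ) ε,
      w (Y (pt 0 v)) i j = w (Y (pt 0 0)) i j := fun i j v hv => by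
    refine eq_zero_of_dE (f := fun v => w (Y (pt 0 v)) i j) (ha i j) (fun v hv k l _ => ?_) hv
    rw [dE_eq_fderiv_wdg, (odd_first_order hn hε hYε hP hv _ _ i j).1]
    simp only [wg, mv, hmat v hv, hmat' v hv]
    simp
  have hreal : ∀ i j, conj (w (Y (pt 0 0)) i j) = w (Y (pt 0 0)) i j := fun i j => by
    have := w_conj_eq hε hP (v := 0) (by simpa using hε) i j
    rwa [cv_zero] at this
  set d₂ := coeffs (fun p : Pairs n => (w (Y (pt 0 0)) p.1.1 p.1.2).re) 0 0 0 0 0 with hd₂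
  refine ⟨d₁ + d₂, ?_⟩
  filter_upwards [ball_mem_nhds (0 : Amb n) hε] with x hx
  have hx' : ‖x‖ < ε := by simpa using hx
  obtain ⟨u, v, rfl⟩ : ∃ u v, x = pt u v := ⟨_, _, (pt_eta x).symm⟩
  have hu : ‖u‖ < ε := by
    refine (pi_norm_lt_iff hε).2 fun i => ?_
    exact (norm_le_pi_norm (pt u v) (Sum.inl i)).trans_lt hx'
  have hv : ‖v‖ < ε := by
    refine (pi_norm_lt_iff hε).2 fun i => ?_
    exact (norm_le_pi_norm (pt u v) (Sum.inr i)).trans_lt hx'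
  have hsk : ∀ m k, sk (fun _ : Pairs n => (0 : ℂ)) m k = 0 := fun m k => (skL m k).map_zero
  have key : Y (pt u v) = comb d₂ (pt u v) := by
    funext a
    rcases a with l | p
    · rw [hd₂, comb_coeffs_inl]
      have := hz0 u v hu hv l
      simp only [z] at this
      rw [this]
      simp [hsk]
    · rw [hd₂, comb_coeffs_inr, ← w_pair (Y (pt u v)), w_eq hε hP hu hv,
        hconst _ _ v (by simpa using hv)]
      have h1 : ∀ l, z (Y (pt 0 (cv v))) l = 0 := fun l =>
        hz0 0 (cv v) (by simpa using hε) (by simpa using hv) l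
      have := Complex.conj_eq_iff_re.1 (hreal p.1.1 p.1.2)
      simp [h1, hsk, this]
  rw [comb_add, Pi.add_apply, ← key]
  simp [Y]

/-! ### Transport to an arbitrary base point -/

/-- The unipotent linear map `(z, w) ↦ (z, w + z ∧ ā)`. -/
def shear (a : Fin n → ℂ) : Amb n →L[ℂ] Amb n :=
  LinearMap.toContinuousLinearMap
    { toFun := fun v => Sum.elim (fun i => z v i) fun q : Pairs n =>
        v (Sum.inr q) + (z v q.1.1 * conj (a q.1.2) - z v q.1.2 * conj (a q.1.1))
      map_add' := fun v v' => by
        funext s; rcases s with i | q <;> simp [z]; ring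
      map_smul' := fun c v => by
        funext s; rcases s with i | q <;> simp [z]; ring }

@[simp] lemma z_shear (a : Fin n → ℂ) (v : Amb n) (i : Fin n) : z (shear a v) i = z v i := rfl

lemma shear_inr (a : Fin n → ℂ) (v : Amb n) (q : Pairs n) : shear a v (Sum.inr q) =
    v (Sum.inr q) + (z v q.1.1 * conj (a q.1.2) - z v q.1.2 * conj (a q.1.1)) := rfl

lemma shear_shear_neg (a : Fin n → ℂ) (v : Amb n) : shear a (shear (-a) v) = v := by
  funext s
  rcases s with i | q
  · rfl
  · simp only [shear_inr, z_shear, Pi.neg_apply, map_neg]; ring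

/-- The affine automorphism of the quadric that moves `0` to `p`. -/
def transl (p x : Amb n) : Amb n := p + shear (z p) x

/-- The base point of the inverse of `transl p`. -/
def translInv (p : Amb n) : Amb n := shear (-z p) (-p)

lemma z_translInv (p : Amb n) : z (translInv p) = -z p := by
  funext i
  rw [translInv, z_shear]
  rfl

lemma transl_translInv (p x : Amb n) : transl p (transl (translInv p) x) = x := by
  rw [transl, transl, z_translInv, translInv, ← map_add, shear_shear_neg]
  abel

lemma transl_translInv_self (p : Amb n) : transl (translInv p) p = 0 := by
  rw [transl, z_translInv, translInv, ← map_add, neg_add_cancel, map_zero]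

lemma transl_mem {p x : Amb n} (hp : p ∈ quadric n) (hx : x ∈ quadric n) :
    transl p x ∈ quadric n := fun q => by
  have h1 := hp q
  have h2 := hx q
  simp only [rho, z] at h1 h2
  simp only [rho, transl, shear_inr, z, Pi.add_apply, map_add, map_sub, map_mul, Complex.conj_conj]
  change p (Sum.inr q) + _ - _ - ((p (Sum.inl q.1.1) + x (Sum.inl q.1.1)) *
    (conj (p (Sum.inl q.1.2)) + conj (x (Sum.inl q.1.2))) -
    (conj (p (Sum.inl q.1.1)) + conj (x (Sum.inl q.1.1))) *
    (p (Sum.inl q.1.2) + x (Sum.inl q.1.2))) = 0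
  linear_combination h1 + h2

lemma translInv_mem {p : Amb n} (hp : p ∈ quadric n) : translInv p ∈ quadric n := fun q => by
  have h1 := hp q
  simp only [rho, z] at h1
  simp only [rho, z_translInv]
  simp only [translInv, shear_inr, z, Pi.neg_apply, map_add, map_sub, map_mul, map_neg,
    Complex.conj_conj]
  linear_combination -h1

/-- The pull-back of a vector field by `transl p`. -/
def pullback (p : Amb n) (X : Amb n → Amb n) : Amb n → Amb n :=
  fun x => shear (-z p) (X (transl p x))

/-- The derivative of `rho` at `transl p x` composed with `shear (z p)` is its derivative at `x`;
this linear identity holds at all points, on or off the quadric. -/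
lemma tangentAt_pullback {p x : Amb n} {X : Amb n → Amb n} (h : TangentAt X (transl p x)) :
    TangentAt (pullback p X) x := fun q => by
  have := h q
  rw [fderiv_rho] at this ⊢
  simp only [pullback, z_shear, shear_inr, map_add, map_sub, map_mul, Pi.neg_apply, map_neg,
    Complex.conj_conj]
  have e : ∀ i, z (transl p x) i = z p i + z x i := fun i => rfl
  simp only [e, map_add] at this
  linear_combination this

lemma analyticAt_transl (p x : Amb n) : AnalyticAt ℂ (transl p) x :=
  analyticAt_const.add ((shear (z p)).analyticAt x)

lemma analyticAt_pullback {p x : Amb n} {X : Amb n → Amb n} (h : AnalyticAt ℂ X (transl p x)) :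
    AnalyticAt ℂ (pullback p X) x :=
  ((shear (-z p)).analyticAt _).comp (h.comp (analyticAt_transl p x))

/-- Every element of `hol(M)` is a combination of the generators. -/
theorem exists_comb (hn : 2 ≤ n) {U : Set (Amb n)} (hUo : IsOpen U) (hU : IsPreconnected U)
    {p : Amb n} (hpU : p ∈ U) (hp : p ∈ quadric n) {X : Amb n → Amb n}
    (hX : AnalyticOnNhd ℂ X U) (hT : ∀ x ∈ quadric n, x ∈ U → TangentAt X x) :
    ∃ d : GenIdx n → ℝ, ∀ x ∈ U, X x = comb d x := by
  have h0 : transl p 0 = p := by simp [transl]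
  obtain ⟨R, hR, hRU⟩ : ∃ R > 0, ball (0 : Amb n) R ⊆ transl p ⁻¹' U := by
    refine Metric.mem_nhds_iff.1 ((analyticAt_transl p 0).continuousAt.preimage_mem_nhds ?_)
    rw [h0]
    exact hUo.mem_nhds hpU
  obtain ⟨d, hd⟩ := exists_comb_of_ball hn hR (X := pullback p X)
    (fun x hx => analyticAt_pullback (hX _ (hRU hx)))
    fun x hM hx => tangentAt_pullback (hT _ (transl_mem hp hM) (hRU hx))
  -- Instead of computing how translations act on the generators, the local theorem is applied again
  -- to the transported combination, which is entire and tangent. The identity theorem upgrades the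
  -- result to the whole space.
  obtain ⟨d', hd'⟩ := exists_comb_of_ball hn one_pos (X := pullback (translInv p) (comb d))
    (fun x _ => analyticAt_pullback (analyticOnNhd_comb d Set.univ _ trivial))
    fun x hM _ => tangentAt_pullback (tangentAt_comb d (transl_mem (translInv_mem hp) hM))
  have hglob : pullback (translInv p) (comb d) = comb d' :=
    AnalyticOnNhd.eq_of_eventuallyEq
      (fun x _ => analyticAt_pullback (analyticOnNhd_comb d Set.univ _ trivial))
      (analyticOnNhd_comb d' Set.univ) hd'
  refine ⟨d', hX.eqOn_of_preconnected_of_eventuallyEq (analyticOnNhd_comb d' U) hU hpU ?_⟩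
  have hcont : Filter.Tendsto (transl (translInv p)) (𝓝 p) (𝓝 0) := by
    have := (analyticAt_transl (translInv p) p).continuousAt.tendsto
    rwa [transl_translInv_self] at this
  filter_upwards [hcont.eventually hd] with x hx
  rw [← hglob, pullback, ← hx, pullback, transl_translInv, z_translInv, neg_neg, shear_shear_neg]

/-! ### Linear independence and the basis -/

lemma exists_coeffs (d : GenIdx n → ℝ) :
    ∃ t c A θ q s, d = coeffs t c A θ q s := by
  refine ⟨fun p => d (.inl p),
    fun i => d (.inr (.inl (.inl i))) + d (.inr (.inl (.inr i))) * Complex.I,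
    fun i j => d (.inr (.inr (.inl (.inl (j, i))))), d (.inr (.inr (.inl (.inr ())))),
    fun i => d (.inr (.inr (.inr (.inl (.inl i))))) - d (.inr (.inr (.inr (.inl (.inr i)))))
      * Complex.I, fun p => d (.inr (.inr (.inr (.inr p)))), ?_⟩
  funext g
  rcases g with p | (i | i) | (p | _) | (i | i) | p <;> simp [coeffs]

/-- The parameters are read off at a few points: `c` and `t` at the origin, `q`, `A` and `θ` at `z =
±e_k` with `w = 0`, and `s` at `z = e_k`, `w = e_m ∧ e_k`. Real and imaginary parts separate `A k k`
from `θ`. -/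
lemma eq_zero_of_comb (hn : 2 ≤ n) (d : GenIdx n → ℝ) (h : ∀ x, comb d x = 0) : d = 0 := by
  obtain ⟨t, c, A, θ, q, s, rfl⟩ := exists_coeffs d
  have hZ : ∀ x l, comb (coeffs t c A θ q s) x (Sum.inl l) = 0 := fun x l => by rw [h]; rfl
  have hW : ∀ x p, comb (coeffs t c A θ q s) x (Sum.inr p) = 0 := fun x p => by rw [h]; rfl
  simp only [comb_coeffs_inl] at hZ
  simp only [comb_coeffs_inr] at hW
  have hw0 : ∀ (u : Fin n → ℂ) i j, w (pt u 0) i j = 0 := fun u i j => by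
    rw [w_pt]; exact (skL i j).map_zero
  have hzp : ∀ (u : Fin n → ℂ) v i, z (pt u v) i = u i := fun _ _ _ => rfl
  have hc : c = 0 := funext fun l => by simpa [hw0, hzp] using hZ (pt 0 0) l
  subst hc
  have ht : t = 0 := funext fun p => by simpa [hw0, hzp] using hW (pt 0 0) p
  subst ht
  have hlin : ∀ (r : ℂ) k l, A l k * r + Complex.I * θ * (r * δ k l)
      + (conj (q k) * r) * (r * δ k l) = 0 := fun r k l => by
    have h1 : ∀ (f : Fin n → ℂ), ∑ k', f k' * (r * δ k k') = f k * r := fun f => by simp [δ]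
    have := hZ (pt (fun i => r * δ k i) 0) l
    simpa only [hw0, hzp, zero_mul, Finset.sum_const_zero, Pi.zero_apply, zero_add, add_zero, h1]
      using this
  have hk : ∀ k, q k = 0 ∧ (A k k : ℂ) + Complex.I * θ = 0 := fun k => by
    have h1 := hlin 1 k k
    have h2 := hlin (-1) k k
    rw [δ_self] at h1 h2
    have h3 : conj (q k) = 0 := by linear_combination (h1 + h2) / 2
    exact ⟨by simpa using h3, by linear_combination (h1 - h2) / 2⟩
  have hq : q = 0 := funext fun k => (hk k).1
  subst hq
  have hAθ : ∀ k, A k k = 0 ∧ θ = 0 := fun k => by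
    have := (hk k).2
    exact ⟨by simpa using congrArg Complex.re this, by simpa using congrArg Complex.im this⟩
  have hθ : θ = 0 := (hAθ ⟨0, by omega⟩).2
  subst hθ
  have hA : A = 0 := funext fun l => funext fun k => by
    rcases eq_or_ne l k with rfl | hlk
    · exact (hAθ l).1
    · simpa [δ_of_ne hlk.symm] using hlin 1 k l
  subst hA
  have hs : s = 0 := funext fun p => by
    obtain ⟨⟨m, k⟩, hmk⟩ := p
    have := hZ (pt (Pi.single k 1) (E m k)) k
    have hmk' : m < k := hmk
    simp only [w_pt, E, sk_wdg, hzp, single_eq_δ, δ_self, δ_of_ne hmk'.ne] at this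
    simpa [δ, sk_lt _ hmk] using this
  subst hs
  funext g
  rcases g with p | (i | i) | (p | _) | (i | i) | p <;> simp [coeffs]

/-- The generators, as elements of `hol(M)`. -/
def genHol (U : TopologicalSpace.Opens (Amb n)) (g : GenIdx n) : Hol U :=
  ⟨(U : Set (Amb n)).indicator (gen g),
    (analyticOnNhd_gen g U).congr U.isOpen fun x hx => (Set.indicator_of_mem hx _).symm,
    fun x hx => Set.indicator_of_notMem hx _,
    fun x hM hx p => by rw [Set.indicator_of_mem hx]; exact tangentAt_gen g hM p⟩

lemma genHol_apply {U : TopologicalSpace.Opens (Amb n)} (g : GenIdx n) {x : Amb n} (hx : x ∈ U) :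
    (genHol U g : Amb n → Amb n) x = gen g x := Set.indicator_of_mem hx _

lemma sum_genHol_apply {U : TopologicalSpace.Opens (Amb n)} (d : GenIdx n → ℝ) {x : Amb n}
    (hx : x ∈ U) : ((∑ g, d g • genHol U g : Hol U) : Amb n → Amb n) x = comb d x := by
  simp [comb, Finset.sum_apply, genHol_apply _ hx]

/-- The basis of `hol(M)`. -/
def holBasis (hn : 2 ≤ n) (U : TopologicalSpace.Opens (Amb n))
    (hU : IsConnected (U : Set (Amb n))) (hUM : ((U : Set (Amb n)) ∩ quadric n).Nonempty) :
    Module.Basis (GenIdx n) ℝ (Hol U) := by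
  refine Module.Basis.mk (v := genHol U) ?_ ?_
  · refine Fintype.linearIndependent_iff.2 fun d hd => ?_
    have hU0 : ∀ x ∈ U, comb d x = 0 := fun x hx => by
      rw [← sum_genHol_apply d hx, hd]; rfl
    obtain ⟨p, hp⟩ := hU.nonempty
    have h0 : comb d = 0 := AnalyticOnNhd.eq_of_eventuallyEq (z₀ := p)
      (analyticOnNhd_comb d Set.univ) analyticOnNhd_const (by
        filter_upwards [U.isOpen.mem_nhds hp] with x hx
        exact hU0 x hx)
    exact congrFun (eq_zero_of_comb hn d (congrFun h0))
  · rintro X -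
    obtain ⟨p, hpU, hp⟩ := hUM
    obtain ⟨d, hd⟩ := exists_comb hn U.isOpen hU.isPreconnected hpU hp X.2.1 X.2.2.2
    have : X = ∑ g, d g • genHol U g := hol_ext fun x hx => by
      rw [hd x hx, sum_genHol_apply d hx]
    rw [this]
    exact Submodule.sum_mem _ fun g _ => Submodule.smul_mem _ _ (Submodule.subset_span ⟨g, rfl⟩)

lemma holBasis_apply (hn : 2 ≤ n) {U : TopologicalSpace.Opens (Amb n)}
    (hU : IsConnected (U : Set (Amb n))) (hUM : ((U : Set (Amb n)) ∩ quadric n).Nonempty)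
    (g : GenIdx n) : holBasis hn U hU hUM g = genHol U g := Module.Basis.mk_apply _ _ g

lemma genHol_mem_grade {U : TopologicalSpace.Opens (Amb n)} (g : GenIdx n) :
    genHol U g ∈ grade U (deg g) := by
  obtain ⟨P, hP, h⟩ := isPolyField_gen g
  exact ⟨P, hP, fun x hx s => by rw [genHol_apply g hx, h]⟩

/-! ### The Euler field and the grading -/

/-- The Euler field of the weights. -/
def eulerHol (U : TopologicalSpace.Opens (Amb n)) : Hol U :=
  ∑ i, genHol U (.inr (.inr (.inl (.inl (i, i)))))

/-- The linear field `∑ [s] x_s ∂_s`. -/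
def eulerL : Amb n →L[ℂ] Amb n :=
  ContinuousLinearMap.pi fun s => (wt s : ℂ) • ContinuousLinearMap.proj s

lemma eulerL_apply (x : Amb n) (s : Idx n) : eulerL x s = wt s * x s := by simp [eulerL]

lemma eulerHol_apply {U : TopologicalSpace.Opens (Amb n)} {x : Amb n} (hx : x ∈ U) :
    (eulerHol U : Amb n → Amb n) x = eulerL x := by
  funext s
  rw [eulerL_apply]
  have : (eulerHol U : Amb n → Amb n) x s = ∑ i, L0 i i x s := by
    simp [eulerHol, Finset.sum_apply, genHol_apply _ hx, gen]
  rw [this]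
  rcases s with l | p
  · simp [L0, field, wt, δ, z]
  · simp [L0, field, wt, δ, Finset.sum_add_distrib, w_pair]; ring

/-- The dilations are parametrized by `exp t`, so that integer weights of either sign need no case
distinction and the derivative at `t = 0` is Euler's identity. -/
lemma eval_exp_weight {P : MvPolynomial (Idx n) ℂ} {k : ℤ} (hP : P.IsWeightedHomogeneous wt k)
    (x : Amb n) (t : ℂ) :
    MvPolynomial.eval (fun s => Complex.exp (t * wt s) * x s) P =
      Complex.exp (t * k) * MvPolynomial.eval x P := by
  rw [MvPolynomial.eval_eq, MvPolynomial.eval_eq, Finset.mul_sum]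
  refine Finset.sum_congr rfl fun d hd => ?_
  have hw := hP (MvPolynomial.mem_support_iff.1 hd)
  have : ∏ i ∈ d.support, Complex.exp (t * wt i) ^ d i = Complex.exp (t * k) := by
    simp only [← Complex.exp_nat_mul]
    rw [← Complex.exp_sum, ← hw, Finsupp.weight_apply, Finsupp.sum]
    push_cast
    rw [Finset.mul_sum]
    congr 1
    refine Finset.sum_congr rfl fun i _ => ?_
    simp
    ring
  simp only [mul_pow, Finset.prod_mul_distrib, this]
  ring

lemma fderiv_eval_euler {P : MvPolynomial (Idx n) ℂ} {k : ℤ} (hP : P.IsWeightedHomogeneous wt k)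
    (x : Amb n) : fderiv ℂ (fun y => MvPolynomial.eval y P) x (eulerL x) =
      k * MvPolynomial.eval x P := by
  have hd : HasFDerivAt (fun y => MvPolynomial.eval y P)
      (fderiv ℂ (fun y => MvPolynomial.eval y P) x)
      (fun s => Complex.exp ((0 : ℂ) * wt s) * x s) := by
    have : (fun s => Complex.exp ((0 : ℂ) * wt s) * x s) = x := by funext s; simp
    rw [this]
    exact (AnalyticOnNhd.eval_mvPolynomial P x (Set.mem_univ x)).differentiableAt.hasFDerivAt
  have hexp : ∀ a b : ℂ, HasDerivAt (fun t : ℂ => Complex.exp (t * a) * b) (a * b) 0 :=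
    fun a b => by
      have := (((hasDerivAt_id (0 : ℂ)).mul_const a).cexp).mul_const b
      simpa using this
  have hc : HasDerivAt (fun t : ℂ => fun s : Idx n => Complex.exp (t * wt s) * x s)
      (eulerL x) 0 := hasDerivAt_pi.2 fun s => by
    rw [eulerL_apply]; exact hexp _ _
  have h1 := hd.comp_hasDerivAt (0 : ℂ) hc
  have h2 := (hexp k (MvPolynomial.eval x P)).congr_of_eventuallyEq
    (f₁ := (fun y => MvPolynomial.eval y P) ∘
      fun t : ℂ => fun s : Idx n => Complex.exp (t * wt s) * x s)
    (Filter.Eventually.of_forall fun t => eval_exp_weight hP x t)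
  exact h1.unique h2

lemma euler_lie {U : TopologicalSpace.Opens (Amb n)} {k : ℤ} {X : Hol U} (hX : X ∈ grade U k) :
    ⁅eulerHol U, X⁆ = (k : ℝ) • X := by
  obtain ⟨P, hP, h⟩ := hX
  refine hol_ext fun x hx => ?_
  have hU : (U : Set (Amb n)) ∈ 𝓝 x := U.isOpen.mem_nhds hx
  have hE : fderiv ℂ (eulerHol U : Amb n → Amb n) x = eulerL := by
    rw [Filter.EventuallyEq.fderiv_eq (f := eulerL) (by
      filter_upwards [hU] with y hy using eulerHol_apply hy)]
    exact eulerL.fderiv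
  funext s
  have hXs : fderiv ℂ (X : Amb n → Amb n) x (eulerL x) s =
      (k + wt s) * MvPolynomial.eval x (P s) := by
    have h1 : fderiv ℂ (X : Amb n → Amb n) x (eulerL x) s =
        fderiv ℂ (fun y => (X : Amb n → Amb n) y s) x (eulerL x) := by
      rw [fderiv_apply (hol_diff X hx)]; rfl
    rw [h1, Filter.EventuallyEq.fderiv_eq (f := fun y => MvPolynomial.eval y (P s)) (by
      filter_upwards [hU] with y hy using h y hy s), fderiv_eval_euler (hP s)]
    push_cast; rfl
  rw [coe_bracket, VectorField.lieBracket, eulerHol_apply hx, hE, Pi.sub_apply, hXs, eulerL_apply,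
    h x hx s, Submodule.coe_smul, Pi.smul_apply, Pi.smul_apply, h x hx s]
  simp
  ring

section Grading

variable {L ι : Type*} [LieRing L] [LieAlgebra ℝ L] {V : ℤ → Submodule ℝ L} {e : L}
  {b : Module.Basis ι ℝ L} {d : ι → ℤ}

/-- In a basis of eigenvectors of `ad e`, an eigenvector for `k` has zero coefficient on every basis
vector with another eigenvalue. Membership in `V k` thus follows from the eigenvalue alone. -/
lemma mem_span_of_euler [Fintype ι] (he : ∀ k, ∀ X ∈ V k, ⁅e, X⁆ = (k : ℝ) • X) (hb : ∀ i, b i ∈ V (d i))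
    (k : ℤ) {X : L} (hX : ⁅e, X⁆ = (k : ℝ) • X) : X ∈ Submodule.span ℝ (b '' {i | d i = k}) := by
  have h1 : ⁅e, X⁆ = ∑ i, (b.repr X i * d i) • b i := by
    conv_lhs => rw [← b.sum_repr X, lie_sum]
    exact Finset.sum_congr rfl fun i _ => by rw [lie_smul, he _ _ (hb i), smul_smul]
  rw [← b.sum_repr X]
  refine Submodule.sum_mem _ fun i _ => ?_
  by_cases hi : d i = k
  · exact Submodule.smul_mem _ _ (Submodule.subset_span ⟨i, hi, rfl⟩)
  · have h2 : b.repr ⁅e, X⁆ i = b.repr X i * d i := by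
      rw [h1, b.repr_sum_self]
    rw [hX, map_smul, Finsupp.smul_apply, smul_eq_mul] at h2
    have h3 : (d i : ℝ) - k ≠ 0 := sub_ne_zero.2 (by exact_mod_cast hi)
    have h4 : b.repr X i = 0 := by
      have : b.repr X i * ((d i : ℝ) - k) = 0 := by linear_combination -h2
      exact (mul_eq_zero.1 this).resolve_right h3
    rw [h4, zero_smul]
    exact Submodule.zero_mem _

lemma grading_eq_span [Fintype ι] (he : ∀ k, ∀ X ∈ V k, ⁅e, X⁆ = (k : ℝ) • X) (hb : ∀ i, b i ∈ V (d i))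
    (k : ℤ) : V k = Submodule.span ℝ (b '' {i | d i = k}) :=
  le_antisymm (fun X hX => mem_span_of_euler he hb k (he k X hX))
    (Submodule.span_le.2 (by rintro _ ⟨i, rfl, rfl⟩; exact hb i))

lemma grading_lie_mem [Fintype ι] (he : ∀ k, ∀ X ∈ V k, ⁅e, X⁆ = (k : ℝ) • X) (hb : ∀ i, b i ∈ V (d i))
    {k l : ℤ} {X Y : L} (hX : X ∈ V k) (hY : Y ∈ V l) : ⁅X, Y⁆ ∈ V (k + l) := by
  rw [grading_eq_span he hb]
  refine mem_span_of_euler he hb _ ?_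
  rw [leibniz_lie, he k X hX, he l Y hY, smul_lie, lie_smul, ← add_smul]
  push_cast; rfl

lemma grading_isInternal (he : ∀ k, ∀ X ∈ V k, ⁅e, X⁆ = (k : ℝ) • X) (hb : ∀ i, b i ∈ V (d i)) :
    DirectSum.IsInternal V := by
  rw [DirectSum.isInternal_submodule_iff_iSupIndep_and_iSup_eq_top]
  constructor
  · have h1 := (Module.End.eigenspaces_iSupIndep (LieAlgebra.ad ℝ L e)).comp
      (f := fun k : ℤ => (k : ℝ)) Int.cast_injective
    exact h1.mono fun k X hX => Module.End.mem_eigenspace_iff.2 (he k X hX)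
  · rw [eq_top_iff, ← b.span_eq, Submodule.span_le]
    rintro _ ⟨i, rfl⟩
    exact Submodule.mem_iSup_of_mem _ (hb i)

end Grading

/-! ### Dimensions and spans of the graded pieces -/

lemma card_pairs : Fintype.card (Pairs n) = n * (n - 1) / 2 := by
  rw [Fintype.card_subtype, Finset.card_filter, Fintype.sum_prod_type, Finset.sum_comm]
  have : ∀ j : Fin n, ∑ i : Fin n, (if i < j then 1 else 0) = (j : ℕ) := fun j => by
    rw [← Finset.card_filter, ← Fin.card_Iio]
    congr 1
    ext i; simp
  simp only [this]
  rw [Fin.sum_univ_eq_sum_range (fun i => i), Finset.sum_range_id]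

section

variable {U : TopologicalSpace.Opens (Amb n)}

lemma grade_eq_span (hn : 2 ≤ n) (hU : IsConnected (U : Set (Amb n)))
    (hUM : ((U : Set (Amb n)) ∩ quadric n).Nonempty) (k : ℤ) :
    grade U k = Submodule.span ℝ (genHol U '' {g | deg g = k}) := by
  have := grading_eq_span (V := grade U) (b := holBasis hn U hU hUM) (d := deg) (e := eulerHol U)
    (fun k X hX => euler_lie hX)
    (fun g => by rw [holBasis_apply]; exact genHol_mem_grade g) k
  rw [this]
  congr 1
  exact Set.image_congr fun g _ => holBasis_apply hn hU hUM g

lemma finrank_grade (hn : 2 ≤ n) (hU : IsConnected (U : Set (Amb n)))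
    (hUM : ((U : Set (Amb n)) ∩ quadric n).Nonempty) {ι : Type*} [Fintype ι] {k : ℤ}
    {f : ι → GenIdx n} (hf : Function.Injective f) (hr : {g | deg g = k} = Set.range f) :
    Module.finrank ℝ (grade U k) = Fintype.card ι := by
  rw [grade_eq_span hn hU hUM, hr, ← Set.range_comp]
  have : genHol U ∘ f = holBasis hn U hU hUM ∘ f :=
    funext fun i => (holBasis_apply hn hU hUM _).symm
  rw [this]
  exact finrank_span_eq_card ((holBasis hn U hU hUM).linearIndependent.comp f hf)

lemma fields_grade (hn : 2 ≤ n) (hU : IsConnected (U : Set (Amb n)))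
    (hUM : ((U : Set (Amb n)) ∩ quadric n).Nonempty) (k : ℤ) {S : Set (Amb n → Amb n)}
    (hS : gen '' {g | deg g = k} = S) : fields (grade U k) = spanOn U S := by
  rw [fields, grade_eq_span hn hU hUM, Submodule.map_span, spanOn, ← hS, Set.image_image,
    Set.image_image]
  rfl

end

lemma deg_eq_neg_two : {g : GenIdx n | deg g = -2} = Set.range Sum.inl := by
  ext g
  rcases g with p | (i | i) | (p | _) | (i | i) | p <;> simp [deg]

lemma deg_eq_neg_one : {g : GenIdx n | deg g = -1} = Set.range (Sum.inr ∘ Sum.inl) := by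
  ext g
  rcases g with p | (i | i) | (p | _) | (i | i) | p <;> simp [deg]

lemma deg_eq_zero : {g : GenIdx n | deg g = 0} = Set.range (Sum.inr ∘ Sum.inr ∘ Sum.inl) := by
  ext g
  rcases g with p | (i | i) | (p | _) | (i | i) | p <;> simp [deg]

lemma deg_eq_one :
    {g : GenIdx n | deg g = 1} = Set.range (Sum.inr ∘ Sum.inr ∘ Sum.inr ∘ Sum.inl) := by
  ext g
  rcases g with p | (i | i) | (p | _) | (i | i) | p <;> simp [deg]

lemma deg_eq_two :
    {g : GenIdx n | deg g = 2} = Set.range (Sum.inr ∘ Sum.inr ∘ Sum.inr ∘ Sum.inr) := by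
  ext g
  rcases g with p | (i | i) | (p | _) | (i | i) | p <;> simp [deg]

lemma grade_eq_bot (hn : 2 ≤ n) {U : TopologicalSpace.Opens (Amb n)}
    (hU : IsConnected (U : Set (Amb n))) (hUM : ((U : Set (Amb n)) ∩ quadric n).Nonempty) {k : ℤ}
    (hk : 3 ≤ |k|) : grade U k = ⊥ := by
  rw [grade_eq_span hn hU hUM]
  have : {g : GenIdx n | deg g = k} = ∅ := by
    ext g
    simp only [Set.mem_ofPred_eq, Set.mem_empty_iff_false, iff_false]
    rintro rfl
    rcases g with p | (i | i) | (p | _) | (i | i) | p <;> simp [deg] at hk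
  rw [this, Set.image_empty, Submodule.span_empty]

/-! ### Matrix Riccati fields and their brackets -/

section Moebius

variable {o : Type*} [Fintype o]

/-- The quadratic vector field on matrices given by the infinitesimal action of `M` on graphs. -/
def mob (M : Matrix (o ⊕ o) (o ⊕ o) ℂ) (Y : Matrix o o ℂ) : Matrix o o ℂ :=
  M.toBlocks₁₂ + M.toBlocks₁₁ * Y - Y * M.toBlocks₂₂ - Y * M.toBlocks₂₁ * Y

/-- The derivative of `mob M`. -/
def mobDeriv (M : Matrix (o ⊕ o) (o ⊕ o) ℂ) (Y H : Matrix o o ℂ) : Matrix o o ℂ :=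
  M.toBlocks₁₁ * H - H * M.toBlocks₂₂ - H * M.toBlocks₂₁ * Y - Y * M.toBlocks₂₁ * H

lemma mob_add_smul (M : Matrix (o ⊕ o) (o ⊕ o) ℂ) (Y H : Matrix o o ℂ) (t : ℂ) :
    mob M (Y + t • H) = mob M Y + t • mobDeriv M Y H - (t * t) • (H * M.toBlocks₂₁ * H) := by
  simp only [mob, mobDeriv, Matrix.mul_add, Matrix.add_mul, Matrix.mul_smul, Matrix.smul_mul,
    smul_sub]
  module

/-- The fields generate the action of linear maps on graphs `{(Yξ, ξ)}`, and fundamental fields of a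
left action satisfy the bracket relation with a minus sign. -/
lemma mobDeriv_mob (M M' : Matrix (o ⊕ o) (o ⊕ o) ℂ) (Y : Matrix o o ℂ) :
    mobDeriv M' Y (mob M Y) - mobDeriv M Y (mob M' Y) = -mob (M * M' - M' * M) Y := by
  rw [← Matrix.fromBlocks_toBlocks M, ← Matrix.fromBlocks_toBlocks M']
  generalize M.toBlocks₁₁ = A, M.toBlocks₁₂ = B, M.toBlocks₂₁ = C, M.toBlocks₂₂ = D
  generalize M'.toBlocks₁₁ = A', M'.toBlocks₁₂ = B', M'.toBlocks₂₁ = C', M'.toBlocks₂₂ = D'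
  rw [Matrix.fromBlocks_multiply, Matrix.fromBlocks_multiply,
    sub_eq_add_neg (Matrix.fromBlocks _ _ _ _), Matrix.fromBlocks_neg, Matrix.fromBlocks_add]
  simp only [mob, mobDeriv, Matrix.toBlocks_fromBlocks₁₁, Matrix.toBlocks_fromBlocks₁₂,
    Matrix.toBlocks_fromBlocks₂₁, Matrix.toBlocks_fromBlocks₂₂]
  noncomm_ring

end Moebius

/-- A point of the ambient space as a skew-symmetric matrix of size `n + 1`. -/
def skewMat (x : Amb n) : Matrix (Fin n ⊕ Unit) (Fin n ⊕ Unit) ℂ :=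
  Matrix.fromBlocks (.of fun i j => w x i j) (.of fun i _ => z x i) (.of fun _ j => -z x j) 0

lemma skewMat_add_smul (x v : Amb n) (t : ℂ) :
    skewMat (x + t • v) = skewMat x + t • skewMat v := by
  ext (i | i) (j | j) <;> simp [skewMat, w_add, w_smul, z]; ring

lemma skewMat_neg (x : Amb n) : skewMat (-x) = -skewMat x := by
  have h0 : skewMat (0 : Amb n) = 0 := by
    have := skewMat_add_smul (0 : Amb n) 0 1
    simpa using this
  have := skewMat_add_smul (0 : Amb n) x (-1)
  simpa [h0] using this

lemma skewMat_injective : Function.Injective (skewMat (n := n)) := fun x y h => by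
  funext s
  rcases s with i | p
  · exact congrFun (congrFun h (.inl i)) (.inr ())
  · rw [← w_pair x, ← w_pair y]
    exact congrFun (congrFun h (.inl p.1.1)) (.inl p.1.2)

/-- The entries of `skewMat`, as linear forms. -/
def skewMatL (i j : Fin n ⊕ Unit) : Amb n →L[ℂ] ℂ :=
  LinearMap.toContinuousLinearMap
    { toFun := fun x => skewMat x i j
      map_add' := fun x y => by
        have := skewMat_add_smul x y 1
        simp only [one_smul] at this
        rw [this]; rfl
      map_smul' := fun c x => by
        have h0 := skewMat_add_smul (0 : Amb n) 0 1
        have h := skewMat_add_smul (0 : Amb n) x c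
        simp only [one_smul, zero_add, left_eq_add] at h0 h
        rw [h0, zero_add] at h
        rw [h]; rfl }

/-- Differentiation is done along the line `x + t • v`, where `mob` is an explicit quadratic
polynomial in `t`, entry by entry. -/
lemma skewMat_fderiv {X : Amb n → Amb n} {M : Matrix _ _ ℂ}
    (hX : ∀ x, skewMat (X x) = mob M (skewMat x)) {x : Amb n} (hd : DifferentiableAt ℂ X x)
    (v : Amb n) : skewMat (fderiv ℂ X x v) = mobDeriv M (skewMat x) (skewMat v) := by
  ext i j
  have h1 : HasDerivAt (fun t : ℂ => skewMatL i j (X (x + t • v)))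
      (skewMatL i j (fderiv ℂ X x v)) 0 := by
    have hl : HasDerivAt (fun t : ℂ => x + t • v) v 0 := by
      simpa using ((hasDerivAt_id (0 : ℂ)).smul_const v).const_add x
    have hd' : HasFDerivAt X (fderiv ℂ X x) (x + (0 : ℂ) • v) := by
      simpa using hd.hasFDerivAt
    exact (skewMatL i j).hasFDerivAt.comp_hasDerivAt (0 : ℂ) (hd'.comp_hasDerivAt (0 : ℂ) hl)
  have h2 : HasDerivAt (fun t : ℂ => skewMatL i j (X (x + t • v)))
      (mobDeriv M (skewMat x) (skewMat v) i j) 0 := by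
    have e : (fun t : ℂ => skewMatL i j (X (x + t • v))) = fun t =>
        mob M (skewMat x) i j + t * mobDeriv M (skewMat x) (skewMat v) i j
          - t * t * (skewMat v * M.toBlocks₂₁ * skewMat v) i j := by
      funext t
      change skewMat (X (x + t • v)) i j = _
      rw [hX, skewMat_add_smul, mob_add_smul]
      rfl
    rw [e]
    have h3 := (((hasDerivAt_id (0 : ℂ)).mul_const
      (mobDeriv M (skewMat x) (skewMat v) i j)).const_add (mob M (skewMat x) i j)).sub
      ((((hasDerivAt_id (0 : ℂ)).mul (hasDerivAt_id (0 : ℂ)))).mul_const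
        ((skewMat v * M.toBlocks₂₁ * skewMat v) i j))
    exact h3.congr_deriv (by simp)
  exact h1.unique h2

lemma skewMat_lieBracket {X X' : Amb n → Amb n} {M M' : Matrix _ _ ℂ}
    (hX : ∀ x, skewMat (X x) = mob M (skewMat x))
    (hX' : ∀ x, skewMat (X' x) = mob M' (skewMat x)) {x : Amb n} (hd : DifferentiableAt ℂ X x)
    (hd' : DifferentiableAt ℂ X' x) :
    skewMat (VectorField.lieBracket ℂ X X' x) = -mob (M * M' - M' * M) (skewMat x) := by
  rw [VectorField.lieBracket, sub_eq_add_neg, ← one_smul ℂ (-_ : Amb n), skewMat_add_smul, one_smul,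
    skewMat_neg, skewMat_fderiv hX' hd', skewMat_fderiv hX hd, hX, hX', ← sub_eq_add_neg,
    mobDeriv_mob]

/-! ### Combinations of generators as Riccati fields -/

/-- The matrix in `so(2n + 2, ℂ)` of a combination of the generators. -/
def coeffMat (t : Pairs n → ℝ) (c : Fin n → ℂ) (A : Fin n → Fin n → ℝ) (θ : ℝ) (q : Fin n → ℂ)
    (s : Pairs n → ℝ) :
    Matrix ((Fin n ⊕ Unit) ⊕ (Fin n ⊕ Unit)) ((Fin n ⊕ Unit) ⊕ (Fin n ⊕ Unit)) ℂ :=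
  Matrix.fromBlocks
    (.fromBlocks (.of fun k l => (A k l : ℂ)) (.of fun k _ => conj (c k)) (.of fun _ k => -q k)
      (.of fun _ _ => Complex.I * θ))
    (.fromBlocks (.of fun k l => sk (fun p => (t p : ℂ)) k l) (.of fun k _ => c k)
      (.of fun _ k => -c k) 0)
    (.fromBlocks (.of fun k l => sk (fun p => (s p : ℂ)) k l) (.of fun k _ => conj (q k))
      (.of fun _ k => -conj (q k)) 0)
    (.fromBlocks (.of fun k l => -(A l k : ℂ)) (.of fun k _ => q k) (.of fun _ k => -conj (c k))
      (.of fun _ _ => -(Complex.I * θ)))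

lemma w_comb_coeffs (t : Pairs n → ℝ) (c : Fin n → ℂ) (A : Fin n → Fin n → ℝ) (θ : ℝ)
    (q : Fin n → ℂ) (s : Pairs n → ℝ) (x : Amb n) (k l : Fin n) :
    w (comb (coeffs t c A θ q s) x) k l =
      sk (fun p => (t p : ℂ)) k l + (z x k * conj (c l) - z x l * conj (c k))
        + ∑ m, (A k m * w x m l + A l m * w x k m)
        + (z x k * ∑ m, w x m l * conj (q m) - z x l * ∑ m, w x m k * conj (q m))
        + ∑ m, ∑ r, sk (fun p => (s p : ℂ)) m r * (w x m k * w x r l) := by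
  rw [w_eq_sk]
  refine sk_ext (f := fun k l => sk (fun p => (t p : ℂ)) k l
      + (z x k * conj (c l) - z x l * conj (c k)) + ∑ m, (A k m * w x m l + A l m * w x k m)
      + (z x k * ∑ m, w x m l * conj (q m) - z x l * ∑ m, w x m k * conj (q m))
      + ∑ m, ∑ r, sk (fun p => (s p : ℂ)) m r * (w x m k * w x r l))
    (fun i j => ?_) (fun p => ?_) k l
  · have h1 : ∑ m, ∑ r, sk (fun p => (s p : ℂ)) m r * (w x m j * w x r i) =
        -∑ m, ∑ r, sk (fun p => (s p : ℂ)) m r * (w x m i * w x r j) := by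
      rw [Finset.sum_comm, ← Finset.sum_neg_distrib]
      refine Finset.sum_congr rfl fun m _ => ?_
      rw [← Finset.sum_neg_distrib]
      exact Finset.sum_congr rfl fun r _ => by rw [sk_swap _ m r]; ring
    have h2 : ∑ m, (A j m * w x m i + A i m * w x j m) =
        -∑ m, (A i m * w x m j + A j m * w x i m) := by
      rw [← Finset.sum_neg_distrib]
      exact Finset.sum_congr rfl fun r _ => by rw [w_swap x i r, w_swap x r j]; ring
    rw [h1, h2, sk_swap]
    ring
  · rw [comb_coeffs_inr, sk_pair]

/-- The `w`- and `z`-blocks match the coordinate formulas after reordering sums with skewness. The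
corner entry vanishes since it is a skew form evaluated on `(z, z)` together with two cancelling
terms. -/
lemma skewMat_comb (t : Pairs n → ℝ) (c : Fin n → ℂ) (A : Fin n → Fin n → ℝ) (θ : ℝ)
    (q : Fin n → ℂ) (s : Pairs n → ℝ) (x : Amb n) :
    skewMat (comb (coeffs t c A θ q s) x) = mob (coeffMat t c A θ q s) (skewMat x) := by
  have hz := fun l => comb_coeffs_inl t c A θ q s x l
  have hw := fun k l => w_comb_coeffs t c A θ q s x k l
  ext (i | i) (j | j)
  · change w _ i j = _
    rw [hw]
    simp [mob, coeffMat, skewMat, Matrix.mul_apply]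
    have h1 : ∑ m, (A i m * w x m j + A j m * w x i m) =
        ∑ m, A i m * w x m j - ∑ m, A j m * w x m i := by
      rw [← Finset.sum_sub_distrib]
      exact Finset.sum_congr rfl fun m _ => by rw [w_swap x m i]; ring
    have h2 : ∑ m, w x i m * A j m = -∑ m, A j m * w x m i := by
      rw [← Finset.sum_neg_distrib]
      exact Finset.sum_congr rfl fun m _ => by rw [w_swap x m i]; ring
    have h3 : ∑ r, (∑ m, w x i m * sk (fun p => (s p : ℂ)) m r + -(z x i * conj (q r))) * w x r j =
        -∑ m, ∑ r, sk (fun p => (s p : ℂ)) m r * (w x m i * w x r j)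
          - z x i * ∑ m, w x m j * conj (q m) := by
      rw [Finset.sum_comm, Finset.mul_sum, ← Finset.sum_neg_distrib, ← Finset.sum_sub_distrib]
      refine Finset.sum_congr rfl fun r _ => ?_
      rw [add_mul, Finset.sum_mul, ← Finset.sum_neg_distrib, sub_eq_add_neg]
      congr 1
      · exact Finset.sum_congr rfl fun m _ => by rw [w_swap x m i]; ring
      · ring
    have h4 : ∑ m, w x i m * conj (q m) = -∑ m, w x m i * conj (q m) := by
      rw [← Finset.sum_neg_distrib]
      exact Finset.sum_congr rfl fun m _ => by rw [w_swap x m i]; ring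
    rw [h1, h2, h3, h4]
    ring
  · change comb _ x (Sum.inl i) = _
    rw [hz]
    simp [mob, coeffMat, skewMat, Matrix.mul_apply]
    have h1 : ∑ m, w x i m * q m = -∑ m, w x m i * q m := by
      rw [← Finset.sum_neg_distrib]
      exact Finset.sum_congr rfl fun m _ => by rw [w_swap x m i]; ring
    have h2 : ∑ r, (∑ m, w x i m * sk (fun p => (s p : ℂ)) m r + -(z x i * conj (q r))) * z x r =
        -∑ r, (∑ m, w x m i * sk (fun p => (s p : ℂ)) m r) * z x r
          - (∑ m, conj (q m) * z x m) * z x i := by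
      rw [Finset.sum_mul, ← Finset.sum_neg_distrib, ← Finset.sum_sub_distrib]
      refine Finset.sum_congr rfl fun r _ => ?_
      have : ∑ m, w x i m * sk (fun p => (s p : ℂ)) m r =
          -∑ m, w x m i * sk (fun p => (s p : ℂ)) m r := by
        rw [← Finset.sum_neg_distrib]
        exact Finset.sum_congr rfl fun m _ => by rw [w_swap x m i]; ring
      rw [this]
      ring
    rw [h1, h2]
    ring
  · change -comb _ x (Sum.inl j) = _
    rw [hz]
    simp [mob, coeffMat, skewMat, Matrix.mul_apply]
    have h1 : ∑ r, (∑ m, z x m * sk (fun p => (s p : ℂ)) m r) * w x r j =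
        -∑ r, (∑ m, w x m j * sk (fun p => (s p : ℂ)) m r) * z x r := by
      simp only [Finset.sum_mul]
      rw [Finset.sum_comm, ← Finset.sum_neg_distrib]
      refine Finset.sum_congr rfl fun r _ => ?_
      rw [← Finset.sum_neg_distrib]
      exact Finset.sum_congr rfl fun m _ => by rw [sk_swap _ r m]; ring
    rw [h1, Finset.sum_congr rfl fun m _ => mul_comm (q m) (w x m j),
      Finset.sum_congr rfl fun m _ => mul_comm (z x m) (A j m : ℂ),
      Finset.sum_congr rfl fun m _ => mul_comm (z x m) (conj (q m))]
    ring
  · simp [mob, coeffMat, skewMat, Matrix.mul_apply]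
    have h1 : ∑ r, (∑ m, z x m * sk (fun p => (s p : ℂ)) m r) * z x r =
        -∑ r, (∑ m, z x m * sk (fun p => (s p : ℂ)) m r) * z x r := by
      simp only [Finset.sum_mul]
      conv_lhs => rw [Finset.sum_comm]
      rw [← Finset.sum_neg_distrib]
      refine Finset.sum_congr rfl fun r _ => ?_
      rw [← Finset.sum_neg_distrib]
      exact Finset.sum_congr rfl fun m _ => by rw [sk_swap _ m r]; ring
    rw [Finset.sum_congr rfl fun m _ => mul_comm (q m) (z x m)]
    linear_combination -h1 / 2

/-! ### The real form `so(n + 2, n)` -/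

/-- Splitting of the last two of the `n + 2` positive indices. -/
def soEquiv (n : ℕ) : (Fin n ⊕ Fin 2) ⊕ Fin n ≃ Fin (n + 2) ⊕ Fin n :=
  Equiv.sumCongr finSumFinEquiv (Equiv.refl _)

/-- The isotropic basis. -/
def isoBasis (n : ℕ) : Matrix ((Fin n ⊕ Fin 2) ⊕ Fin n) ((Fin n ⊕ Unit) ⊕ (Fin n ⊕ Unit)) ℂ :=
  .fromBlocks (.fromBlocks 1 0 0 (.of fun a _ => ![1, Complex.I] a))
    (.fromBlocks 1 0 0 (.of fun a _ => ![1, -Complex.I] a))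
    (.fromCols 1 0) (.fromCols (-1) 0)

/-- The inverse of `isoBasis`. -/
def isoBasisInv (n : ℕ) : Matrix ((Fin n ⊕ Unit) ⊕ (Fin n ⊕ Unit)) ((Fin n ⊕ Fin 2) ⊕ Fin n) ℂ :=
  (1 / 2 : ℂ) • .fromBlocks (.fromBlocks 1 0 0 (.of fun _ a => ![1, -Complex.I] a)) (.fromRows 1 0)
    (.fromBlocks 1 0 0 (.of fun _ a => ![1, Complex.I] a)) (.fromRows (-1) 0)

/-- The columns of `isoBasis` are the null vectors `e_k ± f_k` and `e_{n+1} ± i e_{n+2}`. Only this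
order of the product is needed, for the multiplicativity of `soMat`. -/
lemma isoBasis_mul_inv : isoBasis n * isoBasisInv n = 1 := by
  ext ((i | a) | i) ((j | b) | j)
  all_goals simp [isoBasis, isoBasisInv, Matrix.mul_apply, Matrix.one_apply]
  all_goals try split_ifs
  all_goals try norm_num
  all_goals fin_cases a <;> fin_cases b <;> simp_all
  all_goals ring_nf
  all_goals norm_num

/-- An element of `so(n + 2, n)` in the isotropic basis. -/
def soMat (X : Matrix (Fin (n + 2) ⊕ Fin n) (Fin (n + 2) ⊕ Fin n) ℝ) :
    Matrix ((Fin n ⊕ Unit) ⊕ (Fin n ⊕ Unit)) ((Fin n ⊕ Unit) ⊕ (Fin n ⊕ Unit)) ℂ :=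
  isoBasisInv n * (X.submatrix (soEquiv n) (soEquiv n)).map Complex.ofRealHom * isoBasis n

lemma soMat_mul (X X' : Matrix (Fin (n + 2) ⊕ Fin n) (Fin (n + 2) ⊕ Fin n) ℝ) :
    soMat (X * X') = soMat X * soMat X' := by
  have h : ∀ a b c : Matrix ((Fin n ⊕ Fin 2) ⊕ Fin n) ((Fin n ⊕ Fin 2) ⊕ Fin n) ℂ, a = b * c →
      isoBasisInv n * a * isoBasis n =
      (isoBasisInv n * b * isoBasis n) * (isoBasisInv n * c * isoBasis n) := fun a b c habc => by
    have : (isoBasisInv n * b * isoBasis n) * (isoBasisInv n * c * isoBasis n) =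
        isoBasisInv n * b * (isoBasis n * isoBasisInv n) * c * isoBasis n := by
      simp only [Matrix.mul_assoc]
    rw [this, isoBasis_mul_inv, habc, Matrix.mul_one, Matrix.mul_assoc (isoBasisInv n) b c]
  refine h _ _ _ ?_
  rw [← Matrix.map_mul, Matrix.submatrix_mul_equiv]

lemma soMat_sub (X X' : Matrix (Fin (n + 2) ⊕ Fin n) (Fin (n + 2) ⊕ Fin n) ℝ) :
    soMat (X - X') = soMat X - soMat X' := by
  rw [soMat, soMat, soMat, ← Matrix.sub_mul, ← Matrix.mul_sub,
    ← Matrix.map_sub _ (map_sub Complex.ofRealHom)]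
  rfl

/-- The entries of a real matrix with respect to the splitting of its indices. -/
def ent (X : Matrix (Fin (n + 2) ⊕ Fin n) (Fin (n + 2) ⊕ Fin n) ℝ) (a b : (Fin n ⊕ Fin 2) ⊕ Fin n) :
    ℝ := X (soEquiv n a) (soEquiv n b)

lemma mem_so'_iff (X : Matrix (Fin (n + 2) ⊕ Fin n) (Fin (n + 2) ⊕ Fin n) ℝ) :
    X ∈ LieAlgebra.Orthogonal.so' (Fin (n + 2)) (Fin n) ℝ ↔
      (∀ a b, ent X (.inl a) (.inl b) = -ent X (.inl b) (.inl a)) ∧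
      (∀ a j, ent X (.inl a) (.inr j) = ent X (.inr j) (.inl a)) ∧
      ∀ i j, ent X (.inr i) (.inr j) = -ent X (.inr j) (.inr i) := by
  have h0 : X ∈ LieAlgebra.Orthogonal.so' (Fin (n + 2)) (Fin n) ℝ ↔
      X.transpose * LieAlgebra.Orthogonal.indefiniteDiagonal (Fin (n + 2)) (Fin n) ℝ =
        LieAlgebra.Orthogonal.indefiniteDiagonal (Fin (n + 2)) (Fin n) ℝ * -X := by
    rw [LieAlgebra.Orthogonal.so', mem_skewAdjointMatricesLieSubalgebra,
      mem_skewAdjointMatricesSubmodule]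
    rfl
  have h1 : X ∈ LieAlgebra.Orthogonal.so' (Fin (n + 2)) (Fin n) ℝ ↔
      ∀ i j, X j i * Sum.elim (fun _ => 1) (fun _ => -1) j =
        Sum.elim (fun _ => 1) (fun _ => -1) i * -X i j := by
    rw [h0, ← Matrix.ext_iff]
    simp only [LieAlgebra.Orthogonal.indefiniteDiagonal, Matrix.mul_diagonal, Matrix.diagonal_mul,
      Matrix.transpose_apply, Matrix.neg_apply]
  have h2 : X ∈ LieAlgebra.Orthogonal.so' (Fin (n + 2)) (Fin n) ℝ ↔
      ∀ i j, ent X j i * Sum.elim (fun _ => 1) (fun _ => -1) j =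
        Sum.elim (fun _ => 1) (fun _ => -1) i * -ent X i j := by
    rw [h1, ← (soEquiv n).forall_congr_right]
    refine forall_congr' fun i => ?_
    rw [← (soEquiv n).forall_congr_right]
    refine forall_congr' fun j => ?_
    rcases i with i | i <;> rcases j with j | j <;> rfl
  rw [h2]
  constructor
  · intro h
    refine ⟨fun a b => ?_, fun a j => ?_, fun i j => ?_⟩
    · have := h (.inl b) (.inl a)
      simp only [Sum.elim_inl] at this
      linarith
    · have := h (.inl a) (.inr j)
      simp only [Sum.elim_inl, Sum.elim_inr] at this
      linarith
    · have := h (.inr j) (.inr i)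
      simp only [Sum.elim_inr] at this
      linarith
  · rintro ⟨h1, h2, h3⟩ (i | i) (j | j) <;> simp only [Sum.elim_inl, Sum.elim_inr]
    · linarith [h1 i j]
    · linarith [h2 i j]
    · linarith [h2 j i]
    · linarith [h3 i j]

section

variable (X : Matrix (Fin (n + 2) ⊕ Fin n) (Fin (n + 2) ⊕ Fin n) ℝ)

/-- The `∂_w` part of the field of an element of `so(n + 2, n)`. -/
def soT (k l : Fin n) : ℝ :=
  (ent X (.inl (.inl k)) (.inl (.inl l)) - ent X (.inl (.inl k)) (.inr l) +
    ent X (.inr k) (.inl (.inl l)) - ent X (.inr k) (.inr l)) / 2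

/-- The translation part of the field of an element of `so(n + 2, n)`. -/
def soC (k : Fin n) : ℂ :=
  ⟨(ent X (.inl (.inl k)) (.inl (.inr 0)) + ent X (.inr k) (.inl (.inr 0))) / 2,
    -(ent X (.inl (.inl k)) (.inl (.inr 1)) + ent X (.inr k) (.inl (.inr 1))) / 2⟩

/-- The linear part of the field of an element of `so(n + 2, n)`. -/
def soA (k l : Fin n) : ℝ :=
  (ent X (.inl (.inl k)) (.inl (.inl l)) + ent X (.inl (.inl k)) (.inr l) +
    ent X (.inr k) (.inl (.inl l)) + ent X (.inr k) (.inr l)) / 2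

/-- The part of weight `1` of the field of an element of `so(n + 2, n)`. -/
def soQ (k : Fin n) : ℂ :=
  ⟨(ent X (.inl (.inl k)) (.inl (.inr 0)) - ent X (.inr k) (.inl (.inr 0))) / 2,
    -(ent X (.inl (.inl k)) (.inl (.inr 1)) - ent X (.inr k) (.inl (.inr 1))) / 2⟩

/-- The part of weight `2` of the field of an element of `so(n + 2, n)`. -/
def soS (k l : Fin n) : ℝ :=
  (ent X (.inl (.inl k)) (.inl (.inl l)) + ent X (.inl (.inl k)) (.inr l) -
    ent X (.inr k) (.inl (.inl l)) - ent X (.inr k) (.inr l)) / 2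

end

/-- The coefficients of the vector field of an element of `so(n + 2, n)`. -/
def soCoeffs : Matrix (Fin (n + 2) ⊕ Fin n) (Fin (n + 2) ⊕ Fin n) ℝ →ₗ[ℝ] GenIdx n → ℝ where
  toFun X := coeffs (fun p => soT X p.1.1 p.1.2) (soC X) (soA X)
    (ent X (.inl (.inr 0)) (.inl (.inr 1))) (soQ X) fun p => soS X p.1.1 p.1.2
  map_add' X Y := by
    funext g
    rcases g with p | (i | i) | (p | _) | (i | i) | p <;>
      simp [coeffs, ent, soT, soC, soA, soQ, soS] <;> ring
  map_smul' c X := by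
    funext g
    rcases g with p | (i | i) | (p | _) | (i | i) | p <;>
      simp [coeffs, ent, soT, soC, soA, soQ, soS] <;> ring

lemma soCoeffs_apply (X : Matrix (Fin (n + 2) ⊕ Fin n) (Fin (n + 2) ⊕ Fin n) ℝ) :
    soCoeffs X = coeffs (fun p => soT X p.1.1 p.1.2) (soC X) (soA X)
      (ent X (.inl (.inr 0)) (.inl (.inr 1))) (soQ X) fun p => soS X p.1.1 p.1.2 := rfl

/-- By the symmetries of `so'`, for `k < l` there remain four free entries, and `soT`, `soS` and the
two entries of `soA` are four independent combinations of them. Likewise `soC` and `soQ` determine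
the entries involving the two extra indices. -/
lemma soCoeffs_injOn {X : Matrix (Fin (n + 2) ⊕ Fin n) (Fin (n + 2) ⊕ Fin n) ℝ}
    (hX : X ∈ LieAlgebra.Orthogonal.so' (Fin (n + 2)) (Fin n) ℝ) (h : soCoeffs X = 0) : X = 0 := by
  obtain ⟨h1, h2, h3⟩ := (mem_so'_iff X).1 hX
  suffices ∀ a b, ent X a b = 0 by
    ext a b
    have := this ((soEquiv n).symm a) ((soEquiv n).symm b)
    simpa [ent] using this
  have ht := fun p => congrFun h (.inl p)
  have hc1 := fun i => congrFun h (.inr (.inl (.inl i)))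
  have hc2 := fun i => congrFun h (.inr (.inl (.inr i)))
  have hA := fun p => congrFun h (.inr (.inr (.inl (.inl p))))
  have hθ := congrFun h (.inr (.inr (.inl (.inr ()))))
  have hq1 := fun i => congrFun h (.inr (.inr (.inr (.inl (.inl i)))))
  have hq2 := fun i => congrFun h (.inr (.inr (.inr (.inl (.inr i)))))
  have hs := fun p => congrFun h (.inr (.inr (.inr (.inr p))))
  simp only [soCoeffs_apply, soT, soC, soA, soQ, soS, coeffs, Sum.elim_inl, Sum.elim_inr,
    Pi.zero_apply] at ht hc1 hc2 hA hθ hq1 hq2 hs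
  have hpp : ∀ k l, ent X (.inl (.inl k)) (.inl (.inl l)) = 0 ∧ ent X (.inl (.inl k)) (.inr l) = 0 ∧
      ent X (.inl (.inl l)) (.inr k) = 0 ∧ ent X (.inr k) (.inr l) = 0 := by
    have hlt : ∀ k l, k < l → ent X (.inl (.inl k)) (.inl (.inl l)) = 0 ∧
        ent X (.inl (.inl k)) (.inr l) = 0 ∧
        ent X (.inl (.inl l)) (.inr k) = 0 ∧ ent X (.inr k) (.inr l) = 0 := fun k l hkl => by
      have a1 := ht ⟨(k, l), hkl⟩
      have a2 := hs ⟨(k, l), hkl⟩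
      have a3 := hA (k, l)
      have a4 := hA (l, k)
      simp only [h1 (.inl l) (.inl k), h3 l k, ← h2] at a1 a2 a3 a4
      exact ⟨by linarith, by linarith, by linarith, by linarith⟩
    intro k l
    rcases lt_trichotomy k l with hkl | rfl | hkl
    · exact hlt k l hkl
    · have a1 := h1 (.inl k) (.inl k)
      have a2 := h3 k k
      have a3 := hA (k, k)
      simp only [← h2] at a3
      exact ⟨by linarith, by linarith, by linarith, by linarith⟩
    · obtain ⟨a1, a2, a3, a4⟩ := hlt l k hkl
      exact ⟨by rw [h1, a1, neg_zero], a3, a2, by rw [h3, a4, neg_zero]⟩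
  have hpa : ∀ k a, ent X (.inl (.inl k)) (.inl (.inr a)) = 0 ∧
      ent X (.inr k) (.inl (.inr a)) = 0 := fun k => by
    have b1 := hc1 k
    have b2 := hc2 k
    have b3 := hq1 k
    have b4 := hq2 k
    exact Fin.forall_fin_two.2
      ⟨⟨by linarith, by linarith⟩, ⟨by linarith, by linarith⟩⟩
  have haa : ∀ a b, ent X (.inl (.inr a)) (.inl (.inr b)) = 0 := by
    have c1 := h1 (.inr 0) (.inr 0)
    have c2 := h1 (.inr 1) (.inr 1)
    have c3 := h1 (.inr 1) (.inr 0)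
    exact Fin.forall_fin_two.2 ⟨Fin.forall_fin_two.2 ⟨self_eq_neg.1 c1, hθ⟩,
      Fin.forall_fin_two.2 ⟨c3.trans (by rw [hθ, neg_zero]), self_eq_neg.1 c2⟩⟩
  rintro ((k | a) | k) ((l | b) | l)
  · exact (hpp k l).1
  · exact (hpa k b).1
  · exact (hpp k l).2.1
  · rw [h1, (hpa l a).1, neg_zero]
  · exact haa a b
  · rw [h2]; exact (hpa l a).2
  · rw [← h2]; exact (hpp k l).2.2.1
  · exact (hpa k b).2
  · exact (hpp k l).2.2.2

/-- The isotropic basis brings the form to the block-swapping one, so an element of `so'` gets skew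
off-diagonal blocks and diagonal blocks `A`, `-Aᵀ`. Reality of `X` produces the conjugates in
`coeffMat`: conjugation fixes `e_k ± f_k` and exchanges `e_{n+1} ± i e_{n+2}`. -/
lemma soMat_eq {X : Matrix (Fin (n + 2) ⊕ Fin n) (Fin (n + 2) ⊕ Fin n) ℝ}
    (hX : X ∈ LieAlgebra.Orthogonal.so' (Fin (n + 2)) (Fin n) ℝ) :
    soMat X = coeffMat (fun p => soT X p.1.1 p.1.2) (soC X) (soA X)
      (ent X (.inl (.inr 0)) (.inl (.inr 1))) (soQ X) fun p => soS X p.1.1 p.1.2 := by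
  obtain ⟨h1, h2, h3⟩ := (mem_so'_iff X).1 hX
  have hent : ∀ a b, X (soEquiv n a) (soEquiv n b) = ent X a b := fun _ _ => rfl
  have hconj : conj (2 : ℂ) = 2 := map_ofNat _ 2
  have r1 : ∀ a j, ent X (.inl (.inr a)) (.inl (.inl j)) = -ent X (.inl (.inl j)) (.inl (.inr a)) :=
    fun a j => h1 _ _
  have r2 : ∀ a j, ent X (.inl (.inr a)) (.inr j) = ent X (.inr j) (.inl (.inr a)) :=
    fun a j => h2 _ _
  have r3 : ∀ a, ent X (.inl (.inr a)) (.inl (.inr a)) = 0 := fun a => self_eq_neg.1 (h1 _ _)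
  have r4 : ent X (.inl (.inr 1)) (.inl (.inr 0)) = -ent X (.inl (.inr 0)) (.inl (.inr 1)) := h1 _ _
  have ht : ∀ k l, sk (fun p : Pairs n => (soT X p.1.1 p.1.2 : ℂ)) k l = soT X k l := by
    refine sk_ext (fun i j => ?_) fun p => rfl
    rw [soT, soT, h1 (.inl j), h3 j, h2 (.inl j), ← h2 (.inl i) j]
    push_cast
    ring
  have hs : ∀ k l, sk (fun p : Pairs n => (soS X p.1.1 p.1.2 : ℂ)) k l = soS X k l := by
    refine sk_ext (fun i j => ?_) fun p => rfl
    rw [soS, soS, h1 (.inl j), h3 j, h2 (.inl j), ← h2 (.inl i) j]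
    push_cast
    ring
  rw [soMat, coeffMat]
  simp only [ht, hs]
  ext ((i | i) | (i | i)) ((j | j) | (j | j))
  -- This is the block `-Aᵀ`; the symmetries must first bring the entries with indices `(j, i)` to
  -- the order `(i, j)`.
  case inr.inl.inr.inl =>
    simp only [Matrix.fromBlocks_apply₂₂, Matrix.fromBlocks_apply₁₁, Matrix.of_apply, soA,
      h1 (.inl j) (.inl i), h3 j i, h2 (.inl j) i, ← h2 (.inl i) j]
    simp [isoBasis, isoBasisInv, Matrix.mul_apply, hent, Matrix.one_apply]
    ring
  all_goals
    simp [isoBasis, isoBasisInv, Matrix.mul_apply, hent, Matrix.one_apply,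
      Complex.mk_eq_add_mul_I, soT, soC, soA, soQ, soS, hconj, r1, r2, r3, r4]
    ring

lemma soCoeffs_surj (d : GenIdx n → ℝ) :
    ∃ X ∈ LieAlgebra.Orthogonal.so' (Fin (n + 2)) (Fin n) ℝ, soCoeffs X = d := by
  obtain ⟨t, c, A, θ, q, s, rfl⟩ := exists_coeffs d
  let τ : Fin n → Fin n → ℝ := fun k l => (sk (fun p => (t p : ℂ)) k l).re
  let σ : Fin n → Fin n → ℝ := fun k l => (sk (fun p => (s p : ℂ)) k l).re
  have hτ : ∀ k l, τ l k = -τ k l := fun k l => by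
    simp only [τ]; rw [sk_swap, Complex.neg_re]
  have hσ : ∀ k l, σ l k = -σ k l := fun k l => by
    simp only [σ]; rw [sk_swap, Complex.neg_re]
  have hτ' : ∀ p : Pairs n, τ p.1.1 p.1.2 = t p := fun p => by simp only [τ]; rw [sk_pair]; simp
  have hσ' : ∀ p : Pairs n, σ p.1.1 p.1.2 = s p := fun p => by simp only [σ]; rw [sk_pair]; simp
  -- The formulas for `soT`, `soS`, `soA`, `soC` and `soQ`, solved for the entries.
  let Z : Matrix ((Fin n ⊕ Fin 2) ⊕ Fin n) ((Fin n ⊕ Fin 2) ⊕ Fin n) ℝ :=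
    .fromBlocks
      (.fromBlocks (.of fun k l => (τ k l + σ k l + A k l - A l k) / 2)
        (.of fun k a => ![(c k).re + (q k).re, -(c k).im - (q k).im] a)
        (.of fun a k => -![(c k).re + (q k).re, -(c k).im - (q k).im] a) !![0, θ; -θ, 0])
      (.fromRows (.of fun k l => (-τ k l + σ k l + A k l + A l k) / 2)
        (.of fun a k => ![(c k).re - (q k).re, -(c k).im + (q k).im] a))
      (.fromCols (.of fun k l => (τ k l - σ k l + A k l + A l k) / 2)
        (.of fun k a => ![(c k).re - (q k).re, -(c k).im + (q k).im] a))
      (.of fun k l => (-τ k l - σ k l + A k l - A l k) / 2)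
  let X := Z.submatrix (soEquiv n).symm (soEquiv n).symm
  have hX : ∀ a b, ent X a b = Z a b := fun a b => by simp [ent, X]
  refine ⟨X, (mem_so'_iff X).2 ⟨?_, ?_, ?_⟩, ?_⟩
  · rintro (k | a) (l | b) <;> simp only [hX, Z, Matrix.fromBlocks_apply₁₁,
      Matrix.fromBlocks_apply₁₂, Matrix.fromBlocks_apply₂₁, Matrix.fromBlocks_apply₂₂,
      Matrix.of_apply, neg_neg]
    · rw [hτ k l, hσ k l]; ring
    · fin_cases a <;> fin_cases b <;> simp
  · rintro (k | a) l <;> simp only [hX, Z, Matrix.fromBlocks_apply₁₂, Matrix.fromBlocks_apply₂₁,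
      Matrix.fromRows_apply_inl, Matrix.fromRows_apply_inr, Matrix.fromCols_apply_inl,
      Matrix.fromCols_apply_inr, Matrix.of_apply]
    rw [hτ k l, hσ k l]; ring
  · intro k l
    simp only [hX, Z, Matrix.fromBlocks_apply₂₂, Matrix.of_apply]
    rw [hτ k l, hσ k l]; ring
  · rw [soCoeffs_apply]
    congr 1
    · funext p
      simp [soT, hX, Z, ← hτ']; ring
    · funext k
      apply Complex.ext <;> simp [soC, hX, Z]
    · funext k l
      simp [soA, hX, Z]; ring
    · simp [hX, Z]
    · funext k
      apply Complex.ext <;> simp [soQ, hX, Z]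
    · funext p
      simp [soS, hX, Z, ← hσ']; ring

lemma skewMat_comb_soCoeffs {X : Matrix (Fin (n + 2) ⊕ Fin n) (Fin (n + 2) ⊕ Fin n) ℝ}
    (hX : X ∈ LieAlgebra.Orthogonal.so' (Fin (n + 2)) (Fin n) ℝ) (x : Amb n) :
    skewMat (comb (soCoeffs X) x) = mob (soMat X) (skewMat x) := by
  rw [soCoeffs_apply, skewMat_comb, soMat_eq hX]

lemma lieBracket_comb_soCoeffs (X Y : LieAlgebra.Orthogonal.so' (Fin (n + 2)) (Fin n) ℝ)
    (x : Amb n) : VectorField.lieBracket ℂ (comb (soCoeffs X.1)) (comb (soCoeffs Y.1)) x =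
      -comb (soCoeffs (⁅X, Y⁆ : LieAlgebra.Orthogonal.so' (Fin (n + 2)) (Fin n) ℝ).1) x := by
  apply skewMat_injective
  rw [skewMat_lieBracket (skewMat_comb_soCoeffs X.2) (skewMat_comb_soCoeffs Y.2)
    (analyticOnNhd_comb _ Set.univ x trivial).differentiableAt
    (analyticOnNhd_comb _ Set.univ x trivial).differentiableAt, skewMat_neg,
    skewMat_comb_soCoeffs (⁅X, Y⁆ : LieAlgebra.Orthogonal.so' (Fin (n + 2)) (Fin n) ℝ).2,
    ← soMat_mul, ← soMat_mul, ← soMat_sub]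
  rfl

/-- The field of an element of `so(n + 2, n)`. -/
def soField (U : TopologicalSpace.Opens (Amb n)) :
    LieAlgebra.Orthogonal.so' (Fin (n + 2)) (Fin n) ℝ →ₗ⁅ℝ⁆ Hol U where
  -- The minus sign turns the antihomomorphism of `lieBracket_comb_soCoeffs` into a homomorphism.
  toFun X := -∑ g, soCoeffs X.1 g • genHol U g
  map_add' X Y := by
    have : soCoeffs (X + Y).1 = soCoeffs X.1 + soCoeffs Y.1 := map_add soCoeffs X.1 Y.1
    simp only [this, Pi.add_apply, add_smul, Finset.sum_add_distrib,
      neg_add]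
  map_smul' c X := by
    have : soCoeffs (c • X).1 = c • soCoeffs X.1 := map_smul soCoeffs c X.1
    simp only [this, Pi.smul_apply, smul_eq_mul, mul_smul,
      Finset.smul_sum, smul_neg, RingHom.id_apply]
  map_lie' {X Y} := hol_ext fun x hx => by
    rw [neg_lie, lie_neg, neg_neg, coe_bracket, Submodule.coe_neg, Pi.neg_apply,
      sum_genHol_apply _ hx, ← lieBracket_comb_soCoeffs]
    have h : ∀ d : GenIdx n → ℝ,
        ((∑ g, d g • genHol U g : Hol U) : Amb n → Amb n) =ᶠ[𝓝 x] comb d := fun d => by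
      filter_upwards [U.isOpen.mem_nhds hx] with y hy using sum_genHol_apply d hy
    rw [VectorField.lieBracket, VectorField.lieBracket, (h _).fderiv_eq, (h _).fderiv_eq,
      (h _).eq_of_nhds, (h _).eq_of_nhds]

theorem nonempty_lieEquiv (hn : 2 ≤ n) (U : TopologicalSpace.Opens (Amb n))
    (hU : IsConnected (U : Set (Amb n))) (hUM : ((U : Set (Amb n)) ∩ quadric n).Nonempty) :
    Nonempty (Hol U ≃ₗ⁅ℝ⁆ LieAlgebra.Orthogonal.so' (Fin (n + 2)) (Fin n) ℝ) := by
  have hb : ∀ d : GenIdx n → ℝ,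
      ∑ g, d g • genHol U g = (holBasis hn U hU hUM).equivFun.symm d := fun d => by
    simp [Module.Basis.equivFun_symm_apply, holBasis_apply]
  refine ⟨(LieEquiv.ofBijective (soField U) ⟨?_, ?_⟩).symm⟩
  · rw [injective_iff_map_eq_zero]
    intro X hX
    have h1 : -∑ g, soCoeffs X.1 g • genHol U g = 0 := hX
    rw [neg_eq_zero, hb, LinearEquiv.map_eq_zero_iff] at h1
    exact Subtype.ext (soCoeffs_injOn X.2 h1)
  · intro Y
    obtain ⟨X, hX, h⟩ := soCoeffs_surj (-(holBasis hn U hU hUM).equivFun Y)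
    refine ⟨⟨X, hX⟩, ?_⟩
    change -∑ g, soCoeffs X g • genHol U g = Y
    rw [h, hb, map_neg, neg_neg, LinearEquiv.symm_apply_apply]

end SOQuadric

end

/-! ### Assembly of the theorem -/

theorem mainTheorem3 (n : ℕ) (hn : 2 ≤ n)
    (U : TopologicalSpace.Opens (SOQuadric.Amb n))
    (hU : IsConnected (U : Set (SOQuadric.Amb n)))
    (hUM : ((U : Set (SOQuadric.Amb n)) ∩ SOQuadric.quadric n).Nonempty) :
    -- `hol(M)` is a graded Lie algebra, concentrated in the degrees `-2, ..., 2`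
    DirectSum.IsInternal (fun k : ℤ => SOQuadric.grade U k) ∧
    (∀ (a b : ℤ) (X Y : SOQuadric.Hol U), X ∈ SOQuadric.grade U a → Y ∈ SOQuadric.grade U b →
      ⁅X, Y⁆ ∈ SOQuadric.grade U (a + b)) ∧
    (∀ k : ℤ, 3 ≤ |k| → SOQuadric.grade U k = ⊥) ∧
    -- the dimensions of the graded pieces
    Module.finrank ℝ (SOQuadric.grade U (-2)) = n * (n - 1) / 2 ∧
    Module.finrank ℝ (SOQuadric.grade U (-1)) = 2 * n ∧
    Module.finrank ℝ (SOQuadric.grade U 0) = n ^ 2 + 1 ∧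
    Module.finrank ℝ (SOQuadric.grade U 1) = 2 * n ∧
    Module.finrank ℝ (SOQuadric.grade U 2) = n * (n - 1) / 2 ∧
    -- the generators of the graded pieces
    SOQuadric.fields (SOQuadric.grade U (-2)) =
      SOQuadric.spanOn U (Set.range SOQuadric.Lm2) ∧
    SOQuadric.fields (SOQuadric.grade U (-1)) =
      SOQuadric.spanOn U (Set.range SOQuadric.Lm1 ∪ Set.range SOQuadric.ILm1) ∧
    SOQuadric.fields (SOQuadric.grade U 0) =
      SOQuadric.spanOn U ({L | ∃ i j : Fin n, L = SOQuadric.L0 i j} ∪ {SOQuadric.Rot}) ∧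
    SOQuadric.fields (SOQuadric.grade U 1) =
      SOQuadric.spanOn U (Set.range SOQuadric.L1 ∪ Set.range SOQuadric.IL1) ∧
    SOQuadric.fields (SOQuadric.grade U 2) =
      SOQuadric.spanOn U (Set.range SOQuadric.L2) ∧
    -- the Lie algebra itself
    Nonempty (SOQuadric.Hol U ≃ₗ⁅ℝ⁆ LieAlgebra.Orthogonal.so' (Fin (n + 2)) (Fin n) ℝ) := by
  open SOQuadric in
  refine ⟨grading_isInternal (b := holBasis hn U hU hUM) (d := deg) (e := eulerHol U)
      (fun k X hX => euler_lie hX) fun g => by rw [holBasis_apply]; exact genHol_mem_grade g,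
    fun a b X Y hX hY => grading_lie_mem (V := grade U) (b := holBasis hn U hU hUM) (d := deg)
      (e := eulerHol U) (fun k X hX => euler_lie hX)
      (fun g => by rw [holBasis_apply]; exact genHol_mem_grade g) hX hY,
    fun k hk => grade_eq_bot hn hU hUM hk, ?_, ?_, ?_, ?_, ?_, ?_, ?_, ?_, ?_, ?_,
    nonempty_lieEquiv hn U hU hUM⟩
  · rw [finrank_grade hn hU hUM Sum.inl_injective deg_eq_neg_two, card_pairs]
  · rw [finrank_grade hn hU hUM (Sum.inr_injective.comp Sum.inl_injective) deg_eq_neg_one]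
    simp [two_mul]
  · rw [finrank_grade hn hU hUM
      (Sum.inr_injective.comp (Sum.inr_injective.comp Sum.inl_injective)) deg_eq_zero]
    simp [sq]
  · rw [finrank_grade hn hU hUM (Sum.inr_injective.comp
      (Sum.inr_injective.comp (Sum.inr_injective.comp Sum.inl_injective))) deg_eq_one]
    simp [two_mul]
  · rw [finrank_grade hn hU hUM (Sum.inr_injective.comp
      (Sum.inr_injective.comp (Sum.inr_injective.comp Sum.inr_injective))) deg_eq_two, card_pairs]
  · refine fields_grade hn hU hUM _ ?_
    rw [deg_eq_neg_two, ← Set.range_comp]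
    rfl
  · refine fields_grade hn hU hUM _ ?_
    rw [deg_eq_neg_one, ← Set.range_comp]
    exact Set.Sum.elim_range Lm1 ILm1
  · refine fields_grade hn hU hUM _ ?_
    rw [deg_eq_zero, ← Set.range_comp]
    refine (Set.Sum.elim_range (fun p : Fin n × Fin n => L0 p.1 p.2) fun _ : Unit => Rot).trans ?_
    congr 1
    · ext L
      simp [eq_comm]
    · ext L
      simp
  · refine fields_grade hn hU hUM _ ?_
    rw [deg_eq_one, ← Set.range_comp]
    exact Set.Sum.elim_range L1 IL1
  · refine fields_grade hn hU hUM _ ?_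
    rw [deg_eq_two, ← Set.range_comp]
    rfl
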